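/- Let $\phi:\mathbb C\to\mathbb R$ be subharmonic, let $dA$ be Lebesgue measure on $\mathbb C$, and write $\partial=\tfrac12(\partial_x-i\partial_y)$ and $\Delta=\tfrac14(\partial_x^2+\partial_y^2)$, where $\Delta\phi$ is understood in the sense of distributions. Let $\mathcal F_\phi$ be the space of entire functions $f$ with $\|f\|_\phi^2=\int_{\mathbb C}|f|^2e^{-\phi}\,dA<\infty$, and put $\bar\partial^*_\phi f=-e^{\phi}\,\partial(e^{-\phi}f)$. Let $\Lambda\subseteq\mathbb C$ be separated, i.e. $\inf\{|\lambda-\lambda'|:\lambda\neq\lambda'\in\Lambda\}>0$, let $m_\Lambda:\Lambda\to\mathbb N$ be a bounded multiplicity function (the value $0$ is allowed), and let $n_\Lambda=\sup_{\lambda\in\Lambda}m_\Lambda(\lambda)-1$. Assume that $(\Lambda,m_\Lambda)$ and $\phi$ are compatible: $\Delta\phi$ is a function with $m<\Delta\phi<M$ for some constants $m,M>0$, and, in case $n_\Lambda\ge2$, moreover $\phi\in C^{n_\Lambda+1}(\mathbb C)$ and $\sup_{z\in\mathbb C}|\partial^j\Delta\phi(z)|<\infty$ for $j=1,\dots,n_\Lambda-1$.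 Assume in addition that $\Delta\phi$ is continuous. For $r>0$ let $\chi_r=\frac1{\pi r^2}1_{B(0,r)}$, and let $\nu=\sum_{\lambda\in\Lambda}m_\Lambda(\lambda)\,\delta_\lambda$. Suppose that there are $\delta>0$ and $r>0$ such that $$\pi\,(\nu\star\chi_r)(z)>\Delta\phi(z)+\delta\qquad\text{for all }z\in\mathbb C.$$ Then $(\Lambda,m_\Lambda)$ is a sampling set for $\mathcal F_\phi$: there are constants $A,B>0$ such that for all $f\in\mathcal F_\phi$ $$A\|f\|_\phi^2\le\sum_{\lambda\in\Lambda}\ \sum_{j=0}^{m_\Lambda(\lambda)-1}\bigl|(\bar\partial^*_\phi)^{j}f(\lambda)\bigr|^2e^{-\phi(\lambda)}\le B\|f\|_\phi^2 .$$ -/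

import Mathlib

open MeasureTheory
open scoped ContDiff

noncomputable section

namespace FockSampling

/-- A set with multiplicities `(Λ, m_Λ)`: a set `Λ ⊆ ℂ` with a bounded function
`m_Λ : Λ → ℕ`. -/
structure MultSet where
  carrier : Set ℂ
  mult : carrier → ℕ
  bddAbove_mult : BddAbove (Set.range mult)

/-- `n_Λ = sup m_Λ - 1`. -/
def MultSet.n (Λ : MultSet) : ℕ := (⨆ p : Λ.carrier, Λ.mult p) - 1

/-- `Λ` is uniformly separated: distinct points have distances bounded below by some `ρ > 0`. -/
def MultSet.Separated (Λ : MultSet) : Prop :=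
  ∃ ρ : ℝ, 0 < ρ ∧ ∀ p ∈ Λ.carrier, ∀ q ∈ Λ.carrier, p ≠ q → ρ ≤ dist p q

/-- The measure `ν = ∑_{λ ∈ Λ} m_Λ(λ) δ_λ`. -/
def MultSet.nu (Λ : MultSet) : Measure ℂ :=
  Measure.sum fun p : Λ.carrier => Λ.mult p • Measure.dirac (p : ℂ)

/-- The normalized indicator `χ_r = (π r²)⁻¹ 1_{B(0,r)}`. -/
def chi (r : ℝ) : ℂ → ℝ :=
  (Metric.ball (0 : ℂ) r).indicator fun _ => 1 / (Real.pi * r ^ 2)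

/-- The convolution `(ν ⋆ χ_r)(z)`. -/
def MultSet.nuConvChi (Λ : MultSet) (r : ℝ) (z : ℂ) : ℝ := ∫ w, chi r (z - w) ∂Λ.nu

/-- Wirtinger derivative `∂ = (∂_x - i ∂_y) / 2`. -/
def wirtinger (f : ℂ → ℂ) (z : ℂ) : ℂ :=
  (1 / 2) * (fderiv ℝ f z 1 - Complex.I * fderiv ℝ f z Complex.I)

/-- The operator `f ↦ -e^φ ∂(e^{-φ} f)`, the formal adjoint of `∂̄` in `L²(e^{-φ} dA)`.
The `j`-th power is the iterate `(dbarStar φ)^[j]`. -/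
def dbarStar (φ : ℂ → ℝ) (f : ℂ → ℂ) (z : ℂ) : ℂ :=
  -(Real.exp (φ z) : ℂ) * wirtinger (fun w => (Real.exp (-φ w) : ℂ) * f w) z

/-- The normalized pointwise Laplacian `(∂_x² + ∂_y²) / 4`, for functions of class `C²`. -/
def quarterLaplacian (u : ℂ → ℝ) (z : ℂ) : ℝ := (1 / 4) * Laplacian.laplacian u z

/-- `L` is the (normalized) Laplacian of `φ` in the sense of distributions. -/
def IsDistribLaplacian (φ L : ℂ → ℝ) : Prop :=
  LocallyIntegrable φ ∧ LocallyIntegrable L ∧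
    ∀ η : ℂ → ℝ, ContDiff ℝ ∞ η → HasCompactSupport η →
      ∫ z, φ z * quarterLaplacian η z = ∫ z, L z * η z

/-- Real-valued subharmonic functions on `ℂ`: upper semicontinuous with the sub-mean value
property on all circles. (Finite-valued subharmonic functions are integrable on every circle.) -/
def Subharmonic (φ : ℂ → ℝ) : Prop :=
  UpperSemicontinuous φ ∧
    ∀ (c : ℂ) (R : ℝ), 0 < R → CircleIntegrable φ c R ∧ φ c ≤ Real.circleAverage φ c R

/-- Compatibility of `(Λ, m_Λ)` and `φ`: the distributional Laplacian of `φ` is a function bounded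
above and below by positive constants; if `n_Λ ≥ 2`, moreover `φ` is of class `C^{n_Λ + 1}` and
`∂^j Δφ` is bounded for `1 ≤ j ≤ n_Λ - 1`. -/
def Compatible (Λ : MultSet) (φ : ℂ → ℝ) : Prop :=
  (∃ L : ℂ → ℝ, IsDistribLaplacian φ L ∧
    ∃ c C : ℝ, 0 < c ∧ ∀ z, c < L z ∧ L z < C) ∧
  (2 ≤ Λ.n → ContDiff ℝ ((Λ.n + 1 : ℕ) : ℕ∞) φ ∧
    ∀ j : ℕ, 1 ≤ j → j ≤ Λ.n - 1 →
      ∃ C : ℝ, ∀ z, ‖wirtinger^[j] (fun w => (quarterLaplacian φ w : ℂ)) z‖ ≤ C)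

/-- Membership in the weighted Fock space: entire functions with
`∫ |f|² e^{-φ} dA < ∞`. -/
def MemFock (φ : ℂ → ℝ) (f : ℂ → ℂ) : Prop :=
  Differentiable ℂ f ∧ Integrable fun z => ‖f z‖ ^ 2 * Real.exp (-φ z)

/-- The squared norm `‖f‖_φ² = ∫ |f|² e^{-φ} dA`. -/
def fockNormSq (φ : ℂ → ℝ) (f : ℂ → ℂ) : ℝ := ∫ z, ‖f z‖ ^ 2 * Real.exp (-φ z)

/-- `∑_{j < m_Λ(λ)} |(∂̄*_φ)^j f(λ)|² e^{-φ(λ)}`, the contribution of one point `λ ∈ Λ`. -/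
def MultSet.sampleEnergy (Λ : MultSet) (φ : ℂ → ℝ) (f : ℂ → ℂ) (p : Λ.carrier) : ℝ :=
  ∑ j ∈ Finset.range (Λ.mult p), ‖(dbarStar φ)^[j] f p‖ ^ 2 * Real.exp (-φ p)

/-- `(Λ, m_Λ)` is a sampling set for the Fock space with weight `φ`. -/
def IsSampling (Λ : MultSet) (φ : ℂ → ℝ) : Prop :=
  ∃ A B : ℝ, 0 < A ∧ 0 < B ∧ ∀ f : ℂ → ℂ, MemFock φ f →
    Summable (Λ.sampleEnergy φ f) ∧
    A * fockNormSq φ f ≤ ∑' p, Λ.sampleEnergy φ f p ∧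
    ∑' p, Λ.sampleEnergy φ f p ≤ B * fockNormSq φ f

end FockSampling

end

noncomputable section

namespace FockSampling

open Filter Topology

/-! For entire `f` and a real weight `ψ`, the function `u = |f|² e^{-ψ}` satisfies `Δu = -Δψ · u +
|f' - f ∂ψ|² e^{-ψ}`, hence `Δu ≥ -Δψ · u`. Tested against cutoffs `κ`, this bounds the integral of
`u` over the region where `Δψ` is negative by its integral over the rest. Take `ψ = φ + v`, where
`v` is a sum of potentials `m_Λ(λ) G(|z - λ|²)` and `G` is a logarithm of strength at most `q < 1`,
flattened inside `|z - λ| < ε` and cut off at a fixed distance. Outside the `ε`-discs each potential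
has nonpositive Laplacian, at most `-θ/r²` up to distance `r`. Since the averaged counting function
exceeds `Δφ + δ`, a suitable `θ < 1` yields `Δφ + Δv ≤ -δ/2` off the `ε`-discs
(`exists_radial_potential`, `exists_potential`).

On the `ε`-discs `Δψ` is only bounded by `A/ε²`, but there `f` is controlled by its jet at `λ`:
`|f|² e^{-φ}` is at most a constant times the sampled energy plus `|z - λ|^{2m}` times the local
norm, with `m = m_Λ(λ)` (`exists_local_estimates`). The factor `e^{-v}` is of size at most
`ε^{-2mq}`, so the second term gains a power `ε^{2(1-q)}`. The factor `1/ε²` is cancelled by the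
area of the disc. For small `ε` the sum of the second terms is absorbed into the left side, and the
lower sampling bound remains once the cutoff tends to `1` (`cutoff_estimate`, `isSampling`). The
upper bound is a Cauchy estimate on disjoint discs.

The jet estimates rest on a gauge. Near each point `φ = Re h + p` with `h` holomorphic, `p` bounded
uniformly in the point, and the pure `∂`-derivatives of `p` vanishing at the point; then `(∂̄*_φ)^j
f` there is, up to a factor of known modulus, the `j`-th complex derivative of `f e^{-h/2}`
(`dbarStar_iterate_gauge`, `exists_gauge`). The gauge exists because `∂φ` is locally a holomorphic
function plus the Cauchy transform of a localized `Δφ` (`exists_wirtinger_decomposition`): the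
holomorphic part is integrated into `h`, together with a polynomial that cancels the jet of the
Cauchy transform. -/

/-- The Wirtinger derivative `∂̄ = (∂_x + i ∂_y) / 2`. -/
def dbar (f : ℂ → ℂ) (z : ℂ) : ℂ :=
  (1 / 2) * (fderiv ℝ f z 1 + Complex.I * fderiv ℝ f z Complex.I)

/-! ### Wirtinger calculus and the gauge identity for powers of `dbarStar` -/

lemma wirtinger_congr {f g : ℂ → ℂ} {z : ℂ} (h : f =ᶠ[𝓝 z] g) : wirtinger f z = wirtinger g z := by
  simp only [wirtinger, h.fderiv_eq]

lemma wirtinger_eventuallyEq {f g : ℂ → ℂ} {z : ℂ} (h : f =ᶠ[𝓝 z] g) :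
    wirtinger f =ᶠ[𝓝 z] wirtinger g := by
  filter_upwards [h.eventuallyEq_nhds] with w hw using wirtinger_congr hw

lemma wirtinger_iterate_eventuallyEq {f g : ℂ → ℂ} {z : ℂ} (h : f =ᶠ[𝓝 z] g) (j : ℕ) :
    wirtinger^[j] f =ᶠ[𝓝 z] wirtinger^[j] g := by
  induction j with
  | zero => simpa using h
  | succ j ih =>
    simp only [Function.iterate_succ_apply']
    exact wirtinger_eventuallyEq ih

lemma wirtinger_const_mul (c : ℂ) (f : ℂ → ℂ) (z : ℂ) :
    wirtinger (fun w => c * f w) z = c * wirtinger f z := by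
  have : fderiv ℝ (fun w => c * f w) z = c • fderiv ℝ f z := by
    exact congrFun (fderiv_const_smul_field (𝕜 := ℝ) (f := f) c) z
  simp only [wirtinger, this, _root_.smul_apply, smul_eq_mul]
  ring

lemma wirtinger_add {f g : ℂ → ℂ} {z : ℂ} (hf : DifferentiableAt ℝ f z)
    (hg : DifferentiableAt ℝ g z) :
    wirtinger (fun w => f w + g w) z = wirtinger f z + wirtinger g z := by
  simp only [wirtinger, fderiv_fun_add hf hg, _root_.add_apply]
  ring

lemma wirtinger_mul {f g : ℂ → ℂ} {z : ℂ} (hf : DifferentiableAt ℝ f z)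
    (hg : DifferentiableAt ℝ g z) :
    wirtinger (fun w => f w * g w) z = wirtinger f z * g z + f z * wirtinger g z := by
  simp only [wirtinger, fderiv_fun_mul hf hg, _root_.add_apply,
    _root_.smul_apply, smul_eq_mul]
  ring

lemma wirtinger_holomorphic {f : ℂ → ℂ} {z : ℂ} (hf : DifferentiableAt ℂ f z) :
    wirtinger f z = deriv f z := by
  have h : fderiv ℝ f z = (fderiv ℂ f z).restrictScalars ℝ := hf.fderiv_restrictScalars ℝ
  have hI : fderiv ℂ f z Complex.I = Complex.I * deriv f z := by
    simp
  simp only [wirtinger, h, ContinuousLinearMap.coe_restrictScalars', fderiv_apply_one_eq_deriv, hI]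
  linear_combination (-(1 / 2) * deriv f z) * Complex.I_mul_I

lemma wirtinger_conj {f : ℂ → ℂ} {z : ℂ} (hf : DifferentiableAt ℂ f z) :
    wirtinger (fun w => (starRingEnd ℂ) (f w)) z = 0 := by
  have h : fderiv ℝ f z = (fderiv ℂ f z).restrictScalars ℝ := hf.fderiv_restrictScalars ℝ
  have hI : fderiv ℂ f z Complex.I = Complex.I * deriv f z := by
    simp
  have hc : fderiv ℝ (fun w => (starRingEnd ℂ) (f w)) z
      = (Complex.conjCLE : ℂ →L[ℝ] ℂ).comp (fderiv ℝ f z) :=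
    ((Complex.conjCLE : ℂ →L[ℝ] ℂ).hasFDerivAt.comp z
      (hf.restrictScalars ℝ).hasFDerivAt).fderiv
  simp only [wirtinger, hc, h, ContinuousLinearMap.comp_apply,
    ContinuousLinearMap.coe_restrictScalars', fderiv_apply_one_eq_deriv, hI]
  simp
  linear_combination ((starRingEnd ℂ) (deriv f z)) * Complex.I_mul_I

lemma wirtinger_cexp {g : ℂ → ℂ} {z : ℂ} (hg : DifferentiableAt ℝ g z) :
    wirtinger (fun w => Complex.exp (g w)) z = Complex.exp (g z) * wirtinger g z := by
  simp only [wirtinger, (hg.hasFDerivAt.cexp).fderiv, _root_.smul_apply, smul_eq_mul]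
  ring

lemma ContDiffAt.wirtinger_of_succ {f : ℂ → ℂ} {z : ℂ} {n : ℕ}
    (hf : ContDiffAt ℝ ((n + 1 : ℕ) : ℕ∞) f z) : ContDiffAt ℝ (n : ℕ∞) (wirtinger f) z := by
  have h : ContDiffAt ℝ (n : ℕ∞) (fderiv ℝ f) z := hf.fderiv_right (by norm_cast)
  unfold wirtinger
  exact contDiffAt_const.mul ((h.clm_apply contDiffAt_const).sub
    (contDiffAt_const.mul (h.clm_apply contDiffAt_const)))

lemma ContDiffAt.wirtinger_iterate {n j : ℕ} : ∀ {f : ℂ → ℂ} {z : ℂ},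
    ContDiffAt ℝ ((n + j : ℕ) : ℕ∞) f z → ContDiffAt ℝ (n : ℕ∞) (wirtinger^[j] f) z := by
  induction j with
  | zero => intro f z hf; simpa using hf
  | succ j ih =>
    intro f z hf
    rw [Function.iterate_succ_apply]
    exact ih (ContDiffAt.wirtinger_of_succ (by simpa [add_assoc] using hf))

lemma ContDiffAt.eventually_differentiableAt {f : ℂ → ℂ} {z : ℂ} {n : ℕ} (hn : 1 ≤ n)
    (hf : ContDiffAt ℝ (n : ℕ∞) f z) : ∀ᶠ w in 𝓝 z, DifferentiableAt ℝ f w := by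
  have h1 : ContDiffAt ℝ 1 f z := hf.of_le (by exact_mod_cast hn)
  filter_upwards [h1.eventually (by simp)] with w hw using hw.differentiableAt (by simp)

lemma wirtinger_iterate_add {z : ℂ} : ∀ (i : ℕ) {u v : ℂ → ℂ}, ContDiffAt ℝ (i : ℕ∞) u z →
    ContDiffAt ℝ (i : ℕ∞) v z →
    wirtinger^[i] (fun w => u w + v w) z = wirtinger^[i] u z + wirtinger^[i] v z := by
  intro i
  induction i with
  | zero => intros; simp
  | succ i ihi =>
    intro u v hu hv
    simp only [Function.iterate_succ_apply]
    have e : wirtinger (fun w => u w + v w) =ᶠ[𝓝 z] fun w => wirtinger u w + wirtinger v w := by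
      filter_upwards [ContDiffAt.eventually_differentiableAt (by omega) hu,
        ContDiffAt.eventually_differentiableAt (by omega) hv] with w h1 h2
        using wirtinger_add h1 h2
    rw [(wirtinger_iterate_eventuallyEq e i).eq_of_nhds]
    exact ihi (ContDiffAt.wirtinger_of_succ hu) (ContDiffAt.wirtinger_of_succ hv)

/-- The class of functions with vanishing pure `∂`-derivatives up to order `k` is an ideal. -/
lemma wirtinger_iterate_mul_eq_zero {z : ℂ} (k : ℕ) : ∀ {a b : ℂ → ℂ},
    ContDiffAt ℝ (k : ℕ∞) a z → ContDiffAt ℝ (k : ℕ∞) b z →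
    (∀ i ≤ k, wirtinger^[i] a z = 0) → ∀ i ≤ k, wirtinger^[i] (fun w => a w * b w) z = 0 := by
  induction k with
  | zero =>
    intro a b _ _ h i hi
    obtain rfl : i = 0 := by omega
    have := h 0 le_rfl
    simp only [Function.iterate_zero, id] at this ⊢
    simp [this]
  | succ k ih =>
    intro a b ha hb h i hi
    have ha' : ContDiffAt ℝ (k : ℕ∞) a z := ha.of_le (by norm_cast; omega)
    have hb' : ContDiffAt ℝ (k : ℕ∞) b z := hb.of_le (by norm_cast; omega)
    rcases i with _ | i
    · exact ih ha' hb' (fun i hi => h i (by omega)) 0 (by omega)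
    rw [Function.iterate_succ_apply]
    have e : wirtinger (fun w => a w * b w)
        =ᶠ[𝓝 z] fun w => wirtinger a w * b w + a w * wirtinger b w := by
      filter_upwards [ContDiffAt.eventually_differentiableAt (by omega) ha,
        ContDiffAt.eventually_differentiableAt (by omega) hb] with w h1 h2 using wirtinger_mul h1 h2
    rw [(wirtinger_iterate_eventuallyEq e i).eq_of_nhds]
    have hda := ContDiffAt.wirtinger_of_succ ha
    have hdb := ContDiffAt.wirtinger_of_succ hb
    have le1 : ((i : ℕ∞) : WithTop ℕ∞) ≤ (k : ℕ∞) := by norm_cast; omega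
    -- Both Leibniz terms are covered by the induction: `∂a` satisfies the vanishing hypothesis with
    -- indices shifted by one, and `a` satisfies it as it stands.
    rw [wirtinger_iterate_add i ((hda.mul hb').of_le le1) ((ha'.mul hdb).of_le le1),
      ih hda hb' (fun l hl => by
        have := h (l + 1) (by omega)
        rwa [Function.iterate_succ_apply] at this) i (by omega),
      ih ha' hdb (fun l hl => h l (by omega)) i (by omega), add_zero]

/-- `dbarStar φ` is `-∂` conjugated by multiplication with `e^{-φ}`, so the inner exponentials
cancel under iteration. No smoothness is required. -/
lemma dbarStar_iterate (φ : ℂ → ℝ) (f : ℂ → ℂ) (j : ℕ) (z : ℂ) :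
    (dbarStar φ)^[j] f z = (-1) ^ j * (Real.exp (φ z) : ℂ) *
      wirtinger^[j] (fun w => (Real.exp (-φ w) : ℂ) * f w) z := by
  induction j generalizing z with
  | zero =>
    simp [← mul_assoc, ← Complex.exp_add]
  | succ j ih =>
    rw [Function.iterate_succ_apply', dbarStar]
    have : (fun w => (Real.exp (-φ w) : ℂ) * (dbarStar φ)^[j] f w) = fun w => (-1) ^ j *
        wirtinger^[j] (fun w => (Real.exp (-φ w) : ℂ) * f w) w := by
      ext w
      rw [ih w]
      have : (Real.exp (-φ w) : ℂ) * (Real.exp (φ w) : ℂ) = 1 := by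
        rw [← Complex.ofReal_mul, ← Real.exp_add]; simp
      linear_combination ((-1) ^ j *
        wirtinger^[j] (fun w => (Real.exp (-φ w) : ℂ) * f w) w) * this
    rw [this, wirtinger_const_mul, Function.iterate_succ_apply']
    ring

/-- Antiholomorphic factors are constants for `∂`. Equality near `z`, and not only at `z`, is what
lets the induction differentiate once more. -/
lemma wirtinger_iterate_antiholomorphic_mul {z : ℂ} {h Q : ℂ → ℂ} (hh : AnalyticAt ℂ h z) (j : ℕ)
    (hQ : ContDiffAt ℝ (j : ℕ∞) Q z) :
    wirtinger^[j] (fun w => (starRingEnd ℂ) (h w) * Q w)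
      =ᶠ[𝓝 z] fun w => (starRingEnd ℂ) (h w) * wirtinger^[j] Q w := by
  induction j with
  | zero => simp only [Function.iterate_zero, id]; exact EventuallyEq.rfl
  | succ j ih =>
    simp only [Function.iterate_succ_apply']
    have hd : ∀ᶠ w in 𝓝 z, DifferentiableAt ℂ h w := by
      filter_upwards [hh.eventually_analyticAt] with w hw using hw.differentiableAt
    have hQ' : ContDiffAt ℝ ((1 : ℕ) : ℕ∞) (wirtinger^[j] Q) z :=
      ContDiffAt.wirtinger_iterate (by rw [add_comm 1 j]; exact hQ)
    refine (wirtinger_eventuallyEq (ih (hQ.of_le (by norm_cast; omega)))).trans ?_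
    filter_upwards [hd, ContDiffAt.eventually_differentiableAt le_rfl hQ'] with w h1 h2
    have hc : DifferentiableAt ℝ (fun w => (starRingEnd ℂ) (h w)) w :=
      (Complex.conjCLE : ℂ →L[ℝ] ℂ).differentiableAt.comp w (h1.restrictScalars ℝ)
    rw [wirtinger_mul hc h2, wirtinger_conj h1, zero_mul, zero_add]

/-- One derivative gives `e^{-p} F'` plus a multiple of `∂p`. The multiple lies in the ideal of
functions with vanishing pure `∂`-derivatives at `z`, so it never contributes, and the induction
continues with `F'` in place of `F`. -/
lemma wirtinger_iterate_exp_mul {z : ℂ} {p : ℂ → ℝ} (n : ℕ) (hp : ContDiffAt ℝ (n : ℕ∞) p z)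
    (hz : ∀ i < n, wirtinger^[i] (wirtinger fun w => (p w : ℂ)) z = 0) (j : ℕ) (hj : j ≤ n) :
    ∀ {F : ℂ → ℂ}, AnalyticAt ℂ F z →
    wirtinger^[j] (fun w => Complex.exp (-(p w : ℂ)) * F w) z
      = Complex.exp (-(p z : ℂ)) * iteratedDeriv j F z := by
  induction j with
  | zero => intro F _; simp
  | succ j ih =>
    intro F hF
    have hpc : ContDiffAt ℝ (n : ℕ∞) (fun w => (p w : ℂ)) z :=
      Complex.ofRealCLM.contDiff.contDiffAt.comp z hp
    have hF' : AnalyticAt ℂ (deriv F) z := hF.deriv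
    have cF : ContDiffAt ℝ (n : ℕ∞) F z := (hF.contDiffAt).restrict_scalars ℝ
    have cF' : ContDiffAt ℝ (n : ℕ∞) (deriv F) z := (hF'.contDiffAt).restrict_scalars ℝ
    have cE : ContDiffAt ℝ (n : ℕ∞) (fun w => Complex.exp (-(p w : ℂ))) z :=
      Complex.contDiff_exp.contDiffAt.comp z hpc.neg
    have cdp : ContDiffAt ℝ (j : ℕ∞) (wirtinger fun w => (p w : ℂ)) z :=
      ContDiffAt.wirtinger_of_succ (hpc.of_le (by norm_cast))
    have lej : ((j : ℕ∞) : WithTop ℕ∞) ≤ (n : ℕ∞) := by norm_cast; omega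
    rw [Function.iterate_succ_apply]
    have e : wirtinger (fun w => Complex.exp (-(p w : ℂ)) * F w) =ᶠ[𝓝 z]
        fun w => Complex.exp (-(p w : ℂ)) * deriv F w +
          (wirtinger (fun w => (p w : ℂ)) w) * (-(Complex.exp (-(p w : ℂ)) * F w)) := by
      filter_upwards [ContDiffAt.eventually_differentiableAt (by omega) hpc,
        hF.eventually_analyticAt] with w h1 h2
      have h3 : DifferentiableAt ℝ (fun w => Complex.exp (-(p w : ℂ))) w := h1.neg.cexp
      rw [wirtinger_mul h3 (h2.differentiableAt.restrictScalars ℝ),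
        wirtinger_holomorphic h2.differentiableAt,
        wirtinger_cexp (g := fun w => -(p w : ℂ)) h1.neg]
      have : wirtinger (fun w => -(p w : ℂ)) w = - wirtinger (fun w => (p w : ℂ)) w := by
        simpa using wirtinger_const_mul (-1) (fun w => (p w : ℂ)) w
      rw [this]
      ring
    rw [(wirtinger_iterate_eventuallyEq e j).eq_of_nhds,
      wirtinger_iterate_add j ((cE.mul cF').of_le lej) (cdp.mul ((cE.mul cF).neg.of_le lej)),
      wirtinger_iterate_mul_eq_zero j cdp ((cE.mul cF).neg.of_le lej)
        (fun i hi => hz i (by omega)) j le_rfl, add_zero, ih (by omega) hF',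
      iteratedDeriv_succ']

/-- In the gauge `φ = Re h + p` with vanishing pure `∂`-derivatives of `p` at `z`, the operators
`(∂̄*_φ)^j` at `z` are the complex derivatives of `f e^{-h/2}`. -/
lemma dbarStar_iterate_gauge {z : ℂ} {φ : ℂ → ℝ} {h f : ℂ → ℂ} (n : ℕ)
    (hφ : ContDiffAt ℝ (n : ℕ∞) φ z) (hh : AnalyticAt ℂ h z) (hf : AnalyticAt ℂ f z)
    (h0 : φ z = (h z).re)
    (hz : ∀ i < n, wirtinger^[i] (wirtinger fun w => ((φ w - (h w).re : ℝ) : ℂ)) z = 0)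
    (j : ℕ) (hj : j ≤ n) :
    ‖(dbarStar φ)^[j] f z‖ ^ 2 * Real.exp (-φ z)
      = ‖iteratedDeriv j (fun w => f w * Complex.exp (-h w / 2)) z‖ ^ 2 := by
  set F := fun w => f w * Complex.exp (-h w / 2) with hFdef
  set p : ℂ → ℝ := fun w => φ w - (h w).re with hpdef
  have hF : AnalyticAt ℂ F z := hf.mul (hh.neg.div analyticAt_const (by norm_num)).cexp
  have hhe : AnalyticAt ℂ (fun w => Complex.exp (-h w / 2)) z :=
    (hh.neg.div analyticAt_const (by norm_num)).cexp
  have chr : ContDiffAt ℝ (n : ℕ∞) (fun w => (h w).re) z :=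
    Complex.reCLM.contDiff.contDiffAt.comp z (hh.contDiffAt.restrict_scalars ℝ)
  have hp : ContDiffAt ℝ (n : ℕ∞) p z := hφ.sub chr
  have hpc : ContDiffAt ℝ (n : ℕ∞) (fun w => (p w : ℂ)) z :=
    Complex.ofRealCLM.contDiff.contDiffAt.comp z hp
  have cE : ContDiffAt ℝ (n : ℕ∞) (fun w => Complex.exp (-(p w : ℂ))) z :=
    Complex.contDiff_exp.contDiffAt.comp z hpc.neg
  have cF : ContDiffAt ℝ (n : ℕ∞) F z := (hF.contDiffAt).restrict_scalars ℝ
  -- Here `e^{-φ} = conj(e^{-h/2}) · e^{-p} · e^{-h/2}`: the first factor is antiholomorphic and the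
  -- last one is absorbed into `F`.
  have e : (fun w => (Real.exp (-φ w) : ℂ) * f w) = fun w =>
      (starRingEnd ℂ) (Complex.exp (-h w / 2)) * (Complex.exp (-(p w : ℂ)) * F w) := by
    ext w
    have : (Real.exp (-φ w) : ℂ) = (starRingEnd ℂ) (Complex.exp (-h w / 2)) *
        (Complex.exp (-(p w : ℂ)) * Complex.exp (-h w / 2)) := by
      rw [← Complex.exp_conj, ← Complex.exp_add, ← Complex.exp_add, Complex.ofReal_exp]
      congr 1
      have h2 : (starRingEnd ℂ) (h w) = 2 * ((h w).re : ℂ) - h w := by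
        have := Complex.add_conj (h w)
        push_cast at this
        linear_combination this
      simp only [map_div₀, map_neg, h2, hpdef, map_ofNat]
      push_cast
      ring
    rw [this]
    simp only [hFdef]
    ring
  rw [dbarStar_iterate, e, (wirtinger_iterate_antiholomorphic_mul hhe j
    ((cE.mul cF).of_le (by norm_cast))).eq_of_nhds, wirtinger_iterate_exp_mul n hp hz j hj hF]
  have p0 : p z = 0 := by simp [hpdef, h0]
  have n1 : ‖Complex.exp (-h z / 2)‖ = Real.exp (-φ z / 2) := by
    rw [Complex.norm_exp, h0]; simp
  rw [p0]
  simp only [norm_mul, norm_pow, norm_neg, norm_one, one_pow, one_mul, RCLike.norm_conj, n1,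
    Complex.ofReal_zero, neg_zero, Complex.exp_zero, Complex.norm_real, Real.norm_eq_abs,
    Real.abs_exp, mul_pow]
  -- The squared factor `e^{φ}` of the operator, the squared modulus of `conj(e^{-h/2})` and the
  -- weight `e^{-φ}` cancel at `z`.
  have : Real.exp (φ z) ^ 2 * Real.exp (-φ z / 2) ^ 2 * Real.exp (-φ z) = 1 := by
    rw [← Real.exp_nat_mul, ← Real.exp_nat_mul, ← Real.exp_add, ← Real.exp_add]
    rw [Real.exp_eq_one_iff]; push_cast; ring
  linear_combination (‖iteratedDeriv j F z‖ ^ 2) * this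

/-! ### The normalized Laplacian, integration by parts, and weights `|f|² e^{-ψ}` -/

lemma fderiv_fderiv_apply {E : Type*} [NormedAddCommGroup E] [NormedSpace ℝ E] {u : ℂ → E} {z : ℂ}
    (hu : ContDiffAt ℝ 2 u z) (v w : ℂ) :
    fderiv ℝ (fun x => fderiv ℝ u x v) z w = fderiv ℝ (fderiv ℝ u) z w v := by
  have h : DifferentiableAt ℝ (fderiv ℝ u) z :=
    (hu.fderiv_right (m := 1) (by norm_num)).differentiableAt (by simp)
  rw [fderiv_clm_apply h (differentiableAt_const _)]
  simp

lemma quarterLaplacian_eq {u : ℂ → ℝ} {z : ℂ} (hu : ContDiffAt ℝ 2 u z) :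
    quarterLaplacian u z = (1 / 4) * (fderiv ℝ (fun x => fderiv ℝ u x 1) z 1 +
      fderiv ℝ (fun x => fderiv ℝ u x Complex.I) z Complex.I) := by
  rw [quarterLaplacian, InnerProductSpace.laplacian_eq_iteratedFDeriv_complexPlane]
  simp only [iteratedFDeriv_two_apply, fderiv_fderiv_apply hu]
  simp

lemma fderiv_ofReal_comp {u : ℂ → ℝ} {z : ℂ} (hu : DifferentiableAt ℝ u z) (v : ℂ) :
    fderiv ℝ (fun w => (u w : ℂ)) z v = (fderiv ℝ u z v : ℂ) := by
  have := (Complex.ofRealCLM.hasFDerivAt.comp z hu.hasFDerivAt).fderiv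
  rw [show (fun w => (u w : ℂ)) = Complex.ofRealCLM ∘ u from rfl, this]
  rfl

lemma dbar_wirtinger_ofReal {u : ℂ → ℝ} (hu : ContDiff ℝ 2 u) (z : ℂ) :
    dbar (wirtinger fun w => (u w : ℂ)) z = quarterLaplacian u z := by
  have hd : Differentiable ℝ u := hu.differentiable (by simp)
  have h1 : ∀ v, DifferentiableAt ℝ (fun x => fderiv ℝ u x v) z := fun v =>
    ((hu.fderiv_right (m := 1) (by norm_num)).clm_apply contDiff_const).differentiable (by simp) z
  have e : (wirtinger fun w => (u w : ℂ)) = fun w =>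
      (1 / 2) * ((fderiv ℝ u w 1 : ℂ) - Complex.I * (fderiv ℝ u w Complex.I : ℂ)) := by
    ext w
    rw [wirtinger, fderiv_ofReal_comp (hd w), fderiv_ofReal_comp (hd w)]
  have hc : ∀ v, DifferentiableAt ℝ (fun x => (fderiv ℝ u x v : ℂ)) z := fun v =>
    Complex.ofRealCLM.differentiableAt.comp z (h1 v)
  have key : ∀ v, fderiv ℝ (wirtinger fun w => (u w : ℂ)) z v = (1 / 2) *
      ((fderiv ℝ (fderiv ℝ u) z v 1 : ℂ) - Complex.I * (fderiv ℝ (fderiv ℝ u) z v Complex.I : ℂ)) := by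
    intro v
    have := (((hc 1).hasFDerivAt.sub ((hc Complex.I).hasFDerivAt.const_mul Complex.I)).const_mul
      (1 / 2)).fderiv
    rw [e]
    refine (congrArg (fun T : ℂ →L[ℝ] ℂ => T v) this).trans ?_
    simp only [_root_.sub_apply, _root_.smul_apply, fderiv_ofReal_comp (h1 _), smul_eq_mul,
      fderiv_fderiv_apply hu.contDiffAt]
  -- Symmetry of the second derivative removes the imaginary part.
  have symm : fderiv ℝ (fderiv ℝ u) z Complex.I 1 = fderiv ℝ (fderiv ℝ u) z 1 Complex.I :=
    (hu.contDiffAt.isSymmSndFDerivAt (by simp)).eq _ _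
  rw [dbar, key, key, quarterLaplacian_eq hu.contDiffAt, fderiv_fderiv_apply hu.contDiffAt,
    fderiv_fderiv_apply hu.contDiffAt, symm]
  push_cast
  linear_combination (-(1 / 4) * (fderiv ℝ (fderiv ℝ u) z Complex.I Complex.I : ℂ)) *
    Complex.I_mul_I

lemma continuous_quarterLaplacian {u : ℂ → ℝ} (hu : ContDiff ℝ 2 u) :
    Continuous (quarterLaplacian u) := by
  have : quarterLaplacian u = fun z => (1 / 4) * (fderiv ℝ (fun x => fderiv ℝ u x 1) z 1 +
      fderiv ℝ (fun x => fderiv ℝ u x Complex.I) z Complex.I) := by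
    ext z; exact quarterLaplacian_eq hu.contDiffAt
  rw [this]
  have h1 : ∀ v, Continuous fun z => fderiv ℝ (fun x => fderiv ℝ u x v) z v := fun v => by
    have : ContDiff ℝ 1 (fun x => fderiv ℝ u x v) :=
      (hu.fderiv_right (m := 1) (by norm_num)).clm_apply contDiff_const
    exact (this.continuous_fderiv (by simp)).clm_apply continuous_const
  exact continuous_const.mul ((h1 1).add (h1 _))

lemma quarterLaplacian_eq_zero_of_notMem_tsupport {u : ℂ → ℝ} {z : ℂ} (hz : z ∉ tsupport u) :
    quarterLaplacian u z = 0 := by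
  have : u =ᶠ[𝓝 z] fun _ => 0 := notMem_tsupport_iff_eventuallyEq.1 hz
  rw [quarterLaplacian, (InnerProductSpace.laplacian_congr_nhds this).eq_of_nhds]
  simp

lemma hasCompactSupport_quarterLaplacian {u : ℂ → ℝ} (hu : HasCompactSupport u) :
    HasCompactSupport (quarterLaplacian u) :=
  HasCompactSupport.intro hu fun _ hz => quarterLaplacian_eq_zero_of_notMem_tsupport hz

lemma quarterLaplacian_add {u v : ℂ → ℝ} {z : ℂ} (hu : ContDiffAt ℝ 2 u z)
    (hv : ContDiffAt ℝ 2 v z) :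
    quarterLaplacian (fun w => u w + v w) z = quarterLaplacian u z + quarterLaplacian v z := by
  have := hu.laplacian_add hv
  simp only [quarterLaplacian]
  rw [show (fun w => u w + v w) = u + v from rfl, this]
  ring

lemma quarterLaplacian_const_mul {u : ℂ → ℝ} {z : ℂ} (c : ℝ) (hu : ContDiffAt ℝ 2 u z) :
    quarterLaplacian (fun w => c * u w) z = c * quarterLaplacian u z := by
  have := InnerProductSpace.laplacian_smul c hu
  simp only [quarterLaplacian]
  rw [show (fun w => c * u w) = c • u from rfl, this, smul_eq_mul]
  ring

lemma quarterLaplacian_sum {ι : Type*} (s : Finset ι) {u : ι → ℂ → ℝ} {z : ℂ}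
    (hu : ∀ i ∈ s, ContDiffAt ℝ 2 (u i) z) :
    quarterLaplacian (fun w => ∑ i ∈ s, u i w) z = ∑ i ∈ s, quarterLaplacian (u i) z := by
  classical
  induction s using Finset.induction_on with
  | empty => simp [quarterLaplacian]
  | insert a s ha ih =>
    simp only [Finset.sum_insert ha]
    rw [quarterLaplacian_add (hu a (by simp))
      (ContDiffAt.sum fun i hi => hu i (by simp [hi])), ih fun i hi => hu i (by simp [hi])]

lemma integral_mul_fderiv_comm {u κ : ℂ → ℝ} (hu : ContDiff ℝ 1 u) (hκ : ContDiff ℝ 1 κ)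
    (hc : HasCompactSupport κ) (v : ℂ) :
    ∫ z, κ z * fderiv ℝ u z v = - ∫ z, fderiv ℝ κ z v * u z := by
  have cu : Continuous fun z => fderiv ℝ u z v :=
    (hu.continuous_fderiv (by simp)).clm_apply continuous_const
  have cκ : Continuous fun z => fderiv ℝ κ z v :=
    (hκ.continuous_fderiv (by simp)).clm_apply continuous_const
  refine integral_mul_fderiv_eq_neg_fderiv_mul_of_integrable ?_ ?_ ?_
    (fun x _ => hκ.differentiable (by simp) x) (fun x _ => hu.differentiable (by simp) x)
  · exact (cκ.mul hu.continuous).integrable_of_hasCompactSupport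
      ((hc.fderiv_apply ℝ v).mul_right)
  · exact (hκ.continuous.mul cu).integrable_of_hasCompactSupport hc.mul_right
  · exact (hκ.continuous.mul hu.continuous).integrable_of_hasCompactSupport hc.mul_right

lemma integral_mul_quarterLaplacian_comm {u κ : ℂ → ℝ} (hu : ContDiff ℝ 2 u)
    (hκ : ContDiff ℝ 2 κ) (hc : HasCompactSupport κ) :
    ∫ z, κ z * quarterLaplacian u z = ∫ z, u z * quarterLaplacian κ z := by
  have d1 : ∀ {g : ℂ → ℝ}, ContDiff ℝ 2 g → ∀ v, ContDiff ℝ 1 fun x => fderiv ℝ g x v :=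
    fun hg v => (hg.fderiv_right (m := 1) (by norm_num)).clm_apply contDiff_const
  have d2 : ∀ {g : ℂ → ℝ}, ContDiff ℝ 2 g → ∀ v,
      Continuous fun x => fderiv ℝ (fun x => fderiv ℝ g x v) x v :=
    fun hg v => ((d1 hg v).continuous_fderiv (by simp)).clm_apply continuous_const
  have one : ∀ v, ∫ z, κ z * fderiv ℝ (fun x => fderiv ℝ u x v) z v =
      ∫ z, u z * fderiv ℝ (fun x => fderiv ℝ κ x v) z v := fun v => by
    rw [integral_mul_fderiv_comm (d1 hu v) (hκ.of_le (by norm_num)) hc,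
      integral_mul_fderiv_comm (hu.of_le (by norm_num)) (d1 hκ v) (hc.fderiv_apply ℝ v), neg_neg]
    simp only [mul_comm]
  have i1 : ∀ v, Integrable fun z => κ z * fderiv ℝ (fun x => fderiv ℝ u x v) z v := fun v =>
    (hκ.continuous.mul (d2 hu v)).integrable_of_hasCompactSupport hc.mul_right
  have i2 : ∀ v, Integrable fun z => u z * fderiv ℝ (fun x => fderiv ℝ κ x v) z v := fun v =>
    (hu.continuous.mul (d2 hκ v)).integrable_of_hasCompactSupport
      ((hc.fderiv_apply ℝ v).fderiv_apply ℝ v).mul_left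
  simp only [quarterLaplacian_eq hu.contDiffAt, quarterLaplacian_eq hκ.contDiffAt]
  have e1 : ∀ a b c : ℝ, a * (1 / 4 * (b + c)) = 1 / 4 * (a * b + a * c) := fun a b c => by ring
  simp only [e1]
  rw [integral_const_mul, integral_const_mul, integral_add (i1 1) (i1 _),
    integral_add (i2 1) (i2 _), one, one]

lemma fderiv_sq_weight {X Y ψ : ℂ → ℝ} {z : ℂ} (hX : DifferentiableAt ℝ X z)
    (hY : DifferentiableAt ℝ Y z) (hψ : DifferentiableAt ℝ ψ z) (v : ℂ) :
    fderiv ℝ (fun w => (X w ^ 2 + Y w ^ 2) * Real.exp (-ψ w)) z v =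
      (2 * (X z * fderiv ℝ X z v + Y z * fderiv ℝ Y z v) -
        (X z ^ 2 + Y z ^ 2) * fderiv ℝ ψ z v) * Real.exp (-ψ z) := by
  have := (((hX.hasFDerivAt.pow 2).add (hY.hasFDerivAt.pow 2)).mul hψ.hasFDerivAt.neg.exp).fderiv
  refine (congrArg (fun T : ℂ →L[ℝ] ℝ => T v) this).trans ?_
  simp
  ring

lemma fderiv_fderiv_sq_weight {X Y ψ : ℂ → ℝ} (hX : ContDiff ℝ 2 X)
    (hY : ContDiff ℝ 2 Y) (hψ : ContDiff ℝ 2 ψ) (z v : ℂ) :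
    fderiv ℝ (fun x => fderiv ℝ (fun w => (X w ^ 2 + Y w ^ 2) * Real.exp (-ψ w)) x v) z v =
      (2 * (fderiv ℝ X z v ^ 2 + X z * fderiv ℝ (fun x => fderiv ℝ X x v) z v
          + fderiv ℝ Y z v ^ 2 + Y z * fderiv ℝ (fun x => fderiv ℝ Y x v) z v)
        - 4 * (X z * fderiv ℝ X z v + Y z * fderiv ℝ Y z v) * fderiv ℝ ψ z v
        + (X z ^ 2 + Y z ^ 2) * fderiv ℝ ψ z v ^ 2
        - (X z ^ 2 + Y z ^ 2) * fderiv ℝ (fun x => fderiv ℝ ψ x v) z v) * Real.exp (-ψ z) := by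
  have d0 : ∀ {g : ℂ → ℝ}, ContDiff ℝ 2 g → Differentiable ℝ g :=
    fun hg => hg.differentiable (by simp)
  have d1 : ∀ {g : ℂ → ℝ}, ContDiff ℝ 2 g → Differentiable ℝ fun x => fderiv ℝ g x v :=
    fun hg => ((hg.fderiv_right (m := 1) (by norm_num)).clm_apply contDiff_const).differentiable
      (by simp)
  have e : (fun x => fderiv ℝ (fun w => (X w ^ 2 + Y w ^ 2) * Real.exp (-ψ w)) x v) = fun x =>
      (2 * (X x * fderiv ℝ X x v + Y x * fderiv ℝ Y x v) -
        (X x ^ 2 + Y x ^ 2) * fderiv ℝ ψ x v) * Real.exp (-ψ x) :=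
    funext fun x => fderiv_sq_weight (d0 hX x) (d0 hY x) (d0 hψ x) v
  have x0 := (d0 hX z).hasFDerivAt
  have y0 := (d0 hY z).hasFDerivAt
  have p0 := (d0 hψ z).hasFDerivAt
  have x1 := (d1 hX z).hasFDerivAt
  have y1 := (d1 hY z).hasFDerivAt
  have p1 := (d1 hψ z).hasFDerivAt
  have := (((((x0.mul x1).add (y0.mul y1)).const_mul 2).sub
    (((x0.pow 2).add (y0.pow 2)).mul p1)).mul p0.neg.exp).fderiv
  have key := congrArg (fun T : ℂ →L[ℝ] ℝ => T v) this
  rw [e]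
  refine key.trans ?_
  simp
  ring

lemma fderiv_re_comp {f : ℂ → ℂ} {z : ℂ} (hf : DifferentiableAt ℂ f z) (v : ℂ) :
    fderiv ℝ (fun w => (f w).re) z v = (deriv f z * v).re := by
  have h := (Complex.reCLM.hasFDerivAt.comp z (hf.hasDerivAt.hasFDerivAt.restrictScalars ℝ)).fderiv
  rw [show (fun w => (f w).re) = Complex.reCLM ∘ f from rfl, h]
  simp [mul_comm]

lemma fderiv_im_comp {f : ℂ → ℂ} {z : ℂ} (hf : DifferentiableAt ℂ f z) (v : ℂ) :
    fderiv ℝ (fun w => (f w).im) z v = (deriv f z * v).im := by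
  have h := (Complex.imCLM.hasFDerivAt.comp z (hf.hasDerivAt.hasFDerivAt.restrictScalars ℝ)).fderiv
  rw [show (fun w => (f w).im) = Complex.imCLM ∘ f from rfl, h]
  simp [mul_comm]

lemma contDiff_two_of_entire {f : ℂ → ℂ} (hf : Differentiable ℂ f) {n : WithTop ℕ∞} :
    ContDiff ℝ n f :=
  (hf.contDiff (n := n)).restrict_scalars ℝ

/-- `Δ(|f|² e^{-ψ}) ≥ -Δψ |f|² e^{-ψ}` for entire `f`. -/
lemma quarterLaplacian_weight_ge {f : ℂ → ℂ} (hf : Differentiable ℂ f) {ψ : ℂ → ℝ}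
    (hψ : ContDiff ℝ 2 ψ) (z : ℂ) :
    -quarterLaplacian ψ z * (‖f z‖ ^ 2 * Real.exp (-ψ z)) ≤
      quarterLaplacian (fun w => ‖f w‖ ^ 2 * Real.exp (-ψ w)) z := by
  have e : (fun w => ‖f w‖ ^ 2 * Real.exp (-ψ w)) =
      fun w => ((f w).re ^ 2 + (f w).im ^ 2) * Real.exp (-ψ w) := by
    ext w; rw [Complex.sq_norm, Complex.normSq_apply]; ring
  have cf : ContDiff ℝ 2 f := contDiff_two_of_entire hf
  have hX : ContDiff ℝ 2 fun w => (f w).re := Complex.reCLM.contDiff.comp cf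
  have hY : ContDiff ℝ 2 fun w => (f w).im := Complex.imCLM.contDiff.comp cf
  have cu : ContDiff ℝ 2 fun w => ((f w).re ^ 2 + (f w).im ^ 2) * Real.exp (-ψ w) :=
    ((hX.pow 2).add (hY.pow 2)).mul hψ.neg.exp
  have hf' : Differentiable ℂ (deriv f) := hf.deriv
  rw [congrFun e z, e, quarterLaplacian_eq cu.contDiffAt, quarterLaplacian_eq hψ.contDiffAt,
    fderiv_fderiv_sq_weight hX hY hψ, fderiv_fderiv_sq_weight hX hY hψ]
  have hm : ∀ v : ℂ, DifferentiableAt ℂ (fun x => deriv f x * v) z := fun v =>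
    (hf' z).mul_const v
  have hdm : ∀ v : ℂ, deriv (fun x => deriv f x * v) z = deriv (deriv f) z * v := fun v =>
    deriv_mul_const (hf' z) v
  simp only [fderiv_re_comp (hf _), fderiv_im_comp (hf _), fderiv_re_comp (hm _),
    fderiv_im_comp (hm _), hdm]
  simp only [Complex.mul_re, Complex.mul_im, Complex.I_re, Complex.I_im, Complex.one_re,
    Complex.one_im]
  set x := (f z).re
  set y := (f z).im
  set p := (deriv f z).re
  set q := (deriv f z).im
  set a := fderiv ℝ ψ z 1
  set b := fderiv ℝ ψ z Complex.I
  set E := Real.exp (-ψ z)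
  have hE : 0 < E := Real.exp_pos _
  -- The completed square is `|f' - f ∂ψ|² e^{-ψ}`, exactly the difference of the two sides.
  have : 0 ≤ (1 / 4) * ((2 * p - (x * a + y * b)) ^ 2 + (2 * q - (y * a - x * b)) ^ 2) * E := by
    positivity
  linear_combination this

lemma integral_weight_nonneg_of_smooth {f : ℂ → ℂ} (hf : Differentiable ℂ f) {ψ κ : ℂ → ℝ}
    (hψ : ContDiff ℝ 2 ψ) (hκ : ContDiff ℝ 2 κ) (hc : HasCompactSupport κ) (h0 : ∀ z, 0 ≤ κ z) :
    0 ≤ ∫ z, (κ z * quarterLaplacian ψ z + quarterLaplacian κ z) *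
      (‖f z‖ ^ 2 * Real.exp (-ψ z)) := by
  have cf : ContDiff ℝ 2 f := contDiff_two_of_entire hf
  have cu : ContDiff ℝ 2 fun w => ‖f w‖ ^ 2 * Real.exp (-ψ w) := (cf.norm_sq ℝ).mul hψ.neg.exp
  have i1 : Integrable fun z => κ z * quarterLaplacian ψ z * (‖f z‖ ^ 2 * Real.exp (-ψ z)) :=
    ((hκ.continuous.mul (continuous_quarterLaplacian hψ)).mul
      cu.continuous).integrable_of_hasCompactSupport hc.mul_right.mul_right
  have i2 : Integrable fun z => quarterLaplacian κ z * (‖f z‖ ^ 2 * Real.exp (-ψ z)) :=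
    ((continuous_quarterLaplacian hκ).mul cu.continuous).integrable_of_hasCompactSupport
      (hasCompactSupport_quarterLaplacian hc).mul_right
  have i3 : Integrable fun z => κ z *
      quarterLaplacian (fun w => ‖f w‖ ^ 2 * Real.exp (-ψ w)) z :=
    (hκ.continuous.mul (continuous_quarterLaplacian cu)).integrable_of_hasCompactSupport
      hc.mul_right
  have ibp := integral_mul_quarterLaplacian_comm cu hκ hc
  simp only [add_mul]
  rw [integral_add i1 i2]
  have : ∫ z, quarterLaplacian κ z * (‖f z‖ ^ 2 * Real.exp (-ψ z)) =
      ∫ z, κ z * quarterLaplacian (fun w => ‖f w‖ ^ 2 * Real.exp (-ψ w)) z := by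
    rw [ibp]; simp only [mul_comm]
  rw [this, ← integral_add i1 i3]
  refine integral_nonneg fun z => ?_
  have := mul_le_mul_of_nonneg_left (quarterLaplacian_weight_ge hf hψ z) (h0 z)
  simp only [Pi.zero_apply]
  linarith

/-! ### Radial functions and cutoffs -/

/-- In the variable `t = |z - a|²` the operator `∂∂̄` becomes `(t G'(t))'`. The potentials below are
designed by prescribing `t G'(t)`. -/
lemma quarterLaplacian_radial {G k k' : ℝ → ℝ} (hG : ∀ t, HasDerivAt G (k t) t)
    (hk : ∀ t, HasDerivAt k (k' t) t) (hGc : ContDiff ℝ 2 G) (a z : ℂ) :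
    quarterLaplacian (fun w => G (‖w - a‖ ^ 2)) z =
      k (‖z - a‖ ^ 2) + ‖z - a‖ ^ 2 * k' (‖z - a‖ ^ 2) := by
  have cN : ContDiff ℝ 2 fun w : ℂ => ‖w - a‖ ^ 2 := (contDiff_id.sub contDiff_const).norm_sq ℝ
  have hN : ∀ w v : ℂ, fderiv ℝ (fun w : ℂ => ‖w - a‖ ^ 2) w v = 2 * ((w - a) * starRingEnd ℂ v).re := by
    intro w v
    have := (((hasFDerivAt_id (𝕜 := ℝ) w).sub_const a).norm_sq).fderiv
    simp only [id] at this
    rw [this]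
    simp [Complex.inner]
    ring
  have h1 : ∀ w v : ℂ, fderiv ℝ (fun w => G (‖w - a‖ ^ 2)) w v =
      k (‖w - a‖ ^ 2) * (2 * ((w - a) * starRingEnd ℂ v).re) := fun w v => by
    have := ((hG (‖w - a‖ ^ 2)).comp_hasFDerivAt w (cN.differentiable (by simp) w).hasFDerivAt).fderiv
    rw [show (fun w => G (‖w - a‖ ^ 2)) = G ∘ (fun w : ℂ => ‖w - a‖ ^ 2) from rfl, this]
    simp [hN]
  have h2 : ∀ v : ℂ, fderiv ℝ (fun x => fderiv ℝ (fun w => G (‖w - a‖ ^ 2)) x v) z v =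
      k' (‖z - a‖ ^ 2) * (2 * ((z - a) * starRingEnd ℂ v).re) ^ 2 +
        k (‖z - a‖ ^ 2) * (2 * ‖v‖ ^ 2) := fun v => by
    simp only [h1]
    have hA := (hk (‖z - a‖ ^ 2)).comp_hasFDerivAt z (cN.differentiable (by simp) z).hasFDerivAt
    have hB : HasFDerivAt (fun w : ℂ => 2 * ((w - a) * starRingEnd ℂ v).re) _ z :=
      ((Complex.reCLM.hasFDerivAt.comp z
        (((hasFDerivAt_id (𝕜 := ℝ) z).sub_const a).mul_const (starRingEnd ℂ v))).const_mul 2)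
    have := (hA.mul hB).fderiv
    refine (congrArg (fun T : ℂ →L[ℝ] ℝ => T v) this).trans ?_
    have : v.re * v.re + v.im * v.im = ‖v‖ ^ 2 := by
      rw [Complex.sq_norm, Complex.normSq_apply]
    simp [hN]
    linear_combination (2 * k (‖z - a‖ ^ 2)) * this
  rw [quarterLaplacian_eq (u := fun w => G (‖w - a‖ ^ 2)) (hGc.comp cN).contDiffAt, h2, h2]
  have : (z - a).re * (z - a).re + (z - a).im * (z - a).im = ‖z - a‖ ^ 2 := by
    rw [Complex.sq_norm, Complex.normSq_apply]
  simp only [map_one, mul_one, norm_one, Complex.conj_I, mul_neg, Complex.neg_re, Complex.mul_I_re,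
    Complex.norm_I]
  linear_combination (k' (‖z - a‖ ^ 2)) * this

lemma hasCompactSupport_deriv_smoothTransition : HasCompactSupport (deriv Real.smoothTransition) := by
  refine HasCompactSupport.intro (isCompact_Icc (a := (0 : ℝ)) (b := 1)) fun x hx => ?_
  rw [Set.mem_Icc, not_and_or, not_le, not_le] at hx
  rcases hx with hx | hx
  · have : Real.smoothTransition =ᶠ[𝓝 x] fun _ => 0 := by
      filter_upwards [Iio_mem_nhds hx] with y hy
        using Real.smoothTransition.zero_of_nonpos (le_of_lt hy)
    rw [this.deriv_eq]; simp
  · have : Real.smoothTransition =ᶠ[𝓝 x] fun _ => 1 := by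
      filter_upwards [Ioi_mem_nhds hx] with y hy
        using Real.smoothTransition.one_of_one_le (le_of_lt hy)
    rw [this.deriv_eq]; simp

lemma exists_bound_deriv_smoothTransition : ∃ C : ℝ, 0 < C ∧
    (∀ x, |deriv Real.smoothTransition x| ≤ C) ∧
    ∀ x, |deriv (deriv Real.smoothTransition) x| ≤ C := by
  have c1 : ContDiff ℝ 1 (deriv Real.smoothTransition) :=
    ((contDiff_succ_iff_deriv (n := 1)).1
      (Real.smoothTransition.contDiff (n := 2))).2.2
  have c2 : Continuous (deriv (deriv Real.smoothTransition)) := c1.continuous_deriv (by simp)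
  obtain ⟨C1, h1⟩ := hasCompactSupport_deriv_smoothTransition.exists_bound_of_continuous
    c1.continuous
  obtain ⟨C2, h2⟩ := hasCompactSupport_deriv_smoothTransition.deriv.exists_bound_of_continuous c2
  exact ⟨max (max C1 C2) 1, by positivity,
    fun x => (h1 x).trans (by simp), fun x => (h2 x).trans (by simp)⟩

lemma hasDerivAt_smoothTransition (x : ℝ) :
    HasDerivAt Real.smoothTransition (deriv Real.smoothTransition x) x :=
  ((Real.smoothTransition.contDiff (n := 1)).differentiable (by simp) x).hasDerivAt

lemma hasDerivAt_deriv_smoothTransition (x : ℝ) :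
    HasDerivAt (deriv Real.smoothTransition) (deriv (deriv Real.smoothTransition) x) x :=
  ((((contDiff_succ_iff_deriv (n := 1)).1
      (Real.smoothTransition.contDiff (n := 2))).2.2).differentiable (by simp) x).hasDerivAt

/-- Smooth cutoffs at scale `R` with Laplacian `O(R⁻²)`. -/
lemma exists_cutoff : ∃ C : ℝ, 0 < C ∧ ∀ R : ℝ, 0 < R → ∃ κ : ℂ → ℝ, ContDiff ℝ ∞ κ ∧
    HasCompactSupport κ ∧ (∀ z, 0 ≤ κ z) ∧ (∀ z, κ z ≤ 1) ∧ (∀ z, ‖z‖ ≤ R → κ z = 1) ∧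
    (∀ z, 2 * R ≤ ‖z‖ → κ z = 0) ∧ ∀ z, |quarterLaplacian κ z| ≤ C / R ^ 2 := by
  obtain ⟨C, hC, h1, h2⟩ := exists_bound_deriv_smoothTransition
  refine ⟨C + 2 * C, by positivity, fun R hR => ?_⟩
  set G : ℝ → ℝ := fun t => Real.smoothTransition (2 - t / R ^ 2) with hGdef
  set k : ℝ → ℝ := fun t => deriv Real.smoothTransition (2 - t / R ^ 2) * (-(1 / R ^ 2))
  set k' : ℝ → ℝ := fun t =>
    deriv (deriv Real.smoothTransition) (2 - t / R ^ 2) * (-(1 / R ^ 2)) * (-(1 / R ^ 2))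
  have hl : ∀ t : ℝ, HasDerivAt (fun t => 2 - t / R ^ 2) (-(1 / R ^ 2)) t := fun t => by
    simpa using ((hasDerivAt_id t).div_const (R ^ 2)).const_sub 2
  have hG : ∀ t, HasDerivAt G (k t) t := fun t =>
    (hasDerivAt_smoothTransition _).comp t (hl t)
  have hk : ∀ t, HasDerivAt k (k' t) t := fun t =>
    ((hasDerivAt_deriv_smoothTransition _).comp t (hl t)).mul_const _
  have cG : ContDiff ℝ ∞ G := Real.smoothTransition.contDiff.comp
    (contDiff_const.sub (contDiff_id.div_const _))
  have hR2 : 0 < R ^ 2 := by positivity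
  have hz2 : ∀ z : ℂ, 2 * R ≤ ‖z‖ → G (‖z - 0‖ ^ 2) = 0 := fun z hz => by
    apply Real.smoothTransition.zero_of_nonpos
    have : 2 ≤ ‖z - 0‖ ^ 2 / R ^ 2 := by
      rw [le_div_iff₀ hR2, sub_zero]; nlinarith
    linarith
  refine ⟨fun z => G (‖z - 0‖ ^ 2), cG.comp ((contDiff_id.sub contDiff_const).norm_sq ℝ), ?_,
    fun z => Real.smoothTransition.nonneg _, fun z => Real.smoothTransition.le_one _, ?_, hz2, ?_⟩
  · refine HasCompactSupport.intro (isCompact_closedBall (0 : ℂ) (2 * R)) fun z hz => hz2 z ?_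
    simp only [Metric.mem_closedBall, dist_zero_right, not_le] at hz
    exact hz.le
  · intro z hz
    apply Real.smoothTransition.one_of_one_le
    have : ‖z - 0‖ ^ 2 / R ^ 2 ≤ 1 := by
      rw [div_le_iff₀ hR2, sub_zero]; nlinarith [norm_nonneg z]
    linarith
  · intro z
    rw [quarterLaplacian_radial hG hk (cG.of_le (by norm_cast)) 0 z]
    set s := ‖z - 0‖ ^ 2
    have hs : 0 ≤ s := by positivity
    have a1 : |k s| ≤ C / R ^ 2 := by
      simp only [k]
      rw [abs_mul, abs_neg, abs_of_pos (show 0 < 1 / R ^ 2 by positivity), div_eq_mul_one_div C]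
      exact mul_le_mul_of_nonneg_right (h1 _) (by positivity)
    -- The factor `s` costs at most `2 R²`: beyond that the transition function is locally zero and
    -- its second derivative vanishes.
    have a2 : |s * k' s| ≤ 2 * C / R ^ 2 := by
      by_cases hs2 : s / R ^ 2 ≤ 2
      · simp only [k']
        rw [abs_mul, abs_mul, abs_mul, abs_neg, abs_of_pos (show 0 < 1 / R ^ 2 by positivity),
          abs_of_nonneg hs]
        calc s * (|deriv (deriv Real.smoothTransition) (2 - s / R ^ 2)| * (1 / R ^ 2) *
              (1 / R ^ 2)) = (s / R ^ 2) *
              |deriv (deriv Real.smoothTransition) (2 - s / R ^ 2)| * (1 / R ^ 2) := by ring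
          _ ≤ 2 * C * (1 / R ^ 2) := by
            gcongr
            exact h2 _
          _ = _ := by ring
      · have : deriv (deriv Real.smoothTransition) (2 - s / R ^ 2) = 0 := by
          have e : Real.smoothTransition =ᶠ[𝓝 (2 - s / R ^ 2)] fun _ => 0 := by
            filter_upwards [Iio_mem_nhds (show 2 - s / R ^ 2 < 0 by linarith)] with y hy
              using Real.smoothTransition.zero_of_nonpos (le_of_lt hy)
          have e2 := e.deriv
          rw [e2.deriv_eq]; simp
        simp only [k', this]
        simp
        positivity
    calc |k s + s * k' s| ≤ |k s| + |s * k' s| := abs_add_le _ _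
      _ ≤ C / R ^ 2 + 2 * C / R ^ 2 := add_le_add a1 a2
      _ = _ := by ring

/-! ### Polar coordinates and radial mollification -/

/-- The point with polar coordinates `(ρ, θ)`. -/
def polarPt (ρ θ : ℝ) : ℂ := ρ * (Real.cos θ + Real.sin θ * Complex.I)

lemma continuous_polarPt : Continuous fun p : ℝ × ℝ => polarPt p.1 p.2 := by
  unfold polarPt; fun_prop

lemma polarPt_eq_circleMap (ρ θ : ℝ) : polarPt ρ θ = circleMap 0 ρ θ := by
  simp [polarPt, circleMap, Complex.exp_mul_I]

lemma norm_polarPt (ρ θ : ℝ) : ‖polarPt ρ θ‖ = |ρ| := by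
  rw [polarPt_eq_circleMap]; simp

variable {E : Type*} [NormedAddCommGroup E] [NormedSpace ℝ E]

lemma integrableOn_polar {F : ℂ → E} (hm : StronglyMeasurable F) (hF : Integrable F) :
    IntegrableOn (fun p : ℝ × ℝ => p.1 • F (polarPt p.1 p.2))
      (Set.Ioi (0 : ℝ) ×ˢ Set.Ioo (-Real.pi) Real.pi) := by
  have hs : MeasurableSet (Set.Ioi (0 : ℝ) ×ˢ Set.Ioo (-Real.pi) Real.pi) :=
    measurableSet_Ioi.prod measurableSet_Ioo
  refine ⟨(measurable_fst.stronglyMeasurable.smul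
    (hm.comp_measurable continuous_polarPt.measurable)).aestronglyMeasurable, ?_⟩
  rw [hasFiniteIntegral_iff_enorm]
  have := Complex.lintegral_comp_polarCoord_symm fun z => ‖F z‖ₑ
  have h2 := hF.2
  rw [hasFiniteIntegral_iff_enorm, ← this] at h2
  refine lt_of_le_of_lt (le_of_eq ?_) h2
  refine setLIntegral_congr_fun hs fun p hp => ?_
  simp only [Set.mem_prod, Set.mem_Ioi] at hp
  rw [enorm_smul, Complex.polarCoord_symm_apply, smul_eq_mul, polarPt]
  congr 1
  rw [Real.enorm_eq_ofReal hp.1.le]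

lemma integral_polar {F : ℂ → E} (hm : StronglyMeasurable F) (hF : Integrable F) :
    ∫ z, F z = ∫ ρ in Set.Ioi (0 : ℝ), ∫ θ in Set.Ioo (-Real.pi) Real.pi, ρ • F (polarPt ρ θ) := by
  rw [← Complex.integral_comp_polarCoord_symm]
  have := setIntegral_prod (μ := volume) (ν := volume)
    (fun p : ℝ × ℝ => p.1 • F (polarPt p.1 p.2)) (by
    rw [← Measure.volume_eq_prod]; exact integrableOn_polar hm hF)
  rw [← this]
  simp only [Complex.polarCoord_symm_apply, polarPt]
  rfl

lemma integral_circle (g : ℂ → E) (ρ : ℝ) :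
    ∫ θ in Set.Ioo (-Real.pi) Real.pi, g (polarPt ρ θ) =
      (2 * Real.pi) • Real.circleAverage g 0 ρ := by
  rw [Real.circleAverage_eq_integral_add (-Real.pi), smul_smul,
    mul_inv_cancel₀ (by positivity), one_smul, ← integral_Ioc_eq_integral_Ioo,
    ← intervalIntegral.integral_of_le (by linarith [Real.pi_pos])]
  rw [intervalIntegral.integral_comp_add_right (fun θ => g (circleMap 0 ρ θ))]
  simp only [polarPt_eq_circleMap]
  congr 1 <;> ring

/-- A smooth radial bump supported in the disc of radius `s`. -/
def bump (s : ℝ) (z : ℂ) : ℝ := Real.smoothTransition (1 - ‖z‖ ^ 2 / s ^ 2)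

/-- The normalized radial mollifier. -/
def mol (s : ℝ) (z : ℂ) : ℝ := bump s z / ∫ w, bump s w

lemma contDiff_bump (s : ℝ) : ContDiff ℝ ∞ (bump s) :=
  Real.smoothTransition.contDiff.comp (contDiff_const.sub
    ((contDiff_id.norm_sq ℝ).div_const _))

lemma bump_eq_zero {s : ℝ} (hs : 0 < s) {z : ℂ} (hz : s ≤ ‖z‖) : bump s z = 0 := by
  apply Real.smoothTransition.zero_of_nonpos
  have : 1 ≤ ‖z‖ ^ 2 / s ^ 2 := by
    rw [le_div_iff₀ (by positivity)]; nlinarith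
  linarith

lemma hasCompactSupport_bump {s : ℝ} (hs : 0 < s) : HasCompactSupport (bump s) := by
  refine HasCompactSupport.intro (isCompact_closedBall (0 : ℂ) s) fun z hz => bump_eq_zero hs ?_
  simp only [Metric.mem_closedBall, dist_zero_right, not_le] at hz
  exact hz.le

lemma integral_bump_pos {s : ℝ} (hs : 0 < s) : 0 < ∫ w, bump s w := by
  have hc := (contDiff_bump s).continuous
  refine hc.integral_pos_of_hasCompactSupport_nonneg_nonzero (x := 0) (hasCompactSupport_bump hs)
    (fun _ => Real.smoothTransition.nonneg _) ?_
  simp [bump]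

lemma contDiff_mol (s : ℝ) : ContDiff ℝ ∞ (mol s) := (contDiff_bump s).div_const _

lemma continuous_mol (s : ℝ) : Continuous (mol s) := (contDiff_mol s).continuous

lemma mol_nonneg {s : ℝ} (hs : 0 < s) (z : ℂ) : 0 ≤ mol s z :=
  div_nonneg (Real.smoothTransition.nonneg _) (integral_bump_pos hs).le

lemma mol_eq_zero {s : ℝ} (hs : 0 < s) {z : ℂ} (hz : s ≤ ‖z‖) : mol s z = 0 := by
  rw [mol, bump_eq_zero hs hz, zero_div]

lemma hasCompactSupport_mol {s : ℝ} (hs : 0 < s) : HasCompactSupport (mol s) := by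
  refine HasCompactSupport.intro (isCompact_closedBall (0 : ℂ) s) fun z hz => mol_eq_zero hs ?_
  simp only [Metric.mem_closedBall, dist_zero_right, not_le] at hz
  exact hz.le

lemma integral_mol {s : ℝ} (hs : 0 < s) : ∫ z, mol s z = 1 := by
  simp only [mol]
  rw [integral_div, div_self (integral_bump_pos hs).ne']

lemma mol_neg (s : ℝ) (z : ℂ) : mol s (-z) = mol s z := by simp [mol, bump]

lemma mol_congr_norm (s : ℝ) {z w : ℂ} (h : ‖z‖ = ‖w‖) : mol s z = mol s w := by
  simp [mol, bump, h]

lemma integrable_mol {s : ℝ} (hs : 0 < s) : Integrable (mol s) :=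
  (continuous_mol s).integrable_of_hasCompactSupport (hasCompactSupport_mol hs)

lemma mol_bounded {s : ℝ} (hs : 0 < s) : ∃ C : ℝ, 0 < C ∧ ∀ z, mol s z ≤ C := by
  obtain ⟨C, hC⟩ := (hasCompactSupport_mol hs).exists_bound_of_continuous (continuous_mol s)
  exact ⟨max C 1, by positivity, fun z => (le_abs_self _).trans ((hC z).trans (le_max_left _ _))⟩

lemma integrable_mol_smul {s : ℝ} (hs : 0 < s) {f : ℂ → E} (hf : LocallyIntegrable f) (z : ℂ) :
    Integrable fun w => mol s w • f (z + w) := by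
  have : LocallyIntegrable fun w => f (z + w) := by
    intro x
    obtain ⟨U, hU, hi⟩ := hf (z + x)
    refine ⟨(fun w => z + w) ⁻¹' U, (continuous_const_add z).continuousAt.preimage_mem_nhds hU, ?_⟩
    exact ((measurePreserving_add_left volume z).integrableOn_comp_preimage
      (measurableEmbedding_addLeft z)).2 hi
  exact this.integrable_smul_left_of_hasCompactSupport (continuous_mol s) (hasCompactSupport_mol hs)

/-- Mollification of a function with the radial mollifier. -/
def mollify (s : ℝ) (f : ℂ → E) (z : ℂ) : E := ∫ w, mol s w • f (z + w)

lemma norm_mollify_sub_le [CompleteSpace E] {s ε : ℝ} (hs : 0 < s) {f : ℂ → E}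
    (hf : LocallyIntegrable f) {z : ℂ} (a : E) (h : ∀ w, ‖w‖ < s → ‖f (z + w) - a‖ ≤ ε) :
    ‖mollify s f z - a‖ ≤ ε := by
  have e : a = ∫ w, mol s w • a := by
    rw [integral_smul_const, integral_mol hs, one_smul]
  have hi := (integrable_mol hs).smul_const a
  rw [mollify, e, ← integral_sub (integrable_mol_smul hs hf z) hi]
  have : ε = ∫ w, mol s w * ε := by rw [integral_mul_const, integral_mol hs, one_mul]
  rw [this]
  refine norm_integral_le_of_norm_le ((integrable_mol hs).mul_const ε)
    (Eventually.of_forall fun w => ?_)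
  rw [← smul_sub, norm_smul, Real.norm_of_nonneg (mol_nonneg hs w)]
  by_cases hw : ‖w‖ < s
  · exact mul_le_mul_of_nonneg_left (h w hw) (mol_nonneg hs w)
  · rw [mol_eq_zero hs (not_lt.1 hw)]; simp

lemma mollify_le_of_le {s B : ℝ} (hs : 0 < s) {f : ℂ → ℝ} (hf : LocallyIntegrable f) {z : ℂ}
    (h : ∀ w, ‖w‖ < s → f (z + w) ≤ B) : mollify s f z ≤ B := by
  have : B = ∫ w, mol s w * B := by rw [integral_mul_const, integral_mol hs, one_mul]
  rw [this]
  refine integral_mono (integrable_mol_smul hs hf z) ((integrable_mol hs).mul_const B) fun w => ?_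
  by_cases hw : ‖w‖ < s
  · exact mul_le_mul_of_nonneg_left (h w hw) (mol_nonneg hs w)
  · simp [mol_eq_zero hs (not_lt.1 hw)]

/-- A radial probability density averages circle means, and each circle mean dominates the value at
the centre. -/
lemma Subharmonic.le_mollify {φ : ℂ → ℝ} (hφ : Subharmonic φ) (hi : LocallyIntegrable φ) {s : ℝ}
    (hs : 0 < s) (z : ℂ) : φ z ≤ mollify s φ z := by
  have hmeas : Measurable φ := hφ.1.measurable
  have e : φ z = ∫ w, mol s w • φ z := by
    rw [integral_smul_const, integral_mol hs, one_smul]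
  have i2 := (integrable_mol hs).smul_const (φ z)
  rw [← sub_nonneg, mollify]
  rw [e]
  rw [← integral_sub (integrable_mol_smul hs hi z) i2]
  rw [integral_polar]
  · refine setIntegral_nonneg measurableSet_Ioi fun ρ hρ => ?_
    have hρ : 0 < ρ := hρ
    have hn : ∀ θ, mol s (polarPt ρ θ) = mol s ρ := fun θ =>
      mol_congr_norm s (by rw [norm_polarPt]; simp)
    have e2 : ∀ θ, ρ • (mol s (polarPt ρ θ) • φ (z + polarPt ρ θ) - mol s (polarPt ρ θ) • φ z) =
        (ρ * mol s ρ) * ((fun w => φ (z + w) - φ z) (polarPt ρ θ)) := fun θ => by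
      simp only [hn, smul_eq_mul]; ring
    simp only [e2]
    rw [integral_const_mul, integral_circle (fun w => φ (z + w) - φ z)]
    refine mul_nonneg (mul_nonneg hρ.le (mol_nonneg hs _)) (mul_nonneg (by positivity) ?_)
    obtain ⟨hc, hle⟩ := hφ.2 z ρ hρ
    have hc' : CircleIntegrable (fun w => φ (z + w)) 0 ρ := by
      simpa [CircleIntegrable, circleMap] using! hc
    have e3 : Real.circleAverage (fun w => φ (z + w)) 0 ρ = Real.circleAverage φ z ρ := by
      simp [Real.circleAverage, circleMap]
    rw [Real.circleAverage_fun_sub hc' (circleIntegrable_const _ _ _), e3,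
      Real.circleAverage_const]
    linarith
  · exact (((continuous_mol s).measurable.smul (hmeas.comp (measurable_const_add z))).sub
      ((continuous_mol s).measurable.smul_const _)).stronglyMeasurable
  · exact (integrable_mol_smul hs hi z).sub i2

/-- The sub-mean value property bounds the limit from below, upper semicontinuity from above;
continuity of `φ` is not yet known. -/
lemma Subharmonic.tendsto_mollify {φ : ℂ → ℝ} (hφ : Subharmonic φ) (hi : LocallyIntegrable φ)
    (z : ℂ) : Tendsto (fun s => mollify s φ z) (𝓝[>] 0) (𝓝 (φ z)) := by
  rw [tendsto_order]
  constructor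
  · intro a ha
    filter_upwards [self_mem_nhdsWithin] with s hs using ha.trans_le (hφ.le_mollify hi hs z)
  · intro b hb
    obtain ⟨c, hc1, hc2⟩ := exists_between hb
    obtain ⟨δ, hδ, h⟩ := Metric.eventually_nhds_iff.1 (hφ.1 z c hc1)
    filter_upwards [Ioo_mem_nhdsGT hδ] with s hs
    refine lt_of_le_of_lt (mollify_le_of_le hs.1 hi fun w hw => (h ?_).le) hc2
    simpa [dist_eq_norm] using hw.trans hs.2

lemma tendsto_mollify_of_continuous [CompleteSpace E] {f : ℂ → E} (hf : Continuous f) (z : ℂ) :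
    Tendsto (fun s => mollify s f z) (𝓝[>] 0) (𝓝 (f z)) := by
  rw [Metric.tendsto_nhds]
  intro ε hε
  obtain ⟨δ, hδ, h⟩ := Metric.continuous_iff.1 hf z (ε / 2) (by positivity)
  filter_upwards [Ioo_mem_nhdsGT hδ] with s hs
  rw [dist_eq_norm]
  refine lt_of_le_of_lt (norm_mollify_sub_le hs.1 hf.locallyIntegrable (f z) fun w hw => ?_)
    (half_lt_self hε)
  rw [← dist_eq_norm]
  exact (h _ (by simpa [dist_eq_norm] using hw.trans hs.2)).le

/-- Mean value property for radial mollifiers. -/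
lemma mollify_holomorphic {F : ℂ → ℂ} {z : ℂ} {R s : ℝ} (hs : 0 < s) (hsR : s < R)
    (hF : DifferentiableOn ℂ F (Metric.ball z R)) : mollify s F z = F z := by
  classical
  set B := Metric.ball z R
  -- Outside the ball nothing is known about `F`, so it is replaced by its extension by zero to have
  -- a measurable integrand. The mollifier does not see the change.
  set F' : ℂ → ℂ := B.piecewise F fun _ => 0 with hF'
  have hm : Measurable F' :=
    hF.continuousOn.measurable_piecewise continuousOn_const Metric.isOpen_ball.measurableSet
  have hEq : ∀ w, ‖w‖ < s → F' (z + w) = F (z + w) := fun w hw => by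
    rw [hF', Set.piecewise_eq_of_mem]
    simpa [B, dist_eq_norm] using hw.trans hsR
  have e0 : (fun w => mol s w • F (z + w)) = fun w => mol s w • F' (z + w) := by
    ext w
    by_cases hw : ‖w‖ < s
    · rw [hEq w hw]
    · simp [mol_eq_zero hs (not_lt.1 hw)]
  have e : F z = ∫ w, mol s w • F z := by
    rw [integral_smul_const, integral_mol hs, one_smul]
  have i2 := (integrable_mol hs).smul_const (F z)
  obtain ⟨C, hC⟩ := (isCompact_closedBall z s).exists_bound_of_continuousOn
    (hF.continuousOn.mono (Metric.closedBall_subset_ball hsR))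
  have i1 : Integrable fun w => mol s w • F' (z + w) := by
    refine ((integrable_mol hs).mul_const C).mono'
      ((continuous_mol s).measurable.smul
        (hm.comp (measurable_const_add z))).aestronglyMeasurable
      (Eventually.of_forall fun w => ?_)
    rw [norm_smul, Real.norm_of_nonneg (mol_nonneg hs w)]
    by_cases hw : ‖w‖ < s
    · rw [hEq w hw]
      exact mul_le_mul_of_nonneg_left (hC _ (by simpa [dist_eq_norm] using hw.le))
        (mol_nonneg hs w)
    · simp [mol_eq_zero hs (not_lt.1 hw)]
  rw [← sub_eq_zero, mollify, e0]
  rw [e]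
  rw [← integral_sub i1 i2, integral_polar]
  -- For radii `ρ < s` the circle mean of `F - F z` vanishes; for `ρ ≥ s` the mollifier does.
  · refine setIntegral_eq_zero_of_forall_eq_zero fun ρ hρ => ?_
    have hρ : 0 < ρ := hρ
    have hn : ∀ θ, mol s (polarPt ρ θ) = mol s ρ := fun θ =>
      mol_congr_norm s (by rw [norm_polarPt]; simp)
    have e2 : ∀ θ, ρ • (mol s (polarPt ρ θ) • F' (z + polarPt ρ θ) - mol s (polarPt ρ θ) • F z) =
        (ρ * mol s ρ) • ((fun w => F' (z + w) - F z) (polarPt ρ θ)) := fun θ => by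
      simp only [hn, Complex.real_smul]; push_cast; ring
    simp only [e2]
    by_cases hρs : s ≤ ρ
    · rw [mol_eq_zero hs (by simpa [abs_of_pos hρ] using hρs)]; simp
    rw [not_le] at hρs
    rw [integral_smul, integral_circle (fun w => F' (z + w) - F z)]
    have e3 : Real.circleAverage (fun w => F' (z + w) - F z) 0 ρ = 0 := by
      have h1 : Real.circleAverage (fun w => F' (z + w) - F z) 0 ρ =
          Real.circleAverage (fun w => F w - F z) z ρ := by
        rw [Real.circleAverage, Real.circleAverage]
        congr 1
        refine intervalIntegral.integral_congr fun θ _ => ?_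
        have : ‖circleMap 0 ρ θ‖ < s := by simpa [abs_of_pos hρ] using hρs
        simp only [hEq _ this]
        simp [circleMap]
      have h2 : DiffContOnCl ℂ (fun w => F w - F z) (Metric.ball z |ρ|) := by
        refine DifferentiableOn.diffContOnCl_ball (U := B) (hF.sub_const _) ?_
        rw [abs_of_pos hρ]
        exact Metric.closedBall_subset_ball (hρs.trans hsR)
      rw [h1, h2.circleAverage]
      simp
    rw [e3]; simp
  · exact (((continuous_mol s).measurable.smul (hm.comp (measurable_const_add z))).sub
      ((continuous_mol s).measurable.smul_const _)).stronglyMeasurable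
  · exact i1.sub i2

/-! ### Convolutions and the Cauchy transform -/

/-- Convolution of complex functions on the plane. -/
def cv (f g : ℂ → ℂ) : ℂ → ℂ := convolution f g (ContinuousLinearMap.mul ℝ ℂ) volume

lemma cv_apply (f g : ℂ → ℂ) (z : ℂ) : cv f g z = ∫ t, f t * g (z - t) := rfl

lemma cv_comm (f g : ℂ → ℂ) : cv f g = cv g f := by
  have := convolution_flip (L := ContinuousLinearMap.mul ℝ ℂ) (μ := (volume : Measure ℂ))
    (f := f) (g := g)
  rw [ContinuousLinearMap.flip_mul] at this
  exact this.symm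

lemma integrable_cv {f g : ℂ → ℂ} (hf : LocallyIntegrable f) (hg : Continuous g)
    (hc : HasCompactSupport g) (z : ℂ) : Integrable fun t => f t * g (z - t) :=
  hc.convolutionExists_right (ContinuousLinearMap.mul ℝ ℂ) hf hg z

lemma contDiff_cv {f g : ℂ → ℂ} {n : ℕ∞} (hf : LocallyIntegrable f) (hg : ContDiff ℝ n g)
    (hc : HasCompactSupport g) : ContDiff ℝ n (cv f g) :=
  hc.contDiff_convolution_right (ContinuousLinearMap.mul ℝ ℂ) hf hg

lemma continuous_cv {f g : ℂ → ℂ} (hf : LocallyIntegrable f) (hg : Continuous g)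
    (hc : HasCompactSupport g) : Continuous (cv f g) :=
  hc.continuous_convolution_right (ContinuousLinearMap.mul ℝ ℂ) hf hg

lemma hasCompactSupport_cv {f g : ℂ → ℂ} (hf : HasCompactSupport f) (hg : HasCompactSupport g) :
    HasCompactSupport (cv f g) :=
  HasCompactSupport.convolution (ContinuousLinearMap.mul ℝ ℂ) hf hg

lemma fderiv_cv {f g : ℂ → ℂ} (hf : LocallyIntegrable f) (hg : ContDiff ℝ 1 g)
    (hc : HasCompactSupport g) (z v : ℂ) :
    fderiv ℝ (cv f g) z v = cv f (fun x => fderiv ℝ g x v) z := by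
  have h := hc.hasFDerivAt_convolution_right (ContinuousLinearMap.mul ℝ ℂ) hf hg z
  rw [cv, h.fderiv, convolution_precompR_apply _ hf (hc.fderiv ℝ)
    (hg.continuous_fderiv (by simp))]
  rfl

lemma continuous_fderiv_apply_one {g : ℂ → ℂ} (hg : ContDiff ℝ 1 g) (v : ℂ) :
    Continuous fun x => fderiv ℝ g x v :=
  (hg.continuous_fderiv (by simp)).clm_apply continuous_const

lemma wirtinger_cv {f g : ℂ → ℂ} (hf : LocallyIntegrable f) (hg : ContDiff ℝ 1 g)
    (hc : HasCompactSupport g) : wirtinger (cv f g) = cv f (wirtinger g) := by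
  ext z
  rw [wirtinger, fderiv_cv hf hg hc, fderiv_cv hf hg hc, cv_apply, cv_apply, cv_apply]
  have i1 := integrable_cv hf (continuous_fderiv_apply_one hg 1) (hc.fderiv_apply ℝ 1) z
  have i2 := integrable_cv hf (continuous_fderiv_apply_one hg Complex.I)
    (hc.fderiv_apply ℝ Complex.I) z
  rw [← integral_const_mul Complex.I, ← integral_sub i1 (i2.const_mul _), ← integral_const_mul]
  congr 1; ext t; rw [wirtinger]; ring

lemma dbar_cv {f g : ℂ → ℂ} (hf : LocallyIntegrable f) (hg : ContDiff ℝ 1 g)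
    (hc : HasCompactSupport g) : dbar (cv f g) = cv f (dbar g) := by
  ext z
  rw [dbar, fderiv_cv hf hg hc, fderiv_cv hf hg hc, cv_apply, cv_apply, cv_apply]
  have i1 := integrable_cv hf (continuous_fderiv_apply_one hg 1) (hc.fderiv_apply ℝ 1) z
  have i2 := integrable_cv hf (continuous_fderiv_apply_one hg Complex.I)
    (hc.fderiv_apply ℝ Complex.I) z
  rw [← integral_const_mul Complex.I, ← integral_add i1 (i2.const_mul _), ← integral_const_mul]
  congr 1; ext t; rw [dbar]; ring

lemma hasCompactSupport_wirtinger {g : ℂ → ℂ} (hc : HasCompactSupport g) :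
    HasCompactSupport (wirtinger g) := by
  refine HasCompactSupport.intro hc fun z hz => ?_
  have : g =ᶠ[𝓝 z] fun _ => 0 := notMem_tsupport_iff_eventuallyEq.1 hz
  rw [wirtinger_congr this]
  simp [wirtinger]

lemma contDiff_wirtinger {g : ℂ → ℂ} {n : ℕ} (hg : ContDiff ℝ ((n + 1 : ℕ) : ℕ∞) g) :
    ContDiff ℝ (n : ℕ∞) (wirtinger g) :=
  contDiff_iff_contDiffAt.2 fun _ => ContDiffAt.wirtinger_of_succ hg.contDiffAt

lemma continuous_wirtinger {g : ℂ → ℂ} (hg : ContDiff ℝ 1 g) : Continuous (wirtinger g) := by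
  unfold wirtinger
  have h1 := continuous_fderiv_apply_one hg 1
  have h2 := continuous_fderiv_apply_one hg Complex.I
  fun_prop

lemma wirtinger_iterate_cv (n : ℕ) : ∀ {f g : ℂ → ℂ}, LocallyIntegrable f →
    ContDiff ℝ (n : ℕ∞) g → HasCompactSupport g →
    wirtinger^[n] (cv f g) = cv f (wirtinger^[n] g) := by
  induction n with
  | zero => intros; simp
  | succ n ih =>
    intro f g hf hg hc
    rw [Function.iterate_succ_apply, Function.iterate_succ_apply,
      wirtinger_cv hf (hg.of_le (by norm_cast; omega)) hc,
      ih hf (contDiff_wirtinger hg) (hasCompactSupport_wirtinger hc)]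

lemma cv_assoc {f g h : ℂ → ℂ} (hf : LocallyIntegrable f) (hg : Continuous g)
    (hgc : HasCompactSupport g) (hh : Continuous h) (hhc : HasCompactSupport h) :
    cv (cv f g) h = cv f (cv g h) := by
  ext z
  refine convolution_assoc (ContinuousLinearMap.mul ℝ ℂ) (ContinuousLinearMap.mul ℝ ℂ)
    (ContinuousLinearMap.mul ℝ ℂ) (ContinuousLinearMap.mul ℝ ℂ) (fun x y z => mul_assoc x y z)
    hf.aestronglyMeasurable hg.aestronglyMeasurable hh.aestronglyMeasurable
    (Eventually.of_forall fun y => hgc.convolutionExists_right _ hf hg y)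
    (Eventually.of_forall fun y => hhc.norm.convolutionExists_right _
      hg.norm.locallyIntegrable hh.norm y) ?_
  refine HasCompactSupport.convolutionExists_right _ (HasCompactSupport.convolution _ hgc.norm hhc.norm)
    (fun x => let ⟨U, hU, hi⟩ := hf x; ⟨U, hU, hi.norm⟩) (hhc.norm.continuous_convolution_right _ hg.norm.locallyIntegrable hh.norm) z

/-- The radial mollifier as a complex function. -/
def molC (s : ℝ) (z : ℂ) : ℂ := (mol s z : ℂ)

lemma contDiff_molC (s : ℝ) : ContDiff ℝ ∞ (molC s) :=
  Complex.ofRealCLM.contDiff.comp (contDiff_mol s)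

lemma hasCompactSupport_molC {s : ℝ} (hs : 0 < s) : HasCompactSupport (molC s) :=
  (hasCompactSupport_mol hs).comp_left (g := fun x : ℝ => (x : ℂ)) Complex.ofReal_zero

lemma cv_molC (s : ℝ) (f : ℂ → ℂ) (z : ℂ) : cv f (molC s) z = mollify s f z := by
  rw [cv_apply, mollify, ← integral_add_left_eq_self _ z]
  congr 1; ext w
  rw [molC, Complex.real_smul, mul_comm, show z - (z + w) = -w by ring, mol_neg]

lemma mollify_ofReal (s : ℝ) (f : ℂ → ℝ) (z : ℂ) :
    mollify s (fun w => (f w : ℂ)) z = ((mollify s f z : ℝ) : ℂ) := by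
  rw [mollify, mollify, ← integral_complex_ofReal]
  simp

lemma contDiff_mollify {s : ℝ} (hs : 0 < s) {f : ℂ → ℝ} (hf : LocallyIntegrable f) :
    ContDiff ℝ ∞ (mollify s f) := by
  have hfc : LocallyIntegrable fun w => (f w : ℂ) := fun x => by
    obtain ⟨U, hU, hi⟩ := hf x
    exact ⟨U, hU, hi.ofReal⟩
  have h := contDiff_cv (n := ⊤) hfc (contDiff_molC s) (hasCompactSupport_molC hs)
  have e : mollify s f = fun z => Complex.reCLM (cv (fun w => (f w : ℂ)) (molC s) z) := by
    ext z; rw [cv_molC, mollify_ofReal]; simp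
  rw [e]
  exact Complex.reCLM.contDiff.comp h

/-- The Cauchy kernel `1 / (π z)`. -/
def cauchyK (z : ℂ) : ℂ := 1 / (Real.pi * z)

lemma locallyIntegrable_cauchyK : LocallyIntegrable cauchyK := by
  refine locallyIntegrable_of_norm_le_rpow (C := 1 / Real.pi) (α := 1) (by simp)
    (by simp) (Eventually.of_forall fun z => ?_) ?_
  · rw [cauchyK, norm_div, norm_mul, norm_one, Complex.norm_real,
      Real.norm_of_nonneg Real.pi_pos.le, Real.rpow_neg_one]
    apply le_of_eq; field_simp
  · unfold cauchyK
    exact (by fun_prop : Measurable fun z : ℂ => 1 / ((Real.pi : ℂ) * z)).aestronglyMeasurable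

/-- The Cauchy–Pompeiu formula. In polar coordinates about `z` the Jacobian cancels the singularity
of the kernel, and the integrand becomes `-(A + iB)/(2π)`. Here `A` is the radial derivative of `g(z
- ρ e^{iθ})`, whose integral along each ray is `-g z`, and `ρ B` is the angular derivative, which
integrates to zero over each circle. -/
lemma cv_cauchyK_dbar {g : ℂ → ℂ} (hg : ContDiff ℝ 1 g) (hc : HasCompactSupport g) :
    cv cauchyK (dbar g) = g := by
  ext z
  set A : ℝ × ℝ → ℂ := fun p =>
    -fderiv ℝ g (z - polarPt p.1 p.2) (Real.cos p.2 + Real.sin p.2 * Complex.I) with hA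
  set B : ℝ × ℝ → ℂ := fun p =>
    -fderiv ℝ g (z - polarPt p.1 p.2) (-Real.sin p.2 + Real.cos p.2 * Complex.I) with hB
  have cA : Continuous A := by
    have h1 : Continuous fun p : ℝ × ℝ => fderiv ℝ g (z - polarPt p.1 p.2) :=
      (hg.continuous_fderiv (by simp)).comp (continuous_const.sub continuous_polarPt)
    exact (h1.clm_apply (by fun_prop)).neg
  have cB : Continuous B := by
    have h1 : Continuous fun p : ℝ × ℝ => fderiv ℝ g (z - polarPt p.1 p.2) :=
      (hg.continuous_fderiv (by simp)).comp (continuous_const.sub continuous_polarPt)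
    exact (h1.clm_apply (by fun_prop)).neg
  obtain ⟨R, hR⟩ := (hc.fderiv ℝ).isCompact.isBounded.subset_ball (0 : ℂ)
  set R' := ‖z‖ + |R| with hR'
  have hz0 : ∀ p : ℝ × ℝ, R' < p.1 → fderiv ℝ g (z - polarPt p.1 p.2) = 0 := fun p hp => by
    refine image_eq_zero_of_notMem_tsupport fun hm => ?_
    have := hR hm
    rw [Metric.mem_ball, dist_zero_right] at this
    have h2 : ‖polarPt p.1 p.2‖ ≤ ‖z‖ + ‖z - polarPt p.1 p.2‖ := by
      have := norm_sub_le z (z - polarPt p.1 p.2)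
      simpa using this
    rw [norm_polarPt] at h2
    have := le_abs_self p.1
    have := le_abs_self R
    linarith
  have intC : ∀ F : ℝ × ℝ → ℂ, Continuous F → (∀ p : ℝ × ℝ, R' < p.1 → F p = 0) →
      IntegrableOn F (Set.Ioi (0 : ℝ) ×ˢ Set.Ioo (-Real.pi) Real.pi) := fun F cF hF => by
    have hK : IntegrableOn F (Set.Icc (0 : ℝ) R' ×ˢ Set.Icc (-Real.pi) Real.pi) :=
      cF.continuousOn.integrableOn_compact (isCompact_Icc.prod isCompact_Icc)
    refine hK.of_forall_sdiff_eq_zero (measurableSet_Ioi.prod measurableSet_Ioo) fun p hp => ?_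
    apply hF
    obtain ⟨⟨h1, h2⟩, h3⟩ := hp
    by_contra h
    exact h3 ⟨⟨le_of_lt h1, not_lt.1 h⟩, ⟨h2.1.le, h2.2.le⟩⟩
  have iA := intC A cA fun p hp => by simp [hA, hz0 p hp]
  have iB := intC B cB fun p hp => by simp [hB, hz0 p hp]
  have e1 : cv cauchyK (dbar g) z = ∫ p in Set.Ioi (0 : ℝ) ×ˢ Set.Ioo (-Real.pi) Real.pi,
      (-(1 / (2 * Real.pi)) : ℂ) * (A p + Complex.I * B p) := by
    rw [cv_apply, ← Complex.integral_comp_polarCoord_symm]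
    refine setIntegral_congr_fun (measurableSet_Ioi.prod measurableSet_Ioo) fun p hp => ?_
    have hp1 : (p.1 : ℂ) ≠ 0 := by
      have : (0 : ℝ) < p.1 := hp.1
      exact_mod_cast this.ne'
    have hlin : ∀ (T : ℂ →L[ℝ] ℂ) (a b : ℝ), T (a + b * Complex.I) = a * T 1 + b * T Complex.I := by
      intro T a b
      have : (a + b * Complex.I : ℂ) = a • (1 : ℂ) + b • Complex.I := by simp
      rw [this, map_add, map_smul, map_smul]; simp
    have hlin2 : ∀ (T : ℂ →L[ℝ] ℂ) (a b : ℝ),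
        T (-a + b * Complex.I) = -a * T 1 + b * T Complex.I := by
      intro T a b
      have := hlin T (-a) b
      push_cast at this
      exact this
    have hpi : (Real.pi : ℂ) ≠ 0 := by exact_mod_cast Real.pi_ne_zero
    have hcs : (Real.cos p.2 + Real.sin p.2 * Complex.I : ℂ) *
        (Real.cos p.2 - Real.sin p.2 * Complex.I) = 1 := by
      have h := Real.cos_sq_add_sin_sq p.2
      have h' : ((Real.cos p.2 : ℂ)) ^ 2 + (Real.sin p.2 : ℂ) ^ 2 = 1 := by exact_mod_cast h
      linear_combination h' - (Real.sin p.2 : ℂ) ^ 2 * Complex.I_sq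
    have hne : (Real.cos p.2 + Real.sin p.2 * Complex.I : ℂ) ≠ 0 := left_ne_zero_of_mul_eq_one hcs
    have hinv : (1 : ℂ) / (Real.cos p.2 + Real.sin p.2 * Complex.I) =
        Real.cos p.2 - Real.sin p.2 * Complex.I := by
      rw [div_eq_iff hne, mul_comm]; exact hcs.symm
    simp only [Complex.polarCoord_symm_apply, Complex.real_smul, hA, hB, hlin, hlin2]
    rw [← polarPt]
    set T := fderiv ℝ g (z - polarPt p.1 p.2) with hT
    have hd : dbar g (z - polarPt p.1 p.2) = 1 / 2 * (T 1 + Complex.I * T Complex.I) := rfl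
    have hk : (p.1 : ℂ) * cauchyK (polarPt p.1 p.2) =
        1 / Real.pi * (Real.cos p.2 - Real.sin p.2 * Complex.I) := by
      rw [← hinv, cauchyK, polarPt]; field_simp
    rw [← mul_assoc, hk, hd]
    field_simp
    linear_combination (-Real.sin p.2 * T Complex.I) * Complex.I_sq
  have eA : ∫ p in Set.Ioi (0 : ℝ) ×ˢ Set.Ioo (-Real.pi) Real.pi, A p = -(2 * Real.pi) * g z := by
    rw [Measure.volume_eq_prod] at iA ⊢
    rw [← setIntegral_prod_swap, setIntegral_prod (fun p : ℝ × ℝ => A p.swap) iA.swap]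
    have inner : ∀ θ : ℝ, ∫ ρ in Set.Ioi (0 : ℝ), A (ρ, θ) = -g z := fun θ => by
      have hd : ∀ ρ : ℝ, HasDerivAt (fun ρ : ℝ => g (z - polarPt ρ θ)) (A (ρ, θ)) ρ := fun ρ => by
        have h1 : HasDerivAt (fun ρ : ℝ => z - polarPt ρ θ)
            (-(Real.cos θ + Real.sin θ * Complex.I)) ρ := by
          have := ((Complex.ofRealCLM.hasDerivAt (x := ρ)).mul_const
            (Real.cos θ + Real.sin θ * Complex.I : ℂ)).const_sub z
          simpa [polarPt] using! this
        have := (hg.differentiable (by simp) (z - polarPt ρ θ)).hasFDerivAt.comp_hasDerivAt ρ h1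
        simpa [hA] using! this
      have hsupp : HasCompactSupport fun ρ : ℝ => A (ρ, θ) := by
        refine HasCompactSupport.intro (isCompact_closedBall (0 : ℝ) R') fun ρ hρ => ?_
        simp only [Metric.mem_closedBall, dist_zero_right, not_le, Real.norm_eq_abs] at hρ
        simp only [hA]
        have : fderiv ℝ g (z - polarPt ρ θ) = 0 := by
          refine image_eq_zero_of_notMem_tsupport fun hm => ?_
          have := hR hm
          rw [Metric.mem_ball, dist_zero_right] at this
          have h2 : ‖polarPt ρ θ‖ ≤ ‖z‖ + ‖z - polarPt ρ θ‖ := by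
            have := norm_sub_le z (z - polarPt ρ θ)
            simpa using this
          rw [norm_polarPt] at h2
          have := le_abs_self R
          linarith
        simp [this]
      have hI : Integrable fun ρ : ℝ => A (ρ, θ) :=
        (cA.comp (by fun_prop : Continuous fun ρ : ℝ => (ρ, θ))).integrable_of_hasCompactSupport
          hsupp
      have hlim : Tendsto (fun ρ : ℝ => g (z - polarPt ρ θ)) atTop (𝓝 0) := by
        obtain ⟨R1, hR1⟩ := hc.isCompact.isBounded.subset_ball (0 : ℂ)
        refine tendsto_const_nhds.congr' ?_
        filter_upwards [eventually_gt_atTop (‖z‖ + |R1|)] with ρ hρ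
        symm
        refine image_eq_zero_of_notMem_tsupport fun hm => ?_
        have := hR1 hm
        rw [Metric.mem_ball, dist_zero_right] at this
        have h2 : ‖polarPt ρ θ‖ ≤ ‖z‖ + ‖z - polarPt ρ θ‖ := by
          have := norm_sub_le z (z - polarPt ρ θ)
          simpa using this
        rw [norm_polarPt] at h2
        have := le_abs_self ρ
        have := le_abs_self R1
        linarith
      rw [integral_Ioi_of_hasDerivAt_of_tendsto' (fun ρ _ => hd ρ) hI.integrableOn hlim]
      simp [polarPt]
    simp only [Prod.swap_prod_mk, inner]
    rw [setIntegral_const]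
    simp [Measure.real, Real.volume_Ioo, Real.pi_pos.le]
    left; ring
  have eB : ∫ p in Set.Ioi (0 : ℝ) ×ˢ Set.Ioo (-Real.pi) Real.pi, B p = 0 := by
    rw [Measure.volume_eq_prod] at iB ⊢
    rw [setIntegral_prod _ iB]
    refine setIntegral_eq_zero_of_forall_eq_zero fun ρ hρ => ?_
    have hρ : 0 < ρ := hρ
    have hd : ∀ θ : ℝ, HasDerivAt (fun θ : ℝ => g (z - polarPt ρ θ)) (ρ * B (ρ, θ)) θ := fun θ => by
      have h1 : HasDerivAt (fun θ : ℝ => z - polarPt ρ θ)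
          (-(ρ * (-Real.sin θ + Real.cos θ * Complex.I))) θ := by
        have hc := (Real.hasDerivAt_cos θ).ofReal_comp
        have hs := (Real.hasDerivAt_sin θ).ofReal_comp
        have := ((hc.add (hs.mul_const Complex.I)).const_mul (ρ : ℂ)).const_sub z
        simpa [polarPt] using! this
      have := (hg.differentiable (by simp) (z - polarPt ρ θ)).hasFDerivAt.comp_hasDerivAt θ h1
      convert! this using 1
      rw [map_neg, ← Complex.real_smul, ← Complex.real_smul, map_smul]
      simp [hB]
    rw [← integral_Ioc_eq_integral_Ioo,
      ← intervalIntegral.integral_of_le (by linarith [Real.pi_pos])]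
    have h0 : ∫ θ in (-Real.pi)..Real.pi, (ρ : ℂ) * B (ρ, θ) = 0 := by
      rw [intervalIntegral.integral_eq_sub_of_hasDerivAt (fun θ _ => hd θ)
        ((continuous_const.mul (cB.comp (by fun_prop : Continuous fun θ : ℝ =>
          (ρ, θ)))).intervalIntegrable _ _)]
      simp [polarPt]
    rw [intervalIntegral.integral_const_mul] at h0
    have : (ρ : ℂ) ≠ 0 := by exact_mod_cast hρ.ne'
    exact (mul_eq_zero.1 h0).resolve_left this
  rw [e1, integral_const_mul, integral_add iA (iB.const_mul _), integral_const_mul, eA, eB]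
  have hpi : (Real.pi : ℂ) ≠ 0 := by exact_mod_cast Real.pi_ne_zero
  field_simp
  ring

lemma dbar_cauchy {g : ℂ → ℂ} (hg : ContDiff ℝ 1 g) (hc : HasCompactSupport g) :
    dbar (cv cauchyK g) = g := by
  rw [dbar_cv locallyIntegrable_cauchyK hg hc, cv_cauchyK_dbar hg hc]

/-- For `z` within `2` of `a` and `g` supported within `3` of `a`, only the kernel on the disc of
radius `5` matters, and it is integrable there whatever `a` is. -/
lemma exists_cauchy_bound : ∃ C : ℝ, 0 < C ∧ ∀ (a : ℂ) (g : ℂ → ℂ) (B : ℝ), 0 ≤ B →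
    (∀ w, ‖g w‖ ≤ B) → (∀ w, 3 < ‖w - a‖ → g w = 0) → ∀ z ∈ Metric.ball a 2,
    ‖cv cauchyK g z‖ ≤ C * B := by
  have hi : IntegrableOn cauchyK (Metric.closedBall 0 5) :=
    locallyIntegrable_cauchyK.integrableOn_isCompact (isCompact_closedBall _ _)
  refine ⟨(∫ t in Metric.closedBall 0 5, ‖cauchyK t‖) + 1, ?_, ?_⟩
  · have : 0 ≤ ∫ t in Metric.closedBall 0 5, ‖cauchyK t‖ := integral_nonneg fun _ => norm_nonneg _
    linarith
  · intro a g B hB hg hs z hz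
    rw [Metric.mem_ball, dist_eq_norm] at hz
    have h1 : ‖cv cauchyK g z‖ ≤ ∫ t in Metric.closedBall 0 5, ‖cauchyK t‖ * B := by
      rw [cv_apply, ← setIntegral_eq_integral_of_forall_compl_eq_zero (s := Metric.closedBall 0 5)]
      · refine norm_integral_le_of_norm_le (hi.norm.mul_const B) (Eventually.of_forall fun t => ?_)
        rw [norm_mul]
        exact mul_le_mul_of_nonneg_left (hg _) (norm_nonneg _)
      · intro t ht
        rw [Metric.mem_closedBall, dist_zero_right, not_le] at ht
        rw [hs, mul_zero]
        have := norm_sub_le (z - a) (z - t - a)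
        rw [show z - a - (z - t - a) = t by ring] at this
        linarith
    refine h1.trans ?_
    rw [integral_mul_const]
    nlinarith

/-! ### Distributional Laplacians and regularity of the weight -/

lemma locallyIntegrable_ofReal {f : ℂ → ℝ} (hf : LocallyIntegrable f) :
    LocallyIntegrable fun w => (f w : ℂ) := fun x =>
  let ⟨U, hU, hi⟩ := hf x
  ⟨U, hU, hi.ofReal⟩

/-- The Laplacian of the mollifier is radial, hence even; this turns a convolution with it into a
pairing with a translated test function. -/
lemma exists_quarterLaplacian_mol (s : ℝ) : ∃ q : ℝ → ℝ, ∀ a z : ℂ,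
    quarterLaplacian (fun w => mol s (w - a)) z = q (‖z - a‖ ^ 2) := by
  set I := ∫ w, bump s w
  set G : ℝ → ℝ := fun t => Real.smoothTransition (1 - t / s ^ 2) / I
  have cG : ContDiff ℝ 2 G := (Real.smoothTransition.contDiff.comp
    (contDiff_const.sub (contDiff_id.div_const _))).div_const _
  have cG' : ContDiff ℝ 1 (deriv G) := ((contDiff_succ_iff_deriv (n := 1)).1 cG).2.2
  refine ⟨fun t => deriv G t + t * deriv (deriv G) t, fun a z => ?_⟩
  exact quarterLaplacian_radial (G := G) (fun t => (cG.differentiable (by simp) t).hasDerivAt)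
    (fun t => (cG'.differentiable (by simp) t).hasDerivAt) cG a z

/-- Both derivatives fall on the mollifier, and the translate `mol s (· - z)` is an admissible test
function in `IsDistribLaplacian`. -/
lemma quarterLaplacian_mollify {φ L : ℂ → ℝ} (h : IsDistribLaplacian φ L) {s : ℝ} (hs : 0 < s)
    (z : ℂ) : quarterLaplacian (mollify s φ) z = mollify s L z := by
  have hφ := locallyIntegrable_ofReal h.1
  have cm := contDiff_molC s
  have hcs := hasCompactSupport_molC hs
  have e : (fun w => ((mollify s φ w : ℝ) : ℂ)) = cv (fun w => (φ w : ℂ)) (molC s) := by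
    ext w; rw [cv_molC, mollify_ofReal]
  have c2 : ∀ n : ℕ, ContDiff ℝ (n : ℕ∞) (molC s) := fun n => cm.of_le (by
    exact_mod_cast (le_top : (n : ℕ∞) ≤ ⊤))
  have m2 : ContDiff ℝ 2 (mol s) := (contDiff_mol s).of_le (by norm_cast)
  have key : ((quarterLaplacian (mollify s φ) z : ℝ) : ℂ) = ((mollify s L z : ℝ) : ℂ) := by
    have cφ : ContDiff ℝ 2 (mollify s φ) := (contDiff_mollify hs h.1).of_le (by norm_cast)
    rw [← dbar_wirtinger_ofReal cφ, e, wirtinger_cv hφ (c2 1) hcs,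
      dbar_cv hφ (contDiff_wirtinger (n := 1) (c2 2)) (hasCompactSupport_wirtinger hcs), cv_apply]
    have : ∀ w, dbar (wirtinger (molC s)) w = (quarterLaplacian (mol s) w : ℝ) := fun w =>
      dbar_wirtinger_ofReal m2 w
    simp only [this]
    obtain ⟨q, hq⟩ := exists_quarterLaplacian_mol s
    have hq1 : ∀ t, quarterLaplacian (mol s) (z - t) =
        quarterLaplacian (fun w => mol s (w - z)) t := fun t => by
      have h0 := hq 0 (z - t)
      simp only [sub_zero] at h0
      rw [hq z t, norm_sub_rev, ← h0]
    simp only [hq1, ← Complex.ofReal_mul]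
    rw [integral_complex_ofReal]
    congr 1
    have hc : HasCompactSupport fun w => mol s (w - z) := by
      refine HasCompactSupport.intro (isCompact_closedBall z s) fun w hw => mol_eq_zero hs ?_
      simp only [Metric.mem_closedBall, dist_eq_norm, not_le] at hw
      exact hw.le
    have hη : ContDiff ℝ ∞ fun w => mol s (w - z) :=
      (contDiff_mol s).comp (contDiff_id.sub contDiff_const)
    rw [h.2.2 _ hη hc, mollify,
      ← integral_add_left_eq_self _ z]
    simp only [add_sub_cancel_left, smul_eq_mul, mul_comm]
  exact_mod_cast key

/-- The differential of a real function with `∂`-derivative `q`. -/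
def reMul (q : ℂ) : ℂ →L[ℝ] ℝ :=
  Complex.reCLM.comp ((2 : ℝ) • (ContinuousLinearMap.mul ℝ ℂ q))

lemma reMul_apply (q v : ℂ) : reMul q v = 2 * (q * v).re := by simp [reMul]

lemma norm_reMul_le (q : ℂ) : ‖reMul q‖ ≤ 2 * ‖q‖ := by
  refine ContinuousLinearMap.opNorm_le_bound _ (by positivity) fun v => ?_
  rw [reMul_apply, norm_mul, Real.norm_eq_abs, Real.norm_eq_abs, abs_two, mul_assoc, ← norm_mul]
  exact mul_le_mul_of_nonneg_left (Complex.abs_re_le_norm _) (by norm_num)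

lemma reMul_sub (q r : ℂ) : reMul (q - r) = reMul q - reMul r := by
  ext v; simp [reMul_apply]; ring

lemma fderiv_eq_reMul {u : ℂ → ℝ} {z : ℂ} (hu : DifferentiableAt ℝ u z) :
    fderiv ℝ u z = reMul (wirtinger (fun w => (u w : ℂ)) z) := by
  ext v
  rw [reMul_apply, wirtinger, fderiv_ofReal_comp hu, fderiv_ofReal_comp hu]
  have : v = v.re • (1 : ℂ) + v.im • Complex.I := by simp
  conv_lhs => rw [this, map_add, map_smul, map_smul]
  simp
  ring

lemma wirtinger_of_hasFDerivAt {u : ℂ → ℝ} {z q : ℂ} (hu : HasFDerivAt u (reMul q) z) :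
    wirtinger (fun w => (u w : ℂ)) z = q := by
  rw [wirtinger, fderiv_ofReal_comp hu.differentiableAt, fderiv_ofReal_comp hu.differentiableAt,
    hu.fderiv, reMul_apply, reMul_apply]
  apply Complex.ext <;> simp

/-- The radius `5/2` leaves room for a point within `2` of the centre and a mollification at scale
below `1/2`. -/
lemma exists_plateau : ∃ χ : ℂ → ℝ, ContDiff ℝ ∞ χ ∧ HasCompactSupport χ ∧
    (∀ z, ‖z‖ ≤ 5 / 2 → χ z = 1) ∧ (∀ z, 3 < ‖z‖ → χ z = 0) ∧ ∀ z, |χ z| ≤ 1 := by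
  let b : ContDiffBump (0 : ℂ) := ⟨5 / 2, 3, by norm_num, by norm_num⟩
  refine ⟨b, b.contDiff, b.hasCompactSupport, fun z hz => ?_, fun z hz => ?_, fun z => ?_⟩
  · exact b.one_of_mem_closedBall (by simpa [b] using hz)
  · exact b.zero_of_le_dist (by simpa [b] using hz.le)
  · rw [abs_of_nonneg b.nonneg]; exact b.le_one

/-- The standard cutoff, equal to `1` on `|z| ≤ 5/2` and supported in `|z| ≤ 3`. -/
def plateau : ℂ → ℝ := exists_plateau.choose

lemma contDiff_plateau : ContDiff ℝ ∞ plateau := exists_plateau.choose_spec.1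
lemma hasCompactSupport_plateau : HasCompactSupport plateau := exists_plateau.choose_spec.2.1
lemma plateau_eq_one {z : ℂ} (hz : ‖z‖ ≤ 5 / 2) : plateau z = 1 :=
  exists_plateau.choose_spec.2.2.1 z hz
lemma plateau_eq_zero {z : ℂ} (hz : 3 < ‖z‖) : plateau z = 0 :=
  exists_plateau.choose_spec.2.2.2.1 z hz
lemma abs_plateau_le (z : ℂ) : |plateau z| ≤ 1 := exists_plateau.choose_spec.2.2.2.2 z

/-- The function `L` localized near `a`. -/
def localized (L : ℂ → ℝ) (a w : ℂ) : ℂ := (plateau (w - a) : ℂ) * (L w : ℂ)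

lemma hasCompactSupport_localized (L : ℂ → ℝ) (a : ℂ) : HasCompactSupport (localized L a) := by
  refine HasCompactSupport.intro (isCompact_closedBall a 3) fun w hw => ?_
  simp only [Metric.mem_closedBall, dist_eq_norm, not_le] at hw
  simp [localized, plateau_eq_zero hw]

lemma continuous_localized {L : ℂ → ℝ} (hL : Continuous L) (a : ℂ) :
    Continuous (localized L a) := by
  have := contDiff_plateau.continuous
  unfold localized
  fun_prop

/-- The Cauchy transform of the localized Laplacian. -/
def localCauchy (L : ℂ → ℝ) (a : ℂ) : ℂ → ℂ := cv cauchyK (localized L a)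

lemma continuous_localCauchy {L : ℂ → ℝ} (hL : Continuous L) (a : ℂ) :
    Continuous (localCauchy L a) :=
  continuous_cv locallyIntegrable_cauchyK (continuous_localized hL a)
    (hasCompactSupport_localized L a)

/-- Each side is a convolution against `molC s` convolved with `molC t`, which is symmetric in `s`
and `t`. This is what makes the holomorphic part of `∂φ` independent of the mollification scale. -/
lemma mollify_wirtinger_symm {f c : ℂ → ℂ} (hf : LocallyIntegrable f) (hc : LocallyIntegrable c)
    {s t : ℝ} (hs : 0 < s) (ht : 0 < t) (z : ℂ) :
    mollify t (fun w => wirtinger (cv f (molC s)) w - cv c (molC s) w) z =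
      mollify s (fun w => wirtinger (cv f (molC t)) w - cv c (molC t) w) z := by
  have cm : ∀ s, ∀ n : ℕ, ContDiff ℝ (n : ℕ∞) (molC s) := fun s n => (contDiff_molC s).of_le (by
    exact_mod_cast (le_top : (n : ℕ∞) ≤ ⊤))
  have main : ∀ s t : ℝ, 0 < s → 0 < t →
      mollify t (fun w => wirtinger (cv f (molC s)) w - cv c (molC s) w) z =
      cv f (wirtinger (cv (molC s) (molC t))) z - cv c (cv (molC s) (molC t)) z := by
    intro s t hs ht
    have hcs := hasCompactSupport_molC hs
    have hct := hasCompactSupport_molC ht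
    have cw := continuous_wirtinger (cm s 1)
    have i1 : LocallyIntegrable (wirtinger (cv f (molC s))) := by
      rw [wirtinger_cv hf (cm s 1) hcs]
      exact (continuous_cv hf cw (hasCompactSupport_wirtinger hcs)).locallyIntegrable
    have i2 : LocallyIntegrable (cv c (molC s)) :=
      (continuous_cv hc (cm s 0).continuous hcs).locallyIntegrable
    have e : mollify t (fun w => wirtinger (cv f (molC s)) w - cv c (molC s) w) z =
        mollify t (wirtinger (cv f (molC s))) z - mollify t (cv c (molC s)) z := by
      rw [mollify, mollify, mollify, ← integral_sub (integrable_mol_smul ht i1 z)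
        (integrable_mol_smul ht i2 z)]
      simp only [smul_sub]
    rw [e, ← cv_molC, ← cv_molC, wirtinger_cv hf (cm s 1) hcs,
      cv_assoc hf cw (hasCompactSupport_wirtinger hcs) (cm t 0).continuous hct,
      cv_assoc hc (cm s 0).continuous hcs (cm t 0).continuous hct,
      cv_comm (wirtinger (molC s)), ← wirtinger_cv (cm t 0).continuous.locallyIntegrable (cm s 1) hcs,
      cv_comm (molC t)]
  rw [main s t hs ht, main t s ht hs, cv_comm (molC t)]

lemma differentiableAt_of_dbar_eq_zero {f : ℂ → ℂ} {z : ℂ} (hf : DifferentiableAt ℝ f z)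
    (h : dbar f z = 0) : DifferentiableAt ℂ f z := by
  rw [differentiableAt_complex_iff_differentiableAt_real]
  refine ⟨hf, ?_⟩
  have h2 : fderiv ℝ f z 1 + Complex.I * fderiv ℝ f z Complex.I = 0 := by
    rw [dbar] at h; simpa using h
  rw [smul_eq_mul]
  linear_combination (-Complex.I) * h2 + fderiv ℝ f z Complex.I * Complex.I_sq

lemma dbar_sub {f g : ℂ → ℂ} {z : ℂ} (hf : DifferentiableAt ℝ f z)
    (hg : DifferentiableAt ℝ g z) :
    dbar (fun w => f w - g w) z = dbar f z - dbar g z := by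
  simp only [dbar, fderiv_fun_sub hf hg, _root_.sub_apply]
  ring

/-- A subharmonic function with continuous distributional Laplacian is differentiable, and its
`∂`-derivative is locally a holomorphic function plus a Cauchy transform. -/
lemma exists_wirtinger_decomposition {φ L : ℂ → ℝ} (hφ : Subharmonic φ)
    (h : IsDistribLaplacian φ L) (hL : Continuous L) (a : ℂ) :
    ∃ k : ℂ → ℂ, DifferentiableOn ℂ k (Metric.ball a 1) ∧
      ∀ z ∈ Metric.ball a 1, HasFDerivAt φ (reMul (k z + localCauchy L a z)) z := by
  set f : ℂ → ℂ := fun w => (φ w : ℂ) with hf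
  set c := localCauchy L a with hc
  have cc : Continuous c := continuous_localCauchy hL a
  have hfi : LocallyIntegrable f := locallyIntegrable_ofReal h.1
  have cm : ∀ s, ∀ n : ℕ, ContDiff ℝ (n : ℕ∞) (molC s) := fun s n => (contDiff_molC s).of_le (by
    exact_mod_cast (le_top : (n : ℕ∞) ≤ ⊤))
  set K : ℝ → ℂ → ℂ := fun s w => wirtinger (cv f (molC s)) w - cv c (molC s) w with hK
  have hφs : ∀ s, (fun w => ((mollify s φ w : ℝ) : ℂ)) = cv f (molC s) := fun s => by
    ext w; rw [cv_molC, mollify_ofReal]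
  -- `K s` is holomorphic because applying `∂̄` to either of its terms gives the mollification of
  -- `L`, the plateau being `1` at all points involved.
  have hol : ∀ s, 0 < s → s < 1 / 2 → DifferentiableOn ℂ (K s) (Metric.ball a 2) := by
    intro s hs hs2 z hz
    have hcs := hasCompactSupport_molC hs
    have cf : ContDiff ℝ ((2 : ℕ) : ℕ∞) (cv f (molC s)) := contDiff_cv hfi (cm s 2) hcs
    have d1 : DifferentiableAt ℝ (wirtinger (cv f (molC s))) z :=
      (contDiff_wirtinger (n := 1) cf).differentiable (by simp) z
    have d2 : DifferentiableAt ℝ (cv c (molC s)) z :=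
      (contDiff_cv cc.locallyIntegrable (cm s 1) hcs).differentiable (by simp) z
    refine (differentiableAt_of_dbar_eq_zero (d1.sub d2) ?_).differentiableWithinAt
    have e1 : dbar (wirtinger (cv f (molC s))) z = ((mollify s L z : ℝ) : ℂ) := by
      have cφ : ContDiff ℝ 2 (mollify s φ) := (contDiff_mollify hs h.1).of_le (by norm_cast)
      rw [← hφs, dbar_wirtinger_ofReal cφ, quarterLaplacian_mollify h hs]
    have e2 : dbar (cv c (molC s)) z = mollify s (localized L a) z := by
      rw [hc, localCauchy, cv_assoc locallyIntegrable_cauchyK (continuous_localized hL a)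
        (hasCompactSupport_localized L a) (cm s 0).continuous hcs, dbar_cauchy
        (contDiff_cv (continuous_localized hL a).locallyIntegrable (cm s 1) hcs)
        (hasCompactSupport_cv (hasCompactSupport_localized L a) hcs), cv_molC]
    have e3 : mollify s (localized L a) z = mollify s (fun w => (L w : ℂ)) z := by
      rw [mollify, mollify]
      congr 1; ext w
      by_cases hw : ‖w‖ < s
      · have : ‖z + w - a‖ ≤ 5 / 2 := by
          rw [Metric.mem_ball, dist_eq_norm] at hz
          have := norm_add_le (z - a) w
          rw [show z - a + w = z + w - a by ring] at this
          linarith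
        rw [localized, plateau_eq_one this]; simp
      · rw [mol_eq_zero hs (not_lt.1 hw)]; simp
    change dbar (fun w => wirtinger (cv f (molC s)) w - cv c (molC s) w) z = 0
    rw [dbar_sub d1 d2, e1, e2, e3, mollify_ofReal, sub_self]
  -- By the mean value property `K s` equals its own mollification at scale `t`, which by symmetry
  -- is that of `K t` at scale `s`, hence `K t`.
  have indep : ∀ s t, 0 < s → s < 1 / 2 → 0 < t → t < 1 / 2 → ∀ z ∈ Metric.ball a 1,
      K s z = K t z := by
    intro s t hs hs2 ht ht2 z hz
    have hb : Metric.ball z 1 ⊆ Metric.ball a 2 := by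
      refine Metric.ball_subset_ball' ?_
      rw [Metric.mem_ball] at hz; linarith
    rw [← mollify_holomorphic ht (by linarith) ((hol s hs hs2).mono hb),
      ← mollify_holomorphic hs (by linarith) ((hol t ht ht2).mono hb)]
    exact mollify_wirtinger_symm hfi cc.locallyIntegrable hs ht z
  refine ⟨K (1 / 4), (hol _ (by norm_num) (by norm_num)).mono
    (Metric.ball_subset_ball (by norm_num)), fun z hz => ?_⟩
  set σ : ℕ → ℝ := fun n => 1 / ((n : ℝ) + 3) with hσ
  have σpos : ∀ n, 0 < σ n := fun n => by positivity
  have σlt : ∀ n, σ n < 1 / 2 := fun n => by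
    rw [hσ]; simp only
    rw [div_lt_div_iff₀ (by positivity) (by norm_num)]
    have : (0 : ℝ) ≤ n := by positivity
    linarith
  have σlim : Tendsto σ atTop (𝓝[>] 0) := by
    rw [tendsto_nhdsWithin_iff]
    refine ⟨?_, Eventually.of_forall fun n => σpos n⟩
    have := (tendsto_const_div_atTop_nhds_zero_nat (1 : ℝ)).comp (tendsto_add_atTop_nat 3)
    refine this.congr fun n => ?_
    simp [hσ]
  -- The mollified weights converge pointwise to `φ` and their differentials converge uniformly, so
  -- `φ` is differentiable with the limiting differential.
  refine hasFDerivAt_of_tendstoUniformlyOn (l := atTop) (f := fun n => mollify (σ n) φ)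
    (f' := fun n w => fderiv ℝ (mollify (σ n) φ) w)
    (g' := fun w => reMul (K (1 / 4) w + c w)) Metric.isOpen_ball ?_ ?_ ?_ hz
  -- The holomorphic part does not change with `n`; only `mollify (σ n) c - c` has to be small,
  -- which is uniform continuity of `c` on a compact disc.
  · rw [Metric.tendstoUniformlyOn_iff]
    intro ε hε
    have huc : UniformContinuousOn c (Metric.closedBall a 2) :=
      (isCompact_closedBall a 2).uniformContinuousOn_of_continuous cc.continuousOn
    obtain ⟨δ, hδ, hu⟩ := Metric.uniformContinuousOn_iff.1 huc (ε / 4) (by positivity)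
    have ev : ∀ᶠ n in atTop, σ n < δ := by
      have := σlim.eventually (Ioo_mem_nhdsGT hδ)
      filter_upwards [this] with n hn using hn.2
    filter_upwards [ev] with n hn w hw
    have hw' := hw
    rw [Metric.mem_ball] at hw'
    have d : DifferentiableAt ℝ (mollify (σ n) φ) w :=
      (contDiff_mollify (σpos n) h.1).differentiable (by simp) w
    have e : wirtinger (fun x => ((mollify (σ n) φ x : ℝ) : ℂ)) w =
        K (1 / 4) w + mollify (σ n) c w := by
      rw [← indep _ _ (σpos n) (σlt n) (by norm_num) (by norm_num) w hw, hφs, hK, ← cv_molC]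
      simp
    rw [fderiv_eq_reMul d, e, dist_eq_norm, ← reMul_sub]
    refine (norm_reMul_le _).trans_lt ?_
    have : ‖mollify (σ n) c w - c w‖ ≤ ε / 4 := by
      refine norm_mollify_sub_le (σpos n) cc.locallyIntegrable _ fun v hv => ?_
      rw [← dist_eq_norm]
      refine (hu _ ?_ _ ?_ ?_).le
      · rw [Metric.mem_closedBall]
        have h3 := dist_triangle (w + v) w a
        have h4 : dist (w + v) w = ‖v‖ := by simp [dist_eq_norm]
        have := σlt n
        linarith
      · rw [Metric.mem_closedBall]; linarith
      · simpa [dist_eq_norm] using hv.trans hn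
    rw [add_sub_add_left_eq_sub, norm_sub_rev]
    linarith
  · exact fun n w _ => ((contDiff_mollify (σpos n) h.1).differentiable (by simp) w).hasFDerivAt
  · exact fun w _ => (hφ.tendsto_mollify h.1 w).comp σlim

lemma two_le_coe {n : ℕ} (hn : 2 ≤ n) : (2 : WithTop ℕ∞) ≤ ((n : ℕ∞) : WithTop ℕ∞) := by
  have : ((2 : ℕ) : ℕ∞) ≤ (n : ℕ∞) := by exact_mod_cast hn
  exact WithTop.coe_le_coe.2 this

lemma eq_of_integral_test_eq {f g : ℂ → ℝ} (hf : Continuous f) (hg : Continuous g)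
    (h : ∀ η : ℂ → ℝ, ContDiff ℝ ∞ η → HasCompactSupport η → ∫ z, f z * η z = ∫ z, g z * η z) :
    f = g := by
  refine (Continuous.ae_eq_iff_eq volume hf hg).1 ?_
  refine ae_eq_of_integral_contDiff_smul_eq hf.locallyIntegrable hg.locallyIntegrable
    fun η hη hc => ?_
  simpa [mul_comm] using h η hη hc

lemma quarterLaplacian_eq_of_distrib {φ L : ℂ → ℝ} (h : IsDistribLaplacian φ L)
    (hL : Continuous L) (hφ : ContDiff ℝ 2 φ) : quarterLaplacian φ = L := by
  refine eq_of_integral_test_eq (continuous_quarterLaplacian hφ) hL fun η hη hc => ?_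
  rw [← h.2.2 η hη hc, ← integral_mul_quarterLaplacian_comm hφ (hη.of_le (by norm_cast)) hc]
  simp only [mul_comm]

/-- The two densities agree almost everywhere, and continuity of `L` turns almost everywhere bounds
into pointwise ones, no longer strict. -/
lemma distribLaplacian_bounds {φ L L' : ℂ → ℝ} (h : IsDistribLaplacian φ L)
    (h' : IsDistribLaplacian φ L') (hL : Continuous L) {c C : ℝ}
    (hb : ∀ z, c < L' z ∧ L' z < C) (z : ℂ) : c ≤ L z ∧ L z ≤ C := by
  have hae : L =ᵐ[volume] L' := by
    refine ae_eq_of_integral_contDiff_smul_eq h.2.1 h'.2.1 fun η hη hc => ?_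
    have := (h.2.2 η hη hc).symm.trans (h'.2.2 η hη hc)
    simpa [mul_comm] using this
  constructor
  · have e : (fun z => min (L z) c) = fun _ => c := by
      refine (Continuous.ae_eq_iff_eq volume (hL.min continuous_const) continuous_const).1 ?_
      filter_upwards [hae] with w hw
      rw [hw]; exact min_eq_right (hb w).1.le
    exact min_eq_right_iff.1 (congrFun e z)
  · have e : (fun z => max (L z) C) = fun _ => C := by
      refine (Continuous.ae_eq_iff_eq volume (hL.max continuous_const) continuous_const).1 ?_
      filter_upwards [hae] with w hw
      rw [hw]; exact max_eq_right (hb w).2.le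
    exact max_eq_right_iff.1 (congrFun e z)

/-- Supplies the regularity of `φ` when `n ≤ 1`, a case in which compatibility assumes no
smoothness. -/
lemma contDiff_one_of_distribLaplacian {φ L : ℂ → ℝ} (hφ : Subharmonic φ)
    (h : IsDistribLaplacian φ L) (hL : Continuous L) : ContDiff ℝ 1 φ := by
  rw [contDiff_one_iff_fderiv]
  constructor
  · intro a
    obtain ⟨k, -, hd⟩ := exists_wirtinger_decomposition hφ h hL a
    exact (hd a (Metric.mem_ball_self one_pos)).differentiableAt
  · rw [continuous_iff_continuousAt]
    intro a
    obtain ⟨k, hk, hd⟩ := exists_wirtinger_decomposition hφ h hL a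
    have hb : Metric.ball a 1 ∈ 𝓝 a := Metric.ball_mem_nhds a one_pos
    have e : fderiv ℝ φ =ᶠ[𝓝 a] fun z => reMul (k z + localCauchy L a z) := by
      filter_upwards [hb] with z hz using (hd z hz).fderiv
    refine ContinuousAt.congr ?_ e.symm
    have hk' : ContinuousAt k a := hk.continuousOn.continuousAt hb
    have hc' : ContinuousAt (localCauchy L a) a := (continuous_localCauchy hL a).continuousAt
    have hr : Continuous reMul := by
      have hl : LipschitzWith 2 reMul := LipschitzWith.of_dist_le_mul fun x y => by
        rw [dist_eq_norm, dist_eq_norm, ← reMul_sub]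
        exact norm_reMul_le _
      exact hl.continuous
    exact hr.continuousAt.comp (hk'.add hc')

/-! ### Local gauges with uniform constants -/

/-- Leibniz: every differentiation doubles the number of terms, each bounded by `A * B`. -/
lemma norm_wirtinger_iterate_mul_le (i : ℕ) : ∀ {a b : ℂ → ℂ} {A B : ℝ}, ContDiff ℝ (i : ℕ∞) a →
    ContDiff ℝ (i : ℕ∞) b → (∀ l ≤ i, ∀ w, ‖wirtinger^[l] a w‖ ≤ A) →
    (∀ l ≤ i, ∀ w, ‖wirtinger^[l] b w‖ ≤ B) →
    ∀ w, ‖wirtinger^[i] (fun w => a w * b w) w‖ ≤ 2 ^ i * (A * B) := by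
  induction i with
  | zero =>
    intro a b A B _ _ hA hB w
    have hA := hA 0 le_rfl w
    simp only [Function.iterate_zero, id, norm_mul, pow_zero, one_mul] at hA ⊢
    exact mul_le_mul hA (hB 0 le_rfl w) (norm_nonneg _) ((norm_nonneg _).trans hA)
  | succ i ih =>
    intro a b A B ha hb hA hB w
    have ha' : ContDiff ℝ (i : ℕ∞) a := ha.of_le (by norm_cast; omega)
    have hb' : ContDiff ℝ (i : ℕ∞) b := hb.of_le (by norm_cast; omega)
    have e : wirtinger (fun w => a w * b w) = fun w => wirtinger a w * b w + a w * wirtinger b w :=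
      funext fun w => wirtinger_mul (ha.differentiable (by simp) w) (hb.differentiable (by simp) w)
    rw [Function.iterate_succ_apply, e, wirtinger_iterate_add i
      ((contDiff_wirtinger ha).mul hb').contDiffAt (ha'.mul (contDiff_wirtinger hb)).contDiffAt]
    refine (norm_add_le _ _).trans ?_
    have h1 := ih (contDiff_wirtinger ha) hb' (fun l hl w => by
      have := hA (l + 1) (by omega) w
      rwa [Function.iterate_succ_apply] at this) (fun l hl => hB l (by omega)) w
    have h2 := ih ha' (contDiff_wirtinger hb) (fun l hl => hA l (by omega)) (fun l hl w => by
      have := hB (l + 1) (by omega) w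
      rwa [Function.iterate_succ_apply] at this) w
    calc _ ≤ 2 ^ i * (A * B) + 2 ^ i * (A * B) := add_le_add h1 h2
      _ = _ := by ring

lemma wirtinger_translate (f : ℂ → ℂ) (a : ℂ) (i : ℕ) :
    wirtinger^[i] (fun w => f (w - a)) = fun w => wirtinger^[i] f (w - a) := by
  induction i with
  | zero => rfl
  | succ i ih =>
    rw [Function.iterate_succ_apply', ih, Function.iterate_succ_apply']
    ext w
    simp only [wirtinger, fderiv_comp_sub]

lemma contDiff_quarterLaplacian {u : ℂ → ℝ} {n : ℕ} (hu : ContDiff ℝ ((n + 2 : ℕ) : ℕ∞) u) :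
    ContDiff ℝ (n : ℕ∞) (quarterLaplacian u) := by
  have h2 : ContDiff ℝ 2 u := hu.of_le (two_le_coe (by omega))
  have e : quarterLaplacian u = fun z => (1 / 4) * (fderiv ℝ (fun x => fderiv ℝ u x 1) z 1 +
      fderiv ℝ (fun x => fderiv ℝ u x Complex.I) z Complex.I) :=
    funext fun z => quarterLaplacian_eq h2.contDiffAt
  rw [e]
  have h1 : ∀ v, ContDiff ℝ (n : ℕ∞) fun z => fderiv ℝ (fun x => fderiv ℝ u x v) z v := fun v => by
    have : ContDiff ℝ ((n + 1 : ℕ) : ℕ∞) (fun x => fderiv ℝ u x v) :=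
      (hu.fderiv_right (by norm_cast)).clm_apply contDiff_const
    exact (this.fderiv_right (by norm_cast)).clm_apply contDiff_const
  exact contDiff_const.mul ((h1 1).add (h1 _))

lemma wirtinger_iterate_polynomial (P : Polynomial ℂ) (a : ℂ) (i : ℕ) :
    wirtinger^[i] (fun w => P.eval (w - a)) =
      fun w => (Polynomial.derivative^[i] P).eval (w - a) := by
  induction i with
  | zero => rfl
  | succ i ih =>
    rw [Function.iterate_succ_apply', ih, Function.iterate_succ_apply']
    ext w
    have h : HasDerivAt (fun w => (Polynomial.derivative^[i] P).eval (w - a))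
        ((Polynomial.derivative (Polynomial.derivative^[i] P)).eval (w - a)) w := by
      simpa using! ((Polynomial.derivative^[i] P).hasDerivAt (w - a)).comp w
        ((hasDerivAt_id w).sub_const a)
    rw [wirtinger_holomorphic h.differentiableAt, h.deriv]

/-- Used to cancel the jet of a Cauchy transform by a holomorphic function of controlled size on the
unit disc. -/
lemma exists_taylor_polynomial (n : ℕ) (α : ℕ → ℂ) {B : ℝ} (hB : ∀ i < n, ‖α i‖ ≤ B) :
    ∃ P : Polynomial ℂ, (∀ i < n, (Polynomial.derivative^[i] P).eval 0 = α i) ∧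
      ∀ z : ℂ, ‖z‖ ≤ 1 → ‖P.eval z‖ ≤ n * B := by
  refine ⟨∑ i ∈ Finset.range n, Polynomial.monomial i (α i / i.factorial), fun i hi => ?_,
    fun z hz => ?_⟩
  · rw [← Polynomial.coeff_zero_eq_eval_zero, Polynomial.coeff_iterate_derivative, zero_add,
      Polynomial.finsetSum_coeff]
    simp only [Polynomial.coeff_monomial, Finset.sum_ite_eq', Finset.mem_range, hi, if_true,
      Nat.descFactorial_self, nsmul_eq_mul]
    exact mul_div_cancel₀ _ (by exact_mod_cast i.factorial_ne_zero)
  · rw [Polynomial.eval_finsetSum]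
    refine (norm_sum_le _ _).trans ?_
    have : ∀ i ∈ Finset.range n, ‖(Polynomial.monomial i (α i / i.factorial)).eval z‖ ≤ B := by
      intro i hi
      rw [Polynomial.eval_monomial, norm_mul, norm_div, norm_pow, Complex.norm_natCast]
      have h1 : (1 : ℝ) ≤ i.factorial := by exact_mod_cast i.factorial_pos
      calc ‖α i‖ / i.factorial * ‖z‖ ^ i ≤ ‖α i‖ / i.factorial * 1 := by
            gcongr; exact pow_le_one₀ (norm_nonneg _) hz
        _ ≤ ‖α i‖ := by rw [mul_one]; exact div_le_self (norm_nonneg _) h1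
        _ ≤ B := hB i (Finset.mem_range.1 hi)
    refine (Finset.sum_le_card_nsmul _ _ _ this).trans ?_
    simp

/-- The derivative bounds on the Laplacian which the gauge construction needs. -/
lemma exists_localized_bound {φ L : ℂ → ℝ} (h : IsDistribLaplacian φ L) (hL : Continuous L)
    {M : ℝ} (hM : ∀ z, |L z| ≤ M) (n : ℕ)
    (hn : 2 ≤ n → ContDiff ℝ ((n + 1 : ℕ) : ℕ∞) φ ∧ ∀ j : ℕ, 1 ≤ j → j ≤ n - 1 →
      ∃ C : ℝ, ∀ z, ‖wirtinger^[j] (fun w => (quarterLaplacian φ w : ℂ)) z‖ ≤ C) :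
    (∀ a, ContDiff ℝ ((n - 1 : ℕ) : ℕ∞) (localized L a)) ∧
    ∃ B : ℝ, 0 ≤ B ∧ ∀ i < n, ∀ a w, ‖wirtinger^[i] (localized L a) w‖ ≤ B := by
  have hM0 : 0 ≤ M := (abs_nonneg _).trans (hM 0)
  have zero_le : ∀ a w, ‖localized L a w‖ ≤ M := fun a w => by
    rw [localized, norm_mul, Complex.norm_real, Complex.norm_real]
    calc _ ≤ 1 * M := mul_le_mul (abs_plateau_le _) (hM w) (abs_nonneg _) zero_le_one
      _ = M := one_mul M
  by_cases h2 : 2 ≤ n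
  · obtain ⟨hφ, hb⟩ := hn h2
    have eL : quarterLaplacian φ = L :=
      quarterLaplacian_eq_of_distrib h hL (hφ.of_le (two_le_coe (by omega)))
    have cL : ContDiff ℝ ((n - 1 : ℕ) : ℕ∞) L := by
      rw [← eL]; exact contDiff_quarterLaplacian (by rwa [show n - 1 + 2 = n + 1 by omega])
    have cLc : ContDiff ℝ ((n - 1 : ℕ) : ℕ∞) fun w => (L w : ℂ) := Complex.ofRealCLM.contDiff.comp cL
    set χ : ℂ → ℂ := fun w => (plateau w : ℂ) with hχ
    have cχ : ContDiff ℝ ∞ χ := Complex.ofRealCLM.contDiff.comp contDiff_plateau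
    have cχn : ∀ m : ℕ, ContDiff ℝ (m : ℕ∞) χ := fun m => cχ.of_le (by
      exact_mod_cast (le_top : (m : ℕ∞) ≤ ⊤))
    have ctr : ∀ a, ContDiff ℝ ((n - 1 : ℕ) : ℕ∞) fun w => χ (w - a) := fun a =>
      (cχn _).comp (contDiff_id.sub contDiff_const)
    have hcχ : ∀ i, HasCompactSupport (wirtinger^[i] χ) := by
      intro i
      induction i with
      | zero =>
        exact hasCompactSupport_plateau.comp_left (g := fun x : ℝ => (x : ℂ)) Complex.ofReal_zero
      | succ i ih => rw [Function.iterate_succ_apply']; exact hasCompactSupport_wirtinger ih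
    have bχ : ∀ i, ∃ C, ∀ w, ‖wirtinger^[i] χ w‖ ≤ C := fun i => by
      have : Continuous (wirtinger^[i] χ) := by
        have : ContDiff ℝ ((0 : ℕ) : ℕ∞) (wirtinger^[i] χ) :=
          contDiff_iff_contDiffAt.2 fun z => ContDiffAt.wirtinger_iterate
            (cχn (0 + i)).contDiffAt
        exact this.continuous
      exact (hcχ i).exists_bound_of_continuous this
    have bL : ∀ i, ∃ C, i < n → ∀ w, ‖wirtinger^[i] (fun w => (L w : ℂ)) w‖ ≤ C := by
      intro i
      rcases Nat.eq_zero_or_pos i with rfl | hi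
      · exact ⟨M, fun _ w => by simpa using hM w⟩
      · by_cases hin : i < n
        · obtain ⟨C, hC⟩ := hb i hi (by omega)
          rw [eL] at hC
          exact ⟨C, fun _ => hC⟩
        · exact ⟨0, fun h => absurd h hin⟩
    choose A hA using bχ
    choose D hD using bL
    have hA0 : ∀ i, 0 ≤ A i := fun i => (norm_nonneg _).trans (hA i 0)
    have hSA : ∀ i < n, A i ≤ ∑ l ∈ Finset.range n, A l := fun i hi =>
      Finset.single_le_sum (f := A) (fun l _ => hA0 l) (Finset.mem_range.2 hi)
    have hSD : ∀ i < n, D i ≤ ∑ l ∈ Finset.range n, |D l| := fun i hi =>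
      (le_abs_self _).trans (Finset.single_le_sum (f := fun l => |D l|) (fun l _ => abs_nonneg _)
        (Finset.mem_range.2 hi))
    set SA := ∑ l ∈ Finset.range n, A l
    set SD := ∑ l ∈ Finset.range n, |D l|
    have SA0 : 0 ≤ SA := Finset.sum_nonneg fun l _ => hA0 l
    have SD0 : 0 ≤ SD := Finset.sum_nonneg fun l _ => abs_nonneg _
    refine ⟨fun a => (ctr a).mul cLc, 2 ^ n * (SA * SD), by positivity, fun i hi a w => ?_⟩
    have lei : ((i : ℕ∞) : WithTop ℕ∞) ≤ ((n - 1 : ℕ) : ℕ∞) := by norm_cast; omega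
    refine (norm_wirtinger_iterate_mul_le i (A := SA) (B := SD) ((ctr a).of_le lei)
      (cLc.of_le lei) (fun l hl w => ?_) (fun l hl w => ?_) w).trans ?_
    · rw [wirtinger_translate]
      exact (hA l _).trans (hSA l (by omega))
    · exact (hD l (by omega) w).trans (hSD l (by omega))
    · gcongr
      · norm_num
  -- For `n ≤ 1` only the index `i = 0` can occur, so boundedness and continuity of `L` suffice.
  · have e : n - 1 = 0 := by omega
    refine ⟨fun a => ?_, M, hM0, fun i hi a w => ?_⟩
    · rw [e]
      have := contDiff_zero (𝕜 := ℝ).2 (continuous_localized hL a)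
      simpa using this
    · obtain rfl : i = 0 := by omega
      exact zero_le a w

/-- Local gauge: `φ = Re h + O(1)` on unit discs, with uniform constants and vanishing pure
`∂`-derivatives of the remainder at the centre. -/
theorem exists_gauge {φ L : ℂ → ℝ} (hφ : Subharmonic φ) (h : IsDistribLaplacian φ L)
    (hL : Continuous L) {M : ℝ} (hM : ∀ z, |L z| ≤ M) (n : ℕ)
    (hn : 2 ≤ n → ContDiff ℝ ((n + 1 : ℕ) : ℕ∞) φ ∧ ∀ j : ℕ, 1 ≤ j → j ≤ n - 1 →
      ∃ C : ℝ, ∀ z, ‖wirtinger^[j] (fun w => (quarterLaplacian φ w : ℂ)) z‖ ≤ C) :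
    ∃ C : ℝ, 0 < C ∧ ∀ a : ℂ, ∃ g : ℂ → ℂ, DifferentiableOn ℂ g (Metric.ball a 1) ∧
      φ a = (g a).re ∧ (∀ z ∈ Metric.ball a 1, |φ z - (g z).re| ≤ C) ∧
      ∀ i < n, wirtinger^[i] (wirtinger fun w => ((φ w - (g w).re : ℝ) : ℂ)) a = 0 := by
  obtain ⟨cloc, B, hB0, hB⟩ := exists_localized_bound h hL hM n hn
  obtain ⟨C₀, hC₀, hcau⟩ := exists_cauchy_bound
  have hM0 : 0 ≤ M := (abs_nonneg _).trans (hM 0)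
  -- A bound for the gradient of `φ - Re g` on a disc of radius `1`: `C₀ * M` for the Cauchy
  -- transform, `n * (C₀ * B)` for the polynomial, a factor `2` from `norm_reMul_le`, and `1` for
  -- positivity.
  refine ⟨2 * (C₀ * M + n * (C₀ * B)) + 1, by positivity, fun a => ?_⟩
  obtain ⟨k, hk, hd⟩ := exists_wirtinger_decomposition hφ h hL a
  have hsupp := hasCompactSupport_localized L a
  set c := localCauchy L a with hc
  have cc : ContDiff ℝ ((n - 1 : ℕ) : ℕ∞) c :=
    contDiff_cv locallyIntegrable_cauchyK (cloc a) hsupp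
  have supp3 : ∀ w, 3 < ‖w - a‖ → localized L a w = 0 := fun w hw => by
    simp [localized, plateau_eq_zero hw]
  have bc : ∀ z ∈ Metric.ball a 1, ‖c z‖ ≤ C₀ * M := fun z hz => by
    refine hcau a _ M hM0 (fun w => ?_) supp3 z (Metric.ball_subset_ball (by norm_num) hz)
    rw [localized, norm_mul, Complex.norm_real, Complex.norm_real]
    calc _ ≤ 1 * M := mul_le_mul (abs_plateau_le _) (hM w) (abs_nonneg _) zero_le_one
      _ = M := one_mul M
  -- The derivatives pass through the convolution onto the localized Laplacian, so the jet of `c` at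
  -- `a` is bounded independently of `a`.
  have bα : ∀ i < n, ‖-wirtinger^[i] c a‖ ≤ C₀ * B := fun i hi => by
    rw [norm_neg, hc, localCauchy, wirtinger_iterate_cv i locallyIntegrable_cauchyK
      ((cloc a).of_le (by norm_cast; omega)) hsupp]
    refine hcau a _ B hB0 (hB i hi a) (fun w hw => ?_) a (Metric.mem_ball_self (by norm_num))
    have e : localized L a =ᶠ[𝓝 w] fun _ => 0 := by
      have ho : IsOpen {w : ℂ | 3 < ‖w - a‖} := isOpen_lt continuous_const (by fun_prop)
      filter_upwards [ho.mem_nhds hw] with x hx using supp3 x hx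
    have hz : ∀ i, wirtinger^[i] (fun _ : ℂ => (0 : ℂ)) = fun _ => 0 := by
      intro i
      induction i with
      | zero => rfl
      | succ i ih => rw [Function.iterate_succ_apply', ih]; ext; simp [wirtinger]
    rw [(wirtinger_iterate_eventuallyEq e i).eq_of_nhds, hz]
  obtain ⟨P, hP, bP⟩ := exists_taylor_polynomial n (fun i => -wirtinger^[i] c a) bα
  set Q : ℂ → ℂ := fun w => P.eval (w - a) with hQ
  have hPd : Differentiable ℂ fun w => P.eval w := P.differentiable
  have hQd : Differentiable ℂ Q := hPd.comp (differentiable_id.sub_const a)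
  have hkQ : DifferentiableOn ℂ (fun z => 2 * (k z - Q z)) (Metric.ball a 1) :=
    (hk.sub hQd.differentiableOn).const_mul (2 : ℂ)
  -- A primitive of `2 (k - Q)`: since `∂ Re g = g'/2`, the remainder has `∂(φ - Re g) = c + Q`,
  -- whose pure `∂`-derivatives of order below `n` vanish at `a`.
  obtain ⟨g₀, hg₀⟩ := hkQ.isExactOn_ball
  set g : ℂ → ℂ := fun z => g₀ z - g₀ a + φ a with hg
  have hgd : ∀ z ∈ Metric.ball a 1, HasDerivAt g (2 * (k z - Q z)) z := fun z hz =>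
    ((hg₀ z hz).sub_const _).add_const _
  have hp : ∀ z ∈ Metric.ball a 1, HasFDerivAt (fun w => φ w - (g w).re) (reMul (c z + Q z)) z := by
    intro z hz
    have h1 := Complex.reCLM.hasFDerivAt.comp z
      ((hgd z hz).hasFDerivAt.restrictScalars ℝ)
    refine ((hd z hz).sub h1).congr_fderiv ?_
    ext v
    simp [reMul_apply]
    ring
  have ha : φ a = (g a).re := by simp [hg]
  refine ⟨g, fun z hz => (hgd z hz).differentiableAt.differentiableWithinAt, ha, fun z hz => ?_,
    fun i hi => ?_⟩
  -- The remainder vanishes at `a`, so its gradient bound and the mean value inequality on the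
  -- convex disc give its size.
  · have hbd : ∀ x ∈ Metric.ball a 1, ‖reMul (c x + Q x)‖ ≤ 2 * (C₀ * M + n * (C₀ * B)) := by
      intro x hx
      refine (norm_reMul_le _).trans (mul_le_mul_of_nonneg_left ?_ (by norm_num))
      refine (norm_add_le _ _).trans (add_le_add (bc x hx) (bP _ ?_))
      rw [Metric.mem_ball, dist_eq_norm] at hx
      exact hx.le
    have := (convex_ball a 1).norm_image_sub_le_of_norm_hasFDerivWithin_le
      (fun x hx => (hp x hx).hasFDerivWithinAt) hbd (Metric.mem_ball_self one_pos) hz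
    rw [← ha, sub_self, sub_zero, Real.norm_eq_abs] at this
    rw [Metric.mem_ball, dist_eq_norm] at hz
    refine this.trans ?_
    have : 2 * (C₀ * M + n * (C₀ * B)) * ‖z - a‖ ≤ 2 * (C₀ * M + n * (C₀ * B)) * 1 := by
      gcongr
    linarith
  · have e : (wirtinger fun w => ((φ w - (g w).re : ℝ) : ℂ)) =ᶠ[𝓝 a] fun w => c w + Q w := by
      filter_upwards [Metric.ball_mem_nhds a one_pos] with w hw
        using wirtinger_of_hasFDerivAt (hp w hw)
    rw [(wirtinger_iterate_eventuallyEq e i).eq_of_nhds, wirtinger_iterate_add i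
      (cc.contDiffAt.of_le (by norm_cast; omega)) (contDiff_two_of_entire hQd).contDiffAt, hQ,
      wirtinger_iterate_polynomial]
    simp only [sub_self]
    rw [hP i hi, add_neg_cancel]

/-! ### Local estimates for jets -/

lemma integrableOn_sq_norm {F : ℂ → ℂ} {a : ℂ} {R : ℝ} (hR : R < 1)
    (hF : DifferentiableOn ℂ F (Metric.ball a 1)) :
    IntegrableOn (fun w => ‖F w‖ ^ 2) (Metric.ball a R) := by
  have hc : ContinuousOn (fun w => ‖F w‖ ^ 2) (Metric.closedBall a R) :=
    (hF.continuousOn.mono (Metric.closedBall_subset_ball hR)).norm.pow 2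
  exact (hc.integrableOn_compact (isCompact_closedBall a R)).mono_set Metric.ball_subset_closedBall

/-- The mean value property of the holomorphic function `F²`, against a bounded radial density at
scale `R / 2`. -/
lemma exists_sq_norm_le_integral {R : ℝ} (hR0 : 0 < R) (hR : R < 1) : ∃ C : ℝ, 0 < C ∧
    ∀ (F : ℂ → ℂ) (a : ℂ), DifferentiableOn ℂ F (Metric.ball a 1) →
    ∀ z ∈ Metric.closedBall a (R / 2), ‖F z‖ ^ 2 ≤ C * ∫ w in Metric.ball a R, ‖F w‖ ^ 2 := by
  have hs : 0 < R / 2 := by positivity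
  obtain ⟨C, hC, hm⟩ := mol_bounded hs
  refine ⟨C, hC, fun F a hF z hz => ?_⟩
  rw [Metric.mem_closedBall, dist_eq_norm] at hz
  have hsub : Metric.ball z (1 - R / 2) ⊆ Metric.ball a 1 := by
    refine Metric.ball_subset_ball' ?_
    rw [dist_eq_norm]; linarith
  have hmv : mollify (R / 2) (fun w => F w ^ 2) z = F z ^ 2 :=
    mollify_holomorphic hs (R := 1 - R / 2) (by linarith) ((hF.pow 2).mono hsub)
  rw [← norm_pow, ← hmv, mollify, ← integral_const_mul,
    ← integral_indicator Metric.isOpen_ball.measurableSet,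
    ← integral_add_left_eq_self ((Metric.ball a R).indicator fun w => C * ‖F w‖ ^ 2) z]
  refine norm_integral_le_of_norm_le ?_ (Eventually.of_forall fun w => ?_)
  · have : Integrable ((Metric.ball a R).indicator fun w => C * ‖F w‖ ^ 2) :=
      (integrable_indicator_iff Metric.isOpen_ball.measurableSet).2
        ((integrableOn_sq_norm hR hF).const_mul C)
    exact this.comp_add_left z
  · rw [norm_smul, Real.norm_of_nonneg (mol_nonneg hs w), norm_pow]
    by_cases hw : ‖w‖ < R / 2
    · have hmem : z + w ∈ Metric.ball a R := by
        rw [Metric.mem_ball, dist_eq_norm]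
        have := norm_add_le (z - a) w
        rw [show z - a + w = z + w - a by ring] at this
        linarith
      rw [Set.indicator_of_mem hmem]
      exact mul_le_mul_of_nonneg_right (hm w) (by positivity)
    · rw [mol_eq_zero hs (not_lt.1 hw), zero_mul]
      exact Set.indicator_nonneg (fun _ _ => by positivity) _

lemma norm_iteratedDeriv_le {F : ℂ → ℂ} {a : ℂ} {R S : ℝ} (hR0 : 0 < R) (hR : R < 1)
    (hF : DifferentiableOn ℂ F (Metric.ball a 1))
    (hS : ∀ z ∈ Metric.closedBall a (R / 2), ‖F z‖ ≤ S) (j : ℕ) :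
    ‖iteratedDeriv j F a‖ ≤ j.factorial * S / (R / 2) ^ j := by
  refine Complex.norm_iteratedDeriv_le_of_forall_mem_sphere_norm_le j (by positivity) ?_
    fun z hz => hS z (Metric.sphere_subset_closedBall hz)
  exact (hF.mono (Metric.closedBall_subset_ball (by linarith))).diffContOnCl_ball subset_rfl

/-- Cauchy estimates at radius `R / 2` make the Taylor series geometric, with ratio at most `1/2`
for `‖z - a‖ ≤ R / 4`; the sum of the tail costs the factor `2`. -/
lemma norm_sub_taylor_le {F : ℂ → ℂ} {a z : ℂ} {R S : ℝ} (hR0 : 0 < R) (hR : R < 1)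
    (hF : DifferentiableOn ℂ F (Metric.ball a 1))
    (hS : ∀ z ∈ Metric.closedBall a (R / 2), ‖F z‖ ≤ S) (m : ℕ) (hz : ‖z - a‖ ≤ R / 4) :
    ‖F z - ∑ j ∈ Finset.range m, ((j.factorial : ℂ)⁻¹ * (z - a) ^ j * iteratedDeriv j F a)‖ ≤
      2 * S * (2 * ‖z - a‖ / R) ^ m := by
  have hS0 : 0 ≤ S := (norm_nonneg _).trans (hS a (Metric.mem_closedBall_self (by positivity)))
  set q := 2 * ‖z - a‖ / R with hq
  have hq0 : 0 ≤ q := by positivity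
  have hq1 : q ≤ 1 / 2 := by rw [hq, div_le_iff₀ hR0]; linarith
  have hmem : z ∈ Metric.ball a 1 := by
    rw [Metric.mem_ball, dist_eq_norm]; linarith
  have hsum := Complex.hasSum_taylorSeries_on_ball hF hmem
  have hterm : ∀ j, ‖(j.factorial : ℂ)⁻¹ • (z - a) ^ j • iteratedDeriv j F a‖ ≤ S * q ^ j := by
    intro j
    have h1 := norm_iteratedDeriv_le hR0 hR hF hS j
    have hj : (0 : ℝ) < j.factorial := by exact_mod_cast j.factorial_pos
    rw [norm_smul, norm_smul, norm_inv, norm_pow, Complex.norm_natCast]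
    calc (j.factorial : ℝ)⁻¹ * (‖z - a‖ ^ j * ‖iteratedDeriv j F a‖)
        ≤ (j.factorial : ℝ)⁻¹ * (‖z - a‖ ^ j * (j.factorial * S / (R / 2) ^ j)) := by gcongr
      _ = S * q ^ j := by
        have hR2 : (R / 2) ^ j ≠ 0 := by positivity
        rw [hq, show 2 * ‖z - a‖ / R = ‖z - a‖ / (R / 2) by field_simp, div_pow ‖z - a‖,
          inv_mul_eq_iff_eq_mul₀ hj.ne']
        generalize (R / 2) ^ j = y
        ring
  have htail := (hasSum_nat_add_iff' m).2 hsum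
  have hgeo : HasSum (fun j => S * q ^ (j + m)) (S * q ^ m * (1 - q)⁻¹) := by
    have := (hasSum_geometric_of_lt_one hq0 (by linarith)).mul_left (S * q ^ m)
    refine this.congr_fun fun j => ?_
    rw [pow_add]; ring
  have hle := htail.norm_le_of_bounded hgeo fun j => hterm (j + m)
  simp only [smul_eq_mul, ← mul_assoc] at hle
  refine hle.trans ?_
  have : (1 - q)⁻¹ ≤ 2 := by
    rw [inv_le_comm₀ (by linarith) (by norm_num)]; linarith
  calc S * q ^ m * (1 - q)⁻¹ ≤ S * q ^ m * 2 := by gcongr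
    _ = _ := by ring

/-- The error of order `‖z - a‖ ^ (2 * m)` is the gain that later beats the singularity of the
potential at a point of multiplicity `m`. -/
lemma sq_norm_le_jet {F : ℂ → ℂ} {a z : ℂ} {R S : ℝ} (hR0 : 0 < R) (hR : R < 1)
    (hF : DifferentiableOn ℂ F (Metric.ball a 1))
    (hS : ∀ z ∈ Metric.closedBall a (R / 2), ‖F z‖ ≤ S) (m : ℕ) (hz : ‖z - a‖ ≤ R / 4) :
    ‖F z‖ ^ 2 ≤ 2 * m * ∑ j ∈ Finset.range m, ‖iteratedDeriv j F a‖ ^ 2 +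
      8 * S ^ 2 * (2 / R) ^ (2 * m) * ‖z - a‖ ^ (2 * m) := by
  have hS0 : 0 ≤ S := (norm_nonneg _).trans (hS a (Metric.mem_closedBall_self (by positivity)))
  have h1 := norm_sub_taylor_le hR0 hR hF hS m hz
  set T := ∑ j ∈ Finset.range m, ((j.factorial : ℂ)⁻¹ * (z - a) ^ j * iteratedDeriv j F a) with hT
  have h2 : ‖T‖ ≤ ∑ j ∈ Finset.range m, ‖iteratedDeriv j F a‖ := by
    refine (norm_sum_le _ _).trans (Finset.sum_le_sum fun j _ => ?_)
    have hj : (1 : ℝ) ≤ j.factorial := by exact_mod_cast j.factorial_pos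
    rw [norm_mul, norm_mul, norm_inv, norm_pow, Complex.norm_natCast]
    have : (j.factorial : ℝ)⁻¹ * ‖z - a‖ ^ j ≤ 1 :=
      mul_le_one₀ (inv_le_one_of_one_le₀ hj) (by positivity)
        (pow_le_one₀ (norm_nonneg _) (by linarith))
    exact mul_le_of_le_one_left (norm_nonneg _) this
  have h3 : ‖T‖ ^ 2 ≤ m * ∑ j ∈ Finset.range m, ‖iteratedDeriv j F a‖ ^ 2 := by
    refine (pow_le_pow_left₀ (norm_nonneg _) h2 2).trans ?_
    simpa using sq_sum_le_card_mul_sum_sq (s := Finset.range m)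
      (f := fun j => ‖iteratedDeriv j F a‖)
  have h4 : ‖F z‖ ≤ ‖F z - T‖ + ‖T‖ := by
    simpa using norm_add_le (F z - T) T
  have h5 : ‖F z‖ ^ 2 ≤ 2 * ‖F z - T‖ ^ 2 + 2 * ‖T‖ ^ 2 := by
    nlinarith [norm_nonneg (F z), sq_nonneg (‖F z - T‖ - ‖T‖)]
  have h6 : ‖F z - T‖ ^ 2 ≤ (2 * S * (2 * ‖z - a‖ / R) ^ m) ^ 2 :=
    pow_le_pow_left₀ (norm_nonneg _) h1 2
  have h7 : (2 * S * (2 * ‖z - a‖ / R) ^ m) ^ 2 =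
      4 * S ^ 2 * (2 / R) ^ (2 * m) * ‖z - a‖ ^ (2 * m) := by
    rw [show 2 * ‖z - a‖ / R = 2 / R * ‖z - a‖ by ring, mul_pow (2 / R), mul_comm 2 m, pow_mul,
      pow_mul]
    ring
  rw [h7] at h6
  linarith

lemma norm_sq_gauge (f g : ℂ → ℂ) (z : ℂ) :
    ‖f z * Complex.exp (-g z / 2)‖ ^ 2 = ‖f z‖ ^ 2 * Real.exp (-(g z).re) := by
  rw [norm_mul, Complex.norm_exp, mul_pow, ← Real.exp_nat_mul]
  congr 2
  simp
  ring

/-- Uniform local estimates between point evaluations of `(∂̄*_φ)^j f` and local `L²` norms. -/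
theorem exists_local_estimates {φ L : ℂ → ℝ} (hφ : Subharmonic φ) (h : IsDistribLaplacian φ L)
    (hL : Continuous L) {M : ℝ} (hM : ∀ z, |L z| ≤ M) (n : ℕ)
    (hn : 2 ≤ n → ContDiff ℝ ((n + 1 : ℕ) : ℕ∞) φ ∧ ∀ j : ℕ, 1 ≤ j → j ≤ n - 1 →
      ∃ C : ℝ, ∀ z, ‖wirtinger^[j] (fun w => (quarterLaplacian φ w : ℂ)) z‖ ≤ C)
    {R : ℝ} (hR0 : 0 < R) (hR : R < 1) :
    ∃ C : ℝ, 0 < C ∧ ∀ (f : ℂ → ℂ), Differentiable ℂ f → ∀ a : ℂ,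
      (∀ j ≤ n, ‖(dbarStar φ)^[j] f a‖ ^ 2 * Real.exp (-φ a) ≤
        C * ∫ w in Metric.ball a R, ‖f w‖ ^ 2 * Real.exp (-φ w)) ∧
      ∀ m ≤ n + 1, ∀ z, ‖z - a‖ ≤ R / 4 → ‖f z‖ ^ 2 * Real.exp (-φ z) ≤
        C * ∑ j ∈ Finset.range m, ‖(dbarStar φ)^[j] f a‖ ^ 2 * Real.exp (-φ a) +
        C * ‖z - a‖ ^ (2 * m) * ∫ w in Metric.ball a R, ‖f w‖ ^ 2 * Real.exp (-φ w) := by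
  obtain ⟨Cg, hCg, hgauge⟩ := exists_gauge hφ h hL hM n hn
  obtain ⟨C₁, hC₁, hmv⟩ := exists_sq_norm_le_integral hR0 hR
  have c1 : ContDiff ℝ 1 φ := contDiff_one_of_distribLaplacian hφ h hL
  have cn : ContDiff ℝ (n : ℕ∞) φ := by
    by_cases h2 : 2 ≤ n
    · exact (hn h2).1.of_le (by norm_cast; omega)
    · exact c1.of_le (by norm_cast; omega)
  set E := Real.exp Cg with hE
  have hE0 : 0 < E := Real.exp_pos _
  set D : ℕ → ℝ := fun j => (j.factorial / (R / 2) ^ j) ^ 2 * (C₁ * E) with hD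
  set K : ℕ → ℝ := fun m => E * (2 * m) + E * (8 * (C₁ * E) * (2 / R) ^ (2 * m)) with hK
  have hD0 : ∀ j, 0 ≤ D j := fun j => by positivity
  have hK0 : ∀ j, 0 ≤ K j := fun j => by positivity
  -- One constant for all orders: the range reaches `n + 1`, the largest possible multiplicity.
  set C := ∑ j ∈ Finset.range (n + 2), (D j + K j) + 1 with hC
  have hS0 : 0 ≤ ∑ j ∈ Finset.range (n + 2), (D j + K j) :=
    Finset.sum_nonneg fun j _ => add_nonneg (hD0 j) (hK0 j)
  have hDK : ∀ j < n + 2, D j + K j ≤ C := fun j hj => by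
    have := Finset.single_le_sum (f := fun j => D j + K j)
      (fun j _ => add_nonneg (hD0 j) (hK0 j)) (Finset.mem_range.2 hj)
    linarith
  refine ⟨C, by linarith, fun f hf a => ?_⟩
  obtain ⟨g, hg, hga, hgb, hgz⟩ := hgauge a
  set F : ℂ → ℂ := fun w => f w * Complex.exp (-g w / 2) with hF
  have hFd : DifferentiableOn ℂ F (Metric.ball a 1) :=
    hf.differentiableOn.mul (hg.neg.div_const 2).cexp
  have hga' : AnalyticAt ℂ g a := hg.analyticAt (Metric.ball_mem_nhds a one_pos)
  set N := ∫ w in Metric.ball a R, ‖f w‖ ^ 2 * Real.exp (-φ w) with hN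
  have cN : Continuous fun w => ‖f w‖ ^ 2 * Real.exp (-φ w) :=
    (hf.continuous.norm.pow 2).mul (Real.continuous_exp.comp c1.continuous.neg)
  have iN : IntegrableOn (fun w => ‖f w‖ ^ 2 * Real.exp (-φ w)) (Metric.ball a R) :=
    (cN.continuousOn.integrableOn_compact (isCompact_closedBall a R)).mono_set
      Metric.ball_subset_closedBall
  have hN0 : 0 ≤ N := integral_nonneg fun w => by positivity
  have jet : ∀ j ≤ n, ‖(dbarStar φ)^[j] f a‖ ^ 2 * Real.exp (-φ a) = ‖iteratedDeriv j F a‖ ^ 2 :=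
    fun j hj => dbarStar_iterate_gauge n cn.contDiffAt hga' (hf.analyticAt a) hga hgz j hj
  have hI : ∫ w in Metric.ball a R, ‖F w‖ ^ 2 ≤ E * N := by
    rw [hN, ← integral_const_mul]
    refine setIntegral_mono_on (integrableOn_sq_norm hR hFd) (iN.const_mul E)
      Metric.isOpen_ball.measurableSet fun w hw => ?_
    rw [hF, norm_sq_gauge]
    have := (abs_le.1 (hgb w (Metric.ball_subset_ball hR.le hw))).2
    have he : Real.exp (-(g w).re) ≤ E * Real.exp (-φ w) := by
      rw [hE, ← Real.exp_add]; exact Real.exp_le_exp.2 (by linarith)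
    calc ‖f w‖ ^ 2 * Real.exp (-(g w).re) ≤ ‖f w‖ ^ 2 * (E * Real.exp (-φ w)) := by gcongr
      _ = _ := by ring
  -- `S` dominates `|F|` on the disc of radius `R / 2`; both the Cauchy estimates and the Taylor
  -- remainder are expressed through it.
  set S := Real.sqrt (C₁ * (E * N)) with hS
  have hS2 : S ^ 2 = C₁ * (E * N) := Real.sq_sqrt (by positivity)
  have hFS : ∀ z ∈ Metric.closedBall a (R / 2), ‖F z‖ ≤ S := fun z hz => by
    refine Real.le_sqrt_of_sq_le ((hmv F a hFd z hz).trans ?_)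
    gcongr
  refine ⟨fun j hj => ?_, fun m hm z hz => ?_⟩
  · rw [jet j hj]
    have h1 := pow_le_pow_left₀ (norm_nonneg _) (norm_iteratedDeriv_le hR0 hR hFd hFS j) 2
    have h2 : ((j.factorial : ℝ) * S / (R / 2) ^ j) ^ 2 = D j * N := by
      rw [mul_div_right_comm, mul_pow, hS2, hD]; ring
    rw [h2] at h1
    refine h1.trans (mul_le_mul_of_nonneg_right ?_ hN0)
    linarith [hDK j (by omega), hK0 j]
  · have hzb : z ∈ Metric.ball a 1 := by rw [Metric.mem_ball, dist_eq_norm]; linarith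
    have h1 := sq_norm_le_jet hR0 hR hFd hFS m hz
    rw [hF, norm_sq_gauge, hS2] at h1
    have he : Real.exp (-φ z) ≤ E * Real.exp (-(g z).re) := by
      have := (abs_le.1 (hgb z hzb)).1
      rw [hE, ← Real.exp_add]; exact Real.exp_le_exp.2 (by linarith)
    have e : ∑ j ∈ Finset.range m, ‖(dbarStar φ)^[j] f a‖ ^ 2 * Real.exp (-φ a) =
        ∑ j ∈ Finset.range m, ‖iteratedDeriv j F a‖ ^ 2 :=
      Finset.sum_congr rfl fun j hj => jet j (by have := Finset.mem_range.1 hj; omega)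
    rw [e]
    set J := ∑ j ∈ Finset.range m, ‖iteratedDeriv j F a‖ ^ 2 with hJ
    have hJ0 : 0 ≤ J := Finset.sum_nonneg fun _ _ => by positivity
    have hKm : K m ≤ C := by linarith [hDK m (by omega), hD0 m]
    have k1 : E * (2 * m) ≤ C := le_trans (by rw [hK]; simp only; linarith [show 0 ≤ E * (8 * (C₁ * E) * (2 / R) ^ (2 * m)) by positivity]) hKm
    have k2 : E * (8 * (C₁ * E) * (2 / R) ^ (2 * m)) ≤ C := le_trans (by rw [hK]; simp only; linarith [show 0 ≤ E * (2 * (m : ℝ)) by positivity]) hKm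
    calc ‖f z‖ ^ 2 * Real.exp (-φ z) ≤ ‖f z‖ ^ 2 * (E * Real.exp (-(g z).re)) := by gcongr
      _ = E * (‖f z‖ ^ 2 * Real.exp (-(g z).re)) := by ring
      _ ≤ E * (2 * m * J + 8 * (C₁ * (E * N)) * (2 / R) ^ (2 * m) * ‖z - a‖ ^ (2 * m)) := by
        gcongr
      _ = E * (2 * m) * J + E * (8 * (C₁ * E) * (2 / R) ^ (2 * m)) *
          (‖z - a‖ ^ (2 * m) * N) := by ring
      _ ≤ C * J + C * (‖z - a‖ ^ (2 * m) * N) := by gcongr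
      _ = _ := by ring

/-! ### The weighted inequality for a weight that need not be smooth -/

/-- Integrated form of `Δ(|f|² e^{-ψ}) ≥ -Δψ |f|² e^{-ψ}` for `ψ = φ + v`. -/
lemma integral_weight_nonneg {φ L : ℂ → ℝ} (hφ : Subharmonic φ) (h : IsDistribLaplacian φ L)
    (hL : Continuous L) {M : ℝ} (hM : ∀ z, |L z| ≤ M) {f : ℂ → ℂ} (hf : Differentiable ℂ f)
    {v κ : ℂ → ℝ} (hv : ContDiff ℝ 2 v) (hκ : ContDiff ℝ 2 κ) (hc : HasCompactSupport κ)
    (h0 : ∀ z, 0 ≤ κ z) :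
    0 ≤ ∫ z, (κ z * (L z + quarterLaplacian v z) + quarterLaplacian κ z) *
      (‖f z‖ ^ 2 * Real.exp (-(φ z + v z))) := by
  have cφ : Continuous φ := (contDiff_one_of_distribLaplacian hφ h hL).continuous
  set σ : ℕ → ℝ := fun n => 1 / ((n : ℝ) + 1) with hσ
  have σpos : ∀ n, 0 < σ n := fun n => by positivity
  have σlim : Tendsto σ atTop (𝓝[>] 0) := by
    rw [tendsto_nhdsWithin_iff]
    exact ⟨tendsto_one_div_add_atTop_nhds_zero_nat, Eventually.of_forall fun n => σpos n⟩
  have cs : ∀ n, ContDiff ℝ 2 (mollify (σ n) φ) := fun n =>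
    (contDiff_mollify (σpos n) h.1).of_le (by norm_cast)
  have key : ∀ n, 0 ≤ ∫ z, (κ z * (mollify (σ n) L z + quarterLaplacian v z) +
      quarterLaplacian κ z) * (‖f z‖ ^ 2 * Real.exp (-(mollify (σ n) φ z + v z))) := fun n => by
    have := integral_weight_nonneg_of_smooth hf ((cs n).add hv) hκ hc h0
    have e : ∀ z, quarterLaplacian (fun w => mollify (σ n) φ w + v w) z =
        mollify (σ n) L z + quarterLaplacian v z := fun z => by
      rw [quarterLaplacian_add (cs n).contDiffAt hv.contDiffAt, quarterLaplacian_mollify h (σpos n)]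
    simpa only [e] using this
  have cv2 := continuous_quarterLaplacian hv
  have cκ2 := continuous_quarterLaplacian hκ
  have molL : ∀ n z, |mollify (σ n) L z| ≤ M := fun n z => by
    have := norm_mollify_sub_le (σpos n) h.2.1 (z := z) (0 : ℝ) (ε := M) fun w _ => by
      simpa using hM (z + w)
    simpa using this
  -- The smooth case for the mollified weights, in the limit by dominated convergence.
  -- Mollifications of `L` stay bounded by `M`, and subharmonicity gives `φ ≤ mollify (σ n) φ`, so
  -- the exponentials are dominated by the limiting one.
  refine ge_of_tendsto' (tendsto_integral_of_dominated_convergence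
    (fun z => (κ z * (M + |quarterLaplacian v z|) + |quarterLaplacian κ z|) *
      (‖f z‖ ^ 2 * Real.exp (-(φ z + v z)))) (fun n => ?_) ?_ (fun n => ?_) ?_) key
  · have c1 : Continuous (mollify (σ n) L) := (contDiff_mollify (σpos n) h.2.1).continuous
    have c2 := (cs n).continuous
    have c3 := hf.continuous
    have c4 := hκ.continuous
    have c5 := hv.continuous
    exact (by fun_prop : Continuous fun z => (κ z * (mollify (σ n) L z + quarterLaplacian v z) +
      quarterLaplacian κ z) *
        (‖f z‖ ^ 2 * Real.exp (-(mollify (σ n) φ z + v z)))).aestronglyMeasurable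
  · have c3 := hf.continuous
    have c4 := hκ.continuous
    have c5 := hv.continuous
    refine Continuous.integrable_of_hasCompactSupport (by fun_prop) ?_
    refine HasCompactSupport.mul_right ?_
    exact hc.mul_right.add (hasCompactSupport_quarterLaplacian hc).abs
  · refine Eventually.of_forall fun z => ?_
    rw [norm_mul, Real.norm_of_nonneg (by positivity : 0 ≤ ‖f z‖ ^ 2 *
      Real.exp (-(mollify (σ n) φ z + v z))), Real.norm_eq_abs]
    have h1 : |κ z * (mollify (σ n) L z + quarterLaplacian v z) + quarterLaplacian κ z| ≤
        κ z * (M + |quarterLaplacian v z|) + |quarterLaplacian κ z| := by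
      refine (abs_add_le _ _).trans (add_le_add ?_ le_rfl)
      rw [abs_mul, abs_of_nonneg (h0 z)]
      exact mul_le_mul_of_nonneg_left ((abs_add_le _ _).trans (add_le_add (molL n z) le_rfl)) (h0 z)
    have h2 : Real.exp (-(mollify (σ n) φ z + v z)) ≤ Real.exp (-(φ z + v z)) := by
      have := hφ.le_mollify h.1 (σpos n) z
      exact Real.exp_le_exp.2 (by linarith)
    have h3 : 0 ≤ κ z * (M + |quarterLaplacian v z|) + |quarterLaplacian κ z| :=
      (abs_nonneg _).trans h1
    gcongr
  · refine Eventually.of_forall fun z => ?_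
    have t1 := (tendsto_mollify_of_continuous hL z).comp σlim
    have t2 := (hφ.tendsto_mollify h.1 z).comp σlim
    have e : Tendsto (fun n => Real.exp (-(mollify (σ n) φ z + v z))) atTop
        (𝓝 (Real.exp (-(φ z + v z)))) :=
      (Real.continuous_exp.tendsto _).comp (t2.add_const _).neg
    exact (((t1.add_const _).const_mul _).add_const _).mul (e.const_mul _)

/-! ### The regularized logarithmic potential -/

lemma deriv_smoothTransition_of_one_le {x : ℝ} (hx : 1 ≤ x) : deriv Real.smoothTransition x = 0 := by
  refine IsLocalMax.deriv_eq_zero (Eventually.of_forall fun y => ?_)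
  rw [Real.smoothTransition.one_of_one_le hx]
  exact Real.smoothTransition.le_one y

lemma deriv_smoothTransition_of_nonpos {x : ℝ} (hx : x ≤ 0) : deriv Real.smoothTransition x = 0 := by
  refine IsLocalMin.deriv_eq_zero (Eventually.of_forall fun y => ?_)
  rw [Real.smoothTransition.zero_of_nonpos hx]
  exact Real.smoothTransition.nonneg y

/-- A compactly supported decreasing profile with prescribed slope near the origin. -/
lemma exists_profile {r θ : ℝ} (hr : 0 < r) (hθ : 0 < θ) (hθ1 : θ < 1) :
    ∃ (q T : ℝ) (d D : ℝ → ℝ), 0 < q ∧ q < 1 ∧ r ^ 2 < T ∧ Continuous d ∧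
      (∀ t, HasDerivAt D (-d t) t) ∧ (∀ t, 0 ≤ d t) ∧ (∀ t ≤ r ^ 2, d t = θ / r ^ 2) ∧
      (∀ t, 0 ≤ D t) ∧ (∀ t, 0 ≤ t → D t ≤ q) ∧ ∀ t, T ≤ t → D t = 0 := by
  obtain ⟨q, hq1, hq2⟩ := exists_between hθ1
  have hr2 : 0 < r ^ 2 := by positivity
  -- Chosen so that `θ / r ^ 2 * T = q`. As `d ≤ θ / r ^ 2`, this caps `D`, the integral of `d` from
  -- `t` to `T`, by `q`.
  set T := r ^ 2 * (q / θ) with hT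
  have hTr : r ^ 2 < T := by
    have : 1 < q / θ := by rwa [lt_div_iff₀ hθ, one_mul]
    nlinarith
  -- Constant up to `r ^ 2`, then linear down to zero at `T`.
  set d : ℝ → ℝ := fun s => θ / r ^ 2 * max 0 (min 1 ((T - s) / (T - r ^ 2))) with hd
  have cd : Continuous d := by
    have : T - r ^ 2 ≠ 0 := by linarith
    fun_prop
  have hd0 : ∀ t, 0 ≤ d t := fun t => mul_nonneg (by positivity) (le_max_left _ _)
  have hd1 : ∀ t, d t ≤ θ / r ^ 2 := fun t => by
    have : max 0 (min 1 ((T - t) / (T - r ^ 2))) ≤ 1 := max_le zero_le_one (min_le_left _ _)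
    exact mul_le_of_le_one_right (by positivity) this
  have hdT : ∀ t, T ≤ t → d t = 0 := fun t ht => by
    have : (T - t) / (T - r ^ 2) ≤ 0 := div_nonpos_of_nonpos_of_nonneg (by linarith) (by linarith)
    simp only [hd]
    rw [max_eq_left ((min_le_right _ _).trans this), mul_zero]
  refine ⟨q, T, d, fun t => ∫ s in t..T, d s, by linarith, hq2, hTr, cd, fun t => ?_, hd0,
    fun t ht => ?_, fun t => ?_, fun t ht => ?_, fun t ht => ?_⟩
  · exact intervalIntegral.integral_hasDerivAt_left (cd.intervalIntegrable _ _)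
      cd.stronglyMeasurable.stronglyMeasurableAtFilter cd.continuousAt
  · have : 1 ≤ (T - t) / (T - r ^ 2) := by rw [le_div_iff₀ (by linarith)]; linarith
    simp only [hd]
    rw [min_eq_left this]; simp
  · rcases le_total t T with h | h
    · exact intervalIntegral.integral_nonneg h fun s _ => hd0 s
    · apply le_of_eq
      beta_reduce
      rw [intervalIntegral.integral_symm, intervalIntegral.integral_congr (g := fun _ => (0 : ℝ))]
      · simp
      · intro s hs
        rw [Set.uIcc_of_le h] at hs
        exact hdT s hs.1
  · rcases le_total t T with h | h
    · calc ∫ s in t..T, d s ≤ ∫ s in t..T, θ / r ^ 2 :=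
            intervalIntegral.integral_mono_on h (cd.intervalIntegrable _ _)
              (continuous_const.intervalIntegrable _ _) fun s _ => hd1 s
        _ = θ / r ^ 2 * (T - t) := by rw [intervalIntegral.integral_const, smul_eq_mul]; ring
        _ ≤ θ / r ^ 2 * T := by gcongr; linarith
        _ = q := by rw [hT]; field_simp
    · beta_reduce
      rw [intervalIntegral.integral_symm, intervalIntegral.integral_congr (g := fun _ => (0 : ℝ))]
      · simp; linarith
      · intro s hs
        rw [Set.uIcc_of_le h] at hs
        exact hdT s hs.1
  · simp only
    rw [intervalIntegral.integral_symm, intervalIntegral.integral_congr (g := fun _ => (0 : ℝ))]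
    · simp
    · intro s hs
      rw [Set.uIcc_of_le ht] at hs
      exact hdT s hs.1

/-- Regularized logarithmic potentials `G(|z|²)`. -/
theorem exists_radial_potential {r θ : ℝ} (hr : 0 < r) (hθ : 0 < θ) (hθ1 : θ < 1) :
    ∃ q T C : ℝ, 0 < q ∧ q < 1 ∧ r ^ 2 < T ∧ 0 < C ∧ ∀ ε : ℝ, 0 < ε → ε ≤ r →
      ∃ G k k' : ℝ → ℝ, ContDiff ℝ 2 G ∧ (∀ t, HasDerivAt G (k t) t) ∧
        (∀ t, HasDerivAt k (k' t) t) ∧ (∀ t, 0 ≤ t → G t ≤ 0) ∧ (∀ t, T ≤ t → G t = 0) ∧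
        (∀ τ, 0 < τ → τ ≤ T → ∀ t, τ ≤ t → -G t ≤ q * Real.log (T / τ)) ∧
        (∀ t, 0 ≤ t → -G t ≤ q * Real.log (2 * T / ε ^ 2)) ∧
        (∀ t, 0 ≤ t → k t + t * k' t ≤ C / ε ^ 2) ∧
        (∀ t, ε ^ 2 ≤ t → k t + t * k' t ≤ 0) ∧
        ∀ t, ε ^ 2 ≤ t → t ≤ r ^ 2 → k t + t * k' t ≤ -(θ / r ^ 2) := by
  obtain ⟨q, T, d, D, hq0, hq1, hT, cd, hD, hd0, hdr, hD0, hDq, hDT⟩ := exists_profile hr hθ hθ1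
  obtain ⟨C, hC, hC1, -⟩ := exists_bound_deriv_smoothTransition
  have hT0 : 0 < T := lt_trans (by positivity) hT
  refine ⟨q, T, 2 * C, hq0, hq1, hT, by positivity, fun ε hε hεr => ?_⟩
  have hε2 : 0 < ε ^ 2 := by positivity
  have hεT : ε ^ 2 < T := lt_of_le_of_lt (pow_le_pow_left₀ hε.le hεr 2) hT
  -- A switch from `0` to `1` between `ε² / 2` and `ε²`; its slope is the source of the constant `2
  -- * C`.
  set s : ℝ → ℝ := fun t => Real.smoothTransition (2 / ε ^ 2 * t - 1) with hs
  set s' : ℝ → ℝ := fun t => deriv Real.smoothTransition (2 / ε ^ 2 * t - 1) * (2 / ε ^ 2) with hs'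
  have hsd : ∀ t, HasDerivAt s (s' t) t := fun t => by
    have hl : HasDerivAt (fun t => 2 / ε ^ 2 * t - 1) (2 / ε ^ 2) t := by
      simpa using ((hasDerivAt_id t).const_mul (2 / ε ^ 2)).sub_const 1
    exact (hasDerivAt_smoothTransition _).comp t hl
  have cs : ContDiff ℝ 1 s := Real.smoothTransition.contDiff.comp
    ((contDiff_const.mul contDiff_id).sub contDiff_const)
  have arg : ∀ t, t ≤ ε ^ 2 / 2 → 2 / ε ^ 2 * t - 1 ≤ 0 := fun t ht => by
    have : 2 / ε ^ 2 * t ≤ 2 / ε ^ 2 * (ε ^ 2 / 2) := by gcongr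
    rw [show 2 / ε ^ 2 * (ε ^ 2 / 2) = 1 by field_simp] at this
    linarith
  have arg1 : ∀ t, ε ^ 2 ≤ t → 1 ≤ 2 / ε ^ 2 * t - 1 := fun t ht => by
    have : 2 / ε ^ 2 * ε ^ 2 ≤ 2 / ε ^ 2 * t := by gcongr
    rw [show 2 / ε ^ 2 * ε ^ 2 = 2 by field_simp] at this
    linarith
  have s0 : ∀ t, t ≤ ε ^ 2 / 2 → s t = 0 := fun t ht =>
    Real.smoothTransition.zero_of_nonpos (arg t ht)
  have s1 : ∀ t, ε ^ 2 ≤ t → s t = 1 := fun t ht => Real.smoothTransition.one_of_one_le (arg1 t ht)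
  have s'0 : ∀ t, t ≤ ε ^ 2 / 2 → s' t = 0 := fun t ht => by
    simp only [hs', deriv_smoothTransition_of_nonpos (arg t ht), zero_mul]
  have s'1 : ∀ t, ε ^ 2 ≤ t → s' t = 0 := fun t ht => by
    simp only [hs', deriv_smoothTransition_of_one_le (arg1 t ht), zero_mul]
  have hs0 : ∀ t, 0 ≤ s t := fun t => Real.smoothTransition.nonneg _
  have hs1 : ∀ t, s t ≤ 1 := fun t => Real.smoothTransition.le_one _
  have cD : ContDiff ℝ 1 D := by
    rw [contDiff_one_iff_deriv]
    refine ⟨fun t => (hD t).differentiableAt, ?_⟩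
    rw [show deriv D = fun t => -d t from funext fun t => (hD t).deriv]
    exact cd.neg
  -- With `G' = k` one has `t G' = s D`, so the Laplacian is `(s D)' = s' D - s d`: large only where
  -- the switch acts, and `-d` beyond `ε²`.
  set k : ℝ → ℝ := fun t => s t * D t * t⁻¹ with hk
  have k0 : ∀ t, t ≤ ε ^ 2 / 2 → k t = 0 := fun t ht => by simp only [hk, s0 t ht, zero_mul]
  have ck : ContDiff ℝ 1 k := by
    rw [contDiff_iff_contDiffAt]
    intro t
    by_cases ht : t = 0
    · subst ht
      have e : k =ᶠ[𝓝 0] fun _ => 0 := by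
        filter_upwards [Iio_mem_nhds (show (0 : ℝ) < ε ^ 2 / 2 by positivity)] with y hy
          using k0 y (le_of_lt hy)
      exact contDiffAt_const.congr_of_eventuallyEq e
    · exact (cs.contDiffAt.mul cD.contDiffAt).mul (contDiffAt_inv ℝ ht)
  have hkd : ∀ t, HasDerivAt k (deriv k t) t := fun t =>
    (ck.differentiable (by simp) t).hasDerivAt
  have formula : ∀ t, 0 ≤ t → k t + t * deriv k t = s' t * D t - s t * d t := fun t ht => by
    rcases ht.eq_or_lt with rfl | ht
    · rw [k0 0 (by positivity), s'0 0 (by positivity), s0 0 (by positivity)]; ring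
    · have := (((hsd t).mul (hD t)).mul (hasDerivAt_inv ht.ne')).deriv
      rw [show deriv k t = _ from this]
      simp only [hk, Pi.mul_apply]
      field_simp
      ring
  have kT : ∀ t, T ≤ t → k t = 0 := fun t ht => by simp only [hk, hDT t ht]; ring
  have knn : ∀ t, 0 ≤ t → 0 ≤ k t := fun t ht =>
    mul_nonneg (mul_nonneg (hs0 t) (hD0 t)) (inv_nonneg.2 ht)
  have kle : ∀ t, 0 < t → k t ≤ q * (1 / t) := fun t ht => by
    simp only [hk]
    rw [one_div]
    refine mul_le_mul_of_nonneg_right ?_ (by positivity)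
    calc s t * D t ≤ 1 * q := mul_le_mul (hs1 t) (hDq t ht.le) (hD0 t) zero_le_one
      _ = q := one_mul q
  set G : ℝ → ℝ := fun t => ∫ x in T..t, k x with hG
  have hGd : ∀ t, HasDerivAt G (k t) t := fun t =>
    intervalIntegral.integral_hasDerivAt_right (ck.continuous.intervalIntegrable _ _)
      ck.continuous.stronglyMeasurable.stronglyMeasurableAtFilter ck.continuous.continuousAt
  have cG : ContDiff ℝ 2 G := by
    refine (contDiff_succ_iff_deriv (n := 1)).2 ⟨fun t => (hGd t).differentiableAt, by simp, ?_⟩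
    rwa [show deriv G = k from funext fun t => (hGd t).deriv]
  have GT : ∀ t, T ≤ t → G t = 0 := fun t ht => by
    simp only [hG]
    rw [intervalIntegral.integral_congr (g := fun _ => (0 : ℝ))]
    · simp
    · intro x hx
      rw [Set.uIcc_of_le ht] at hx
      exact kT x hx.1
  have negG : ∀ t, -G t = ∫ x in t..T, k x := fun t => by
    simp only [hG]; rw [intervalIntegral.integral_symm, neg_neg]
  have Gle : ∀ t, 0 ≤ t → G t ≤ 0 := fun t ht => by
    rcases le_total t T with h | h
    · have : 0 ≤ -G t := by
        rw [negG]
        exact intervalIntegral.integral_nonneg h fun x hx => knn x (ht.trans hx.1)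
      linarith
    · rw [GT t h]
  -- Since `s D ≤ q`, the integrand `k` is at most `q / x`, so `G` has a logarithmic singularity of
  -- strength at most `q`.
  have Glog : ∀ τ, 0 < τ → τ ≤ T → ∀ t, τ ≤ t → -G t ≤ q * Real.log (T / τ) := by
    intro τ hτ hτT t ht
    have ht0 : 0 < t := hτ.trans_le ht
    rcases le_total t T with h | h
    · rw [negG]
      have hpos : ∀ x ∈ Set.uIcc t T, x ≠ 0 := fun x hx => by
        rw [Set.uIcc_of_le h] at hx
        exact (ht0.trans_le hx.1).ne'
      have hii : IntervalIntegrable (fun x : ℝ => q * (1 / x)) volume t T :=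
        (intervalIntegral.intervalIntegrable_one_div hpos continuousOn_id).const_mul q
      calc ∫ x in t..T, k x ≤ ∫ x in t..T, q * (1 / x) :=
            intervalIntegral.integral_mono_on h (ck.continuous.intervalIntegrable _ _) hii
              fun x hx => kle x (ht0.trans_le hx.1)
        _ = q * Real.log (T / t) := by
          rw [intervalIntegral.integral_const_mul, integral_one_div_of_pos ht0 hT0]
        _ ≤ q * Real.log (T / τ) := by gcongr
    · rw [GT t h, neg_zero]
      refine mul_nonneg hq0.le (Real.log_nonneg ?_)
      rwa [le_div_iff₀ hτ, one_mul]
  refine ⟨G, k, deriv k, cG, hGd, hkd, Gle, GT, Glog, fun t ht => ?_, fun t ht => ?_,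
    fun t ht => ?_, fun t ht ht2 => ?_⟩
  · have e : 2 * T / ε ^ 2 = T / (ε ^ 2 / 2) := by field_simp
    rw [e]
    rcases le_total t (ε ^ 2 / 2) with h | h
    -- Below `ε² / 2` the integrand `k` vanishes and `G` is constant, so the worst value is the one
    -- at `ε² / 2`.
    · have : G t = G (ε ^ 2 / 2) := by
        have h1 : G (ε ^ 2 / 2) - G t = ∫ x in t..(ε ^ 2 / 2), k x :=
          intervalIntegral.integral_interval_sub_left (ck.continuous.intervalIntegrable _ _)
            (ck.continuous.intervalIntegrable _ _)
        rw [intervalIntegral.integral_congr (g := fun _ => (0 : ℝ))] at h1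
        · simp only [intervalIntegral.integral_zero] at h1
          linarith
        · intro x hx
          rw [Set.uIcc_of_le h] at hx
          exact k0 x hx.2
      rw [this]
      exact Glog _ (by positivity) (by linarith) _ le_rfl
    · exact Glog _ (by positivity) (by linarith) _ h
  · rw [formula t ht]
    have h1 : s' t * D t ≤ C * (2 / ε ^ 2) * 1 := by
      have ha : s' t ≤ C * (2 / ε ^ 2) :=
        mul_le_mul_of_nonneg_right ((le_abs_self _).trans (hC1 _)) (by positivity)
      calc s' t * D t ≤ C * (2 / ε ^ 2) * D t := mul_le_mul_of_nonneg_right ha (hD0 t)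
        _ ≤ _ := mul_le_mul_of_nonneg_left ((hDq t ht).trans hq1.le) (by positivity)
    have h2 : 0 ≤ s t * d t := mul_nonneg (hs0 t) (hd0 t)
    calc _ ≤ C * (2 / ε ^ 2) * 1 := by linarith
      _ = _ := by ring
  · rw [formula t (hε2.le.trans ht), s'1 t ht, zero_mul, zero_sub]
    linarith [mul_nonneg (hs0 t) (hd0 t)]
  · rw [formula t (hε2.le.trans ht), s'1 t ht, s1 t ht, hdr t ht2]
    linarith

/-! ### Packing of separated sets and the counting function -/

lemma MultSet.mult_le (Λ : MultSet) (p : Λ.carrier) : Λ.mult p ≤ Λ.n + 1 := by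
  have h : Λ.mult p ≤ ⨆ p, Λ.mult p := le_ciSup Λ.bddAbove_mult p
  unfold MultSet.n
  omega

/-- Balls of radius at most half the separation constant are disjoint. -/
lemma sum_setIntegral_ball_le {s : Set ℂ} {ρ R : ℝ}
    (hs : ∀ p ∈ s, ∀ q ∈ s, p ≠ q → ρ ≤ dist p q) (hR : 2 * R ≤ ρ) {g : ℂ → ℝ}
    (hg : Integrable g) (h0 : ∀ z, 0 ≤ g z) (F : Finset s) :
    ∑ p ∈ F, ∫ z in Metric.ball (p : ℂ) R, g z ≤ ∫ z, g z := by
  rw [← integral_biUnion_finset F (fun p _ => measurableSet_ball) _ fun p _ => hg.integrableOn]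
  · exact setIntegral_le_integral hg (Eventually.of_forall h0)
  · intro p _ q _ hpq
    refine Metric.ball_disjoint_ball ?_
    have := hs p p.2 q q.2 fun e => hpq (Subtype.ext e)
    linarith

lemma volume_real_ball (a : ℂ) {R : ℝ} (hR : 0 ≤ R) :
    volume.real (Metric.ball a R) = R ^ 2 * Real.pi := by
  simp [Measure.real, Complex.volume_ball, ENNReal.toReal_ofReal hR]

/-- Area comparison: the disjoint discs of radius `ρ / 2` about the points lie in the disc of radius
`T + ρ`. -/
lemma card_le_of_separated {s : Set ℂ} {ρ : ℝ} (hρ : 0 < ρ)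
    (hs : ∀ p ∈ s, ∀ q ∈ s, p ≠ q → ρ ≤ dist p q) {T : ℝ} (hT : 0 ≤ T) (z : ℂ) (F : Finset s)
    (hF : ∀ p ∈ F, dist (p : ℂ) z ≤ T) : (F.card : ℝ) ≤ ((T + ρ) / (ρ / 2)) ^ 2 := by
  have hi : Integrable ((Metric.ball z (T + ρ)).indicator fun _ => (1 : ℝ)) :=
    (integrable_indicator_iff measurableSet_ball).2 (integrableOn_const measure_ball_lt_top.ne)
  have := sum_setIntegral_ball_le hs (R := ρ / 2) (by linarith) hi
    (fun z => Set.indicator_nonneg (fun _ _ => zero_le_one) z) F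
  rw [integral_indicator measurableSet_ball, setIntegral_const,
    volume_real_ball _ (by linarith)] at this
  have e : ∀ p ∈ F, ∫ w in Metric.ball (p : ℂ) (ρ / 2),
      (Metric.ball z (T + ρ)).indicator (fun _ => (1 : ℝ)) w = (ρ / 2) ^ 2 * Real.pi := fun p hp => by
    rw [setIntegral_congr_fun measurableSet_ball (g := fun _ => (1 : ℝ)), setIntegral_const,
      volume_real_ball _ (by linarith)]
    · simp
    · intro w hw
      refine Set.indicator_of_mem ?_ _
      have h1 := hF p hp
      have h2 := dist_triangle w p z
      simp only [Metric.mem_ball] at hw ⊢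
      linarith
  rw [Finset.sum_congr rfl e, Finset.sum_const, nsmul_eq_mul] at this
  rw [div_pow, le_div_iff₀ (by positivity)]
  have hpi := Real.pi_pos
  simp only [smul_eq_mul, mul_one] at this
  rw [← mul_assoc] at this
  exact le_of_mul_le_mul_right this hpi

lemma finite_of_separated {s : Set ℂ} {ρ : ℝ} (hρ : 0 < ρ)
    (hs : ∀ p ∈ s, ∀ q ∈ s, p ≠ q → ρ ≤ dist p q) {T : ℝ} (hT : 0 ≤ T) (z : ℂ) :
    {p : s | dist (p : ℂ) z ≤ T}.Finite := by
  by_contra hinf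
  obtain ⟨k, hk⟩ := exists_nat_gt (((T + ρ) / (ρ / 2)) ^ 2)
  obtain ⟨F, hF, hc⟩ := Set.Infinite.exists_subset_card_eq hinf k
  have := card_le_of_separated hρ hs hT z F fun p hp => hF hp
  rw [hc] at this
  linarith

/-- The averaged counting function as a finite sum. -/
lemma pi_mul_nuConvChi {Λ : MultSet} {r : ℝ} (hr : 0 < r) {z : ℂ} (hpos : 0 < Λ.nuConvChi r z)
    (S : Finset Λ.carrier) (hS : ∀ p : Λ.carrier, ‖z - p‖ < r → p ∈ S) :
    Real.pi * Λ.nuConvChi r z =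
      ∑ p ∈ S, (Λ.mult p : ℝ) * if ‖z - p‖ < r then 1 / r ^ 2 else 0 := by
  classical
  -- A non-integrable function has integral `0`, so positivity of the average already gives
  -- integrability.
  have hi : Integrable (fun w => chi r (z - w)) Λ.nu := by
    by_contra h
    rw [MultSet.nuConvChi, integral_undef h] at hpos
    exact lt_irrefl _ hpos
  have e : ∀ p : Λ.carrier, ∫ w, chi r (z - w) ∂(Λ.mult p • Measure.dirac (p : ℂ)) =
      (Λ.mult p : ℝ) * if ‖z - p‖ < r then 1 / (Real.pi * r ^ 2) else 0 := fun p => by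
    rw [← Nat.cast_smul_eq_nsmul ENNReal, integral_smul_measure, integral_dirac]
    simp [chi, Set.indicator_apply]
  rw [MultSet.nuConvChi, MultSet.nu, integral_sum_measure hi, tsum_congr e, tsum_eq_sum (s := S),
    Finset.mul_sum]
  · refine Finset.sum_congr rfl fun p _ => ?_
    have := Real.pi_ne_zero
    split_ifs
    · field_simp
    · simp
  · intro p hp
    rw [if_neg fun h => hp (hS p h), mul_zero]

/-! ### The potential attached to `Λ` -/

/-- The potential compensating `L` away from the points of `Λ`. -/
theorem exists_potential {Λ : MultSet} {ρ : ℝ} (hρ : 0 < ρ)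
    (hs : ∀ p ∈ Λ.carrier, ∀ q ∈ Λ.carrier, p ≠ q → ρ ≤ dist p q) {L : ℂ → ℝ} {M δ r : ℝ}
    (hM : ∀ z, 0 < L z ∧ L z ≤ M) (hδ : 0 < δ) (hr : 0 < r)
    (hdens : ∀ z : ℂ, Real.pi * Λ.nuConvChi r z > L z + δ) :
    ∃ s A W : ℝ, 0 < s ∧ 0 < A ∧ 0 < W ∧ ∀ ε, 0 < ε → ε ≤ 1 → ε ≤ r → 2 * ε ≤ ρ →
      ∃ B : ℝ, 0 < B ∧ ∀ R : ℝ, 0 < R → ∃ v : ℂ → ℝ, ContDiff ℝ 2 v ∧ (∀ z, v z ≤ 0) ∧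
        (∀ z, Real.exp (-v z) ≤ B) ∧
        (∀ p : Λ.carrier, 1 ≤ Λ.mult p → ∀ z : ℂ, ‖z - p‖ < ε →
          Real.exp (-v z) * ε ^ (2 * Λ.mult p) ≤ W * ε ^ s) ∧
        (∀ z : ℂ, ‖z‖ ≤ R → (∀ p : Λ.carrier, 1 ≤ Λ.mult p → ε ≤ ‖z - p‖) →
          L z + quarterLaplacian v z ≤ -(δ / 2)) ∧
        ∀ z : ℂ, ∀ p : Λ.carrier, ‖z - p‖ < ε → L z + quarterLaplacian v z ≤ A / ε ^ 2 := by
  have hM0 : 0 < M := (hM 0).1.trans_le (hM 0).2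
  -- Chosen so that `θ (x + δ) ≥ x + δ / 2` for all `x ≤ M`: equality holds at `x = M`, and `θ < 1`.
  set θ := (M + δ / 2) / (M + δ) with hθ
  have hθ0 : 0 < θ := by positivity
  have hθ1 : θ < 1 := by rw [hθ, div_lt_one (by positivity)]; linarith
  have hθM : θ * (M + δ) = M + δ / 2 := by rw [hθ]; field_simp
  obtain ⟨q, T, C, hq0, hq1, hT, hC, key⟩ := exists_radial_potential hr hθ0 hθ1
  have hT0 : 0 < T := lt_trans (by positivity) hT
  set m : ℝ := ((Λ.n + 1 : ℕ) : ℝ) with hm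
  have hm1 : 1 ≤ m := by rw [hm]; push_cast; linarith [(Nat.cast_nonneg Λ.n : (0 : ℝ) ≤ _)]
  have hmult : ∀ p : Λ.carrier, (Λ.mult p : ℝ) ≤ m := fun p => by
    rw [hm]; exact_mod_cast Λ.mult_le p
  set N : ℝ := ((√T + ρ) / (ρ / 2)) ^ 2 with hN
  -- Within `ε ≤ ρ / 2` of one point, all others are at distance at least `ρ / 2`; the minimum with
  -- `T` keeps the logarithm nonnegative.
  set τ := min (ρ ^ 2 / 4) T with hτ
  have hτ0 : 0 < τ := lt_min (by positivity) hT0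
  set b : ℝ := m * (q * Real.log (T / τ)) with hb
  have hb0 : 0 ≤ b := by
    have : 0 ≤ Real.log (T / τ) :=
      Real.log_nonneg (by rw [le_div_iff₀ hτ0, one_mul]; exact min_le_right _ _)
    positivity
  refine ⟨2 * (1 - q), M + m * C, Real.exp (N * b) * (max 1 (2 * T)) ^ m, by linarith,
    by positivity, by positivity, fun ε hε hε1 hεr hερ => ?_⟩
  obtain ⟨G, k, k', cG, hG, hk, hG0, hGT, hGτ, hGε, hkC, hk0, hkr⟩ := key ε hε hεr
  have hlog : 0 ≤ q * Real.log (2 * T / ε ^ 2) := by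
    refine mul_nonneg hq0.le (Real.log_nonneg ?_)
    rw [le_div_iff₀ (by positivity)]
    have : ε ^ 2 ≤ r ^ 2 := by gcongr
    linarith
  refine ⟨Real.exp (N * (m * (q * Real.log (2 * T / ε ^ 2)))), Real.exp_pos _, fun R hR => ?_⟩
  -- Finitely many points suffice: a disc of radius `r` about any other point misses the disc of
  -- radius `R`.
  have hfin := finite_of_separated hρ hs (T := R + r) (by positivity) 0
  set S : Finset Λ.carrier := hfin.toFinset with hS
  have cterm : ∀ p : Λ.carrier, ContDiff ℝ 2 fun z : ℂ => G (‖z - p‖ ^ 2) := fun p =>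
    cG.comp ((contDiff_id.sub contDiff_const).norm_sq ℝ)
  have hlap : ∀ z, quarterLaplacian (fun z => ∑ p ∈ S, (Λ.mult p : ℝ) * G (‖z - p‖ ^ 2)) z =
      ∑ p ∈ S, (Λ.mult p : ℝ) * (k (‖z - p‖ ^ 2) + ‖z - p‖ ^ 2 * k' (‖z - p‖ ^ 2)) := fun z => by
    rw [quarterLaplacian_sum S fun p _ => (contDiff_const.mul (cterm p)).contDiffAt]
    refine Finset.sum_congr rfl fun p _ => ?_
    rw [quarterLaplacian_const_mul _ (cterm p).contDiffAt, quarterLaplacian_radial hG hk cG]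
  -- Only points within `√T` of `z` contribute, and packing allows at most `N` of them.
  have hsum : ∀ (z : ℂ) (Q : Finset Λ.carrier) (c : ℝ), 0 ≤ c →
      (∀ p ∈ Q, -G (‖z - p‖ ^ 2) ≤ c) →
      ∑ p ∈ Q, (Λ.mult p : ℝ) * -G (‖z - p‖ ^ 2) ≤ N * (m * c) := by
    intro z Q c hc hQ
    rw [← Finset.sum_filter_add_sum_filter_not Q fun p : Λ.carrier => dist (p : ℂ) z ≤ √T]
    have h1 : ∑ p ∈ Q.filter (fun p : Λ.carrier => ¬ dist (p : ℂ) z ≤ √T), (Λ.mult p : ℝ) * -G (‖z - p‖ ^ 2) = 0 := by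
      refine Finset.sum_eq_zero fun p hp => ?_
      have := (Finset.mem_filter.1 hp).2
      rw [hGT, neg_zero, mul_zero]
      rw [not_le, dist_comm, dist_eq_norm] at this
      exact (Real.sqrt_le_left (norm_nonneg _)).1 this.le
    rw [h1, add_zero]
    have hcard := card_le_of_separated hρ hs (Real.sqrt_nonneg T) z
      (Q.filter fun p : Λ.carrier => dist (p : ℂ) z ≤ √T) fun p hp => (Finset.mem_filter.1 hp).2
    calc _ ≤ ∑ p ∈ Q.filter (fun p : Λ.carrier => dist (p : ℂ) z ≤ √T), m * c := by
          refine Finset.sum_le_sum fun p hp => ?_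
          have hp := hQ p (Finset.mem_filter.1 hp).1
          have := hmult p
          have h0 : 0 ≤ -G (‖z - p‖ ^ 2) := by linarith [hG0 (‖z - p‖ ^ 2) (by positivity)]
          gcongr
      _ ≤ N * (m * c) := by
          rw [Finset.sum_const, nsmul_eq_mul]
          gcongr
  have hother : ∀ z : ℂ, ∀ p : Λ.carrier, ‖z - p‖ < ε → ∀ p' : Λ.carrier, p' ≠ p →
      ρ / 2 ≤ ‖z - p'‖ := fun z p hp p' hpp => by
    have h1 := hs p' p'.2 p p.2 fun e => hpp (Subtype.ext e)
    have h2 := dist_triangle (p' : ℂ) z p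
    rw [dist_comm (p' : ℂ) z, dist_eq_norm z, dist_eq_norm z] at h2
    linarith
  have hv : ∀ z : ℂ, -∑ p ∈ S, (Λ.mult p : ℝ) * G (‖z - p‖ ^ 2) =
      ∑ p ∈ S, (Λ.mult p : ℝ) * -G (‖z - p‖ ^ 2) := fun z => by
    simp only [mul_neg, Finset.sum_neg_distrib]
  refine ⟨fun z : ℂ => ∑ p ∈ S, (Λ.mult p : ℝ) * G (‖z - p‖ ^ 2),
    ContDiff.sum fun p _ => contDiff_const.mul (cterm p), fun z => ?_, fun z => ?_,
    fun p hp z hz => ?_, fun z hz hzp => ?_, fun z p hz => ?_⟩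
  · exact Finset.sum_nonpos fun p _ =>
      mul_nonpos_of_nonneg_of_nonpos (Nat.cast_nonneg _) (hG0 _ (by positivity))
  · refine Real.exp_le_exp.2 ?_
    rw [hv]
    exact hsum z S _ hlog fun p _ => hGε _ (by positivity)
  -- The other points contribute a bounded amount; only `p` itself contributes a logarithm of `1 /
  -- ε`.
  · have h1 : -∑ p ∈ S, (Λ.mult p : ℝ) * G (‖z - p‖ ^ 2) ≤
        N * b + Λ.mult p * (q * Real.log (2 * T / ε ^ 2)) := by
      rw [hv]
      classical
      have hA : ∑ p' ∈ S.erase p, (Λ.mult p' : ℝ) * -G (‖z - p'‖ ^ 2) ≤ N * b := by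
        refine hsum z _ _ (by
          have := hb0
          rw [hb] at this
          exact nonneg_of_mul_nonneg_right this (by linarith)) fun p' hp' => ?_
        refine hGτ τ hτ0 (min_le_right _ _) _ ((min_le_left _ _).trans ?_)
        have := hother z p hz p' (Finset.ne_of_mem_erase hp')
        calc ρ ^ 2 / 4 = (ρ / 2) ^ 2 := by ring
          _ ≤ _ := by gcongr
      have hB : (Λ.mult p : ℝ) * -G (‖z - p‖ ^ 2) ≤
          Λ.mult p * (q * Real.log (2 * T / ε ^ 2)) :=
        mul_le_mul_of_nonneg_left (hGε _ (by positivity)) (Nat.cast_nonneg _)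
      by_cases hpS : p ∈ S
      · rw [← Finset.sum_erase_add S _ hpS]
        linarith
      · rw [Finset.erase_eq_of_notMem hpS] at hA
        have : (0 : ℝ) ≤ Λ.mult p * (q * Real.log (2 * T / ε ^ 2)) := by positivity
        linarith
    -- The product is `(2T)^{mq} ε^{2m(1-q)}` with `m` the multiplicity of `p`; as `m ≥ 1` and `ε ≤
    -- 1`, the power of `ε` is at most `ε^{2(1-q)}`. This is where `q < 1` matters.
    have hpow : Real.exp (Λ.mult p * (q * Real.log (2 * T / ε ^ 2))) * ε ^ (2 * Λ.mult p) ≤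
        (max 1 (2 * T)) ^ m * ε ^ (2 * (1 - q)) := by
      have e1 : Real.exp (Λ.mult p * (q * Real.log (2 * T / ε ^ 2))) * ε ^ (2 * Λ.mult p) =
          (2 * T) ^ (Λ.mult p * q) * ε ^ (2 * Λ.mult p * (1 - q)) := by
        rw [Real.log_div (by positivity) (by positivity), Real.log_pow,
          ← Real.rpow_natCast ε (2 * Λ.mult p), Real.rpow_def_of_pos (by positivity : 0 < 2 * T),
          Real.rpow_def_of_pos hε, Real.rpow_def_of_pos hε, ← Real.exp_add, ← Real.exp_add]
        congr 1
        push_cast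
        ring
      rw [e1]
      have hp1 : (1 : ℝ) ≤ Λ.mult p := by exact_mod_cast hp
      refine mul_le_mul ?_ ?_ (by positivity) (by positivity)
      · calc (2 * T) ^ (Λ.mult p * q) ≤ (max 1 (2 * T)) ^ (Λ.mult p * q) :=
              Real.rpow_le_rpow (by positivity) (le_max_right _ _) (by positivity)
          _ ≤ (max 1 (2 * T)) ^ m :=
              Real.rpow_le_rpow_of_exponent_le (le_max_left _ _)
                ((mul_le_of_le_one_right (Nat.cast_nonneg _) hq1.le).trans (hmult p))
      · refine Real.rpow_le_rpow_of_exponent_ge hε hε1 ?_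
        nlinarith
    calc _ ≤ Real.exp (N * b + Λ.mult p * (q * Real.log (2 * T / ε ^ 2))) *
          ε ^ (2 * Λ.mult p) := by gcongr
      _ = Real.exp (N * b) * (Real.exp (Λ.mult p * (q * Real.log (2 * T / ε ^ 2))) *
          ε ^ (2 * Λ.mult p)) := by rw [Real.exp_add, mul_assoc]
      _ ≤ Real.exp (N * b) * ((max 1 (2 * T)) ^ m * ε ^ (2 * (1 - q))) := by gcongr
      _ = _ := by ring
  · rw [hlap]
    have hd := hdens z
    have hLz := hM z
    rw [pi_mul_nuConvChi hr ((mul_pos_iff_of_pos_left Real.pi_pos).1 (by linarith)) S fun p hp => by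
      rw [hS, Set.Finite.mem_toFinset]
      change dist (p : ℂ) 0 ≤ R + r
      rw [dist_zero_right]
      have := norm_sub_norm_le (p : ℂ) z
      rw [norm_sub_rev] at this
      linarith] at hd
    have h1 : ∑ p ∈ S, (Λ.mult p : ℝ) * (k (‖z - p‖ ^ 2) + ‖z - p‖ ^ 2 * k' (‖z - p‖ ^ 2)) ≤
        -(θ * ∑ p ∈ S, (Λ.mult p : ℝ) * if ‖z - p‖ < r then 1 / r ^ 2 else 0) := by
      rw [Finset.mul_sum, ← Finset.sum_neg_distrib]
      refine Finset.sum_le_sum fun p _ => ?_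
      rcases Nat.eq_zero_or_pos (Λ.mult p) with h0 | h0
      · simp [h0]
      · have hε2 : ε ^ 2 ≤ ‖z - p‖ ^ 2 := by
          have := hzp p h0
          gcongr
        rw [show ∀ x : ℝ, -(θ * ((Λ.mult p : ℝ) * x)) = Λ.mult p * (-(θ * x)) by intro x; ring]
        refine mul_le_mul_of_nonneg_left ?_ (Nat.cast_nonneg _)
        split_ifs with hlt
        · rw [mul_one_div]
          exact hkr _ hε2 (by gcongr)
        · rw [mul_zero, neg_zero]
          exact hk0 _ hε2
    -- The sum is below `-θ (L z + δ)`, and the choice of `θ` makes this at most `-L z - δ / 2`.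
    nlinarith
  · rw [hlap]
    -- The points other than `p` are at distance at least `ε`, where their Laplacians are
    -- nonpositive; only `p` can contribute positively.
    have h1 : ∑ p' ∈ S, (Λ.mult p' : ℝ) *
        (k (‖z - p'‖ ^ 2) + ‖z - p'‖ ^ 2 * k' (‖z - p'‖ ^ 2)) ≤
        ∑ p' ∈ S, if p' = p then m * (C / ε ^ 2) else 0 := by
      refine Finset.sum_le_sum fun p' _ => ?_
      split_ifs with he
      · have := hkC (‖z - p'‖ ^ 2) (by positivity)
        calc _ ≤ (Λ.mult p' : ℝ) * (C / ε ^ 2) := by gcongr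
          _ ≤ _ := by
            have := hmult p'
            gcongr
      · refine mul_nonpos_of_nonneg_of_nonpos (Nat.cast_nonneg _) (hk0 _ ?_)
        have := hother z p hz p' he
        have : ε ≤ ‖z - p'‖ := by linarith
        gcongr
    have h2 : ∑ p' ∈ S, (if p' = p then m * (C / ε ^ 2) else 0) ≤ m * (C / ε ^ 2) := by
      rw [Finset.sum_ite_eq']
      split_ifs
      · exact le_rfl
      · positivity
    have h3 : M ≤ M / ε ^ 2 := by
      rw [le_div_iff₀ (by positivity)]
      exact mul_le_of_le_one_right hM0.le (pow_le_one₀ hε.le hε1)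
    have := (hM z).2
    rw [add_div, mul_div_assoc]
    linarith

/-! ### Cutoff estimate and conclusion -/

lemma tendsto_setIntegral_ball {g : ℂ → ℝ} (hg : Integrable g) :
    Tendsto (fun n : ℕ => ∫ z in Metric.ball (0 : ℂ) (n + 1), g z) atTop (𝓝 (∫ z, g z)) := by
  have hU : ⋃ n : ℕ, Metric.ball (0 : ℂ) ((n : ℝ) + 1) = Set.univ := by
    refine Set.eq_univ_of_forall fun z => Set.mem_iUnion.2 ?_
    obtain ⟨n, hn⟩ := exists_nat_gt ‖z‖
    exact ⟨n, by rw [mem_ball_zero_iff]; linarith⟩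
  have := tendsto_setIntegral_of_monotone (μ := volume) (f := g)
    (s := fun n : ℕ => Metric.ball (0 : ℂ) ((n : ℝ) + 1)) (fun _ => measurableSet_ball)
    (fun a b hab => Metric.ball_subset_ball (by
      have : (a : ℝ) ≤ b := by exact_mod_cast hab
      linarith)) (by rw [hU]; exact hg.integrableOn)
  rwa [hU, setIntegral_univ] at this

lemma MultSet.sampleEnergy_nonneg (Λ : MultSet) (φ : ℂ → ℝ) (f : ℂ → ℂ) (p : Λ.carrier) :
    0 ≤ Λ.sampleEnergy φ f p :=
  Finset.sum_nonneg fun _ _ => by positivity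

/-- Subharmonicity estimate for `|f|² e^{-φ - v}` against a cutoff function. -/
lemma cutoff_estimate {Λ : MultSet} {φ L : ℂ → ℝ} (hφ : Subharmonic φ)
    (h : IsDistribLaplacian φ L) (hL : Continuous L) {M : ℝ} (hM : ∀ z, |L z| ≤ M) {f : ℂ → ℂ}
    (hf : MemFock φ f) {v κ : ℂ → ℝ} (hv : ContDiff ℝ 2 v) (hκ : ContDiff ℝ 2 κ)
    (hc : HasCompactSupport κ) (h0 : ∀ z, 0 ≤ κ z) (h1 : ∀ z, κ z ≤ 1) {δ A B K ε R : ℝ}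
    (hδ : 0 < δ) (hA : 0 < A) (hε : 0 < ε) (hε1 : ε ≤ 1)
    (hκR : ∀ z, R ≤ ‖z‖ → κ z = 0) (hK : ∀ z, |quarterLaplacian κ z| ≤ K)
    (hv0 : ∀ z, v z ≤ 0) (hvB : ∀ z, Real.exp (-v z) ≤ B)
    (hfar : ∀ z : ℂ, ‖z‖ ≤ R → (∀ p : Λ.carrier, 1 ≤ Λ.mult p → ε ≤ ‖z - p‖) →
      L z + quarterLaplacian v z ≤ -δ)
    (hnear : ∀ z : ℂ, ∀ p : Λ.carrier, ‖z - p‖ < ε → L z + quarterLaplacian v z ≤ A / ε ^ 2)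
    {H : Λ.carrier → ℝ} (hH0 : ∀ p, 0 ≤ H p)
    (hH : ∀ p : Λ.carrier, 1 ≤ Λ.mult p → ∀ z : ℂ, ‖z - p‖ < ε →
      ‖f z‖ ^ 2 * Real.exp (-(φ z + v z)) ≤ H p)
    (S : Finset Λ.carrier) (hS : ∀ p : Λ.carrier, ‖(p : ℂ)‖ ≤ R + ε → p ∈ S) :
    δ * ∫ z, κ z * (‖f z‖ ^ 2 * Real.exp (-φ z)) ≤
      (A + δ) * Real.pi * ∑ p ∈ S, H p + K * B * fockNormSq φ f := by
  have cφ : Continuous φ := (contDiff_one_of_distribLaplacian hφ h hL).continuous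
  have cf : Continuous f := hf.1.continuous
  have key := integral_weight_nonneg hφ h hL hM hf.1 hv hκ hc h0
  have iw : Integrable fun z => κ z * (‖f z‖ ^ 2 * Real.exp (-φ z)) := by
    have cκ := hκ.continuous
    exact Continuous.integrable_of_hasCompactSupport (by fun_prop) hc.mul_right
  set u : ℂ → ℝ := fun z => ‖f z‖ ^ 2 * Real.exp (-(φ z + v z)) with hu
  set w : ℂ → ℝ := fun z => ‖f z‖ ^ 2 * Real.exp (-φ z) with hw
  have hw0 : ∀ z, 0 ≤ w z := fun z => by positivity
  have hwu : ∀ z, w z ≤ u z := fun z => by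
    have := hv0 z
    simp only [hu, hw]
    gcongr
    linarith
  have huB : ∀ z, u z ≤ B * w z := fun z => by
    have e : u z = Real.exp (-v z) * w z := by
      simp only [hu, hw]
      rw [neg_add, Real.exp_add]
      ring
    rw [e]
    exact mul_le_mul_of_nonneg_right (hvB z) (hw0 z)
  have hB0 : 0 ≤ B := (Real.exp_pos _).le.trans (hvB 0)
  have hK0 : 0 ≤ K := (abs_nonneg _).trans (hK 0)
  -- Covers `A / ε ^ 2` from the positive Laplacian and also the term `-δ κ w`, which is placed on
  -- the right side even on the discs. The area `π ε²` cancels the denominator.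
  set a : ℝ := (A + δ) / ε ^ 2 with ha
  have ha0 : 0 ≤ a := by positivity
  set g : Λ.carrier → ℂ → ℝ := fun p =>
    (Metric.ball (p : ℂ) ε).indicator fun _ => a * H p with hg
  have hg0 : ∀ p z, 0 ≤ g p z := fun p z =>
    Set.indicator_nonneg (fun _ _ => mul_nonneg ha0 (hH0 p)) z
  have ig : ∀ p, Integrable (g p) := fun p =>
    (integrable_indicator_iff measurableSet_ball).2 (integrableOn_const measure_ball_lt_top.ne)
  have hgi : ∀ p, ∫ z, g p z = (A + δ) * Real.pi * H p := fun p => by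
    simp only [hg]
    rw [integral_indicator measurableSet_ball, setIntegral_const, volume_real_ball _ hε.le,
      smul_eq_mul, ha]
    field_simp
  have pointwise : ∀ z, (κ z * (L z + quarterLaplacian v z) + quarterLaplacian κ z) * u z ≤
      -(δ * (κ z * w z)) + ∑ p ∈ S, g p z + K * B * w z := by
    intro z
    have hu0 : 0 ≤ u z := (hw0 z).trans (hwu z)
    have t1 : quarterLaplacian κ z * u z ≤ K * B * w z := by
      calc quarterLaplacian κ z * u z ≤ K * u z :=
            mul_le_mul_of_nonneg_right ((le_abs_self _).trans (hK z)) hu0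
        _ ≤ K * (B * w z) := mul_le_mul_of_nonneg_left (huB z) hK0
        _ = _ := by ring
    have hsum0 : 0 ≤ ∑ p ∈ S, g p z := Finset.sum_nonneg fun p _ => hg0 p z
    have t2 : κ z * (L z + quarterLaplacian v z) * u z ≤ -(δ * (κ z * w z)) + ∑ p ∈ S, g p z := by
      rcases le_or_gt R ‖z‖ with hz | hz
      · rw [hκR z hz]
        simpa using hsum0
      · by_cases hn : ∀ p : Λ.carrier, 1 ≤ Λ.mult p → ε ≤ ‖z - p‖
        · have := hfar z hz.le hn
          have e1 : κ z * (L z + quarterLaplacian v z) * u z ≤ κ z * -δ * u z :=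
            mul_le_mul_of_nonneg_right (mul_le_mul_of_nonneg_left this (h0 z)) hu0
          have e2 : κ z * δ * w z ≤ κ z * δ * u z :=
            mul_le_mul_of_nonneg_left (hwu z) (mul_nonneg (h0 z) hδ.le)
          linarith
        · push Not at hn
          obtain ⟨p, hp, hpz⟩ := hn
          have hpS : p ∈ S := hS p (by
            have := norm_sub_norm_le (p : ℂ) z
            rw [norm_sub_rev] at this
            linarith)
          have e1 : g p z ≤ ∑ p ∈ S, g p z :=
            Finset.single_le_sum (f := fun p => g p z) (fun p _ => hg0 p z) hpS
          have e2 : g p z = a * H p := by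
            refine Set.indicator_of_mem ?_ _
            rwa [Metric.mem_ball, dist_eq_norm]
          have e3 : κ z * (L z + quarterLaplacian v z) * u z ≤ κ z * (A / ε ^ 2) * u z :=
            mul_le_mul_of_nonneg_right (mul_le_mul_of_nonneg_left (hnear z p hpz) (h0 z)) hu0
          have e4 : δ ≤ δ / ε ^ 2 := by
            rw [le_div_iff₀ (by positivity)]
            exact mul_le_of_le_one_right hδ.le (pow_le_one₀ hε.le hε1)
          have e5 : κ z * (δ * w z) ≤ κ z * (δ / ε ^ 2 * u z) :=
            mul_le_mul_of_nonneg_left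
              (mul_le_mul e4 (hwu z) (hw0 z) (by positivity)) (h0 z)
          have e6 : κ z * (a * u z) ≤ 1 * (a * H p) :=
            mul_le_mul (h1 z) (mul_le_mul_of_nonneg_left (hH p hp z hpz) ha0)
              (mul_nonneg ha0 hu0) zero_le_one
          have e7 : κ z * (a * u z) = κ z * (A / ε ^ 2) * u z + κ z * (δ / ε ^ 2 * u z) := by
            rw [ha]; ring
          linarith
    rw [add_mul]
    linarith
  have i1 : Integrable fun z => -(δ * (κ z * w z)) := (iw.const_mul δ).neg
  have i2 : Integrable fun z => ∑ p ∈ S, g p z := integrable_finsetSum S fun p _ => ig p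
  have i3 : Integrable fun z => K * B * w z := hf.2.const_mul _
  have hi : Integrable fun z =>
      (κ z * (L z + quarterLaplacian v z) + quarterLaplacian κ z) * u z := by
    have c1 := continuous_quarterLaplacian hv
    have c2 := continuous_quarterLaplacian hκ
    have c3 := hκ.continuous
    have c4 := hv.continuous
    refine Continuous.integrable_of_hasCompactSupport (by fun_prop) ?_
    exact (hc.mul_right.add (hasCompactSupport_quarterLaplacian hc)).mul_right
  have := key.trans (integral_mono hi ((i1.add i2).add i3) pointwise)
  simp only [Pi.add_apply] at this
  rw [integral_add (f := fun z => -(δ * (κ z * w z)) + ∑ p ∈ S, g p z) (i1.add i2) i3,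
    integral_add i1 i2, integral_neg, integral_const_mul,
    integral_const_mul, integral_finsetSum S fun p _ => ig p, Finset.sum_congr rfl fun p _ => hgi p,
    ← Finset.mul_sum] at this
  simp only [fockNormSq]
  linarith

theorem isSampling {φ : ℂ → ℝ} (hφ : Subharmonic φ) {Λ : MultSet} (hsep : Λ.Separated)
    (hcomp : Compatible Λ φ) {L : ℂ → ℝ} (h : IsDistribLaplacian φ L) (hL : Continuous L)
    {δ r : ℝ} (hδ : 0 < δ) (hr : 0 < r) (hdens : ∀ z, Real.pi * Λ.nuConvChi r z > L z + δ) :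
    IsSampling Λ φ := by
  obtain ⟨ρ, hρ, hs⟩ := hsep
  obtain ⟨⟨L', h', c, M, hc, hb⟩, hn⟩ := hcomp
  have hLb := distribLaplacian_bounds h h' hL hb
  have hLM : ∀ z, 0 < L z ∧ L z ≤ M := fun z => ⟨hc.trans_le (hLb z).1, (hLb z).2⟩
  have habs : ∀ z, |L z| ≤ M := fun z => by rw [abs_of_pos (hLM z).1]; exact (hLM z).2
  have hnL : 2 ≤ Λ.n → ContDiff ℝ ((Λ.n + 1 : ℕ) : ℕ∞) φ ∧ ∀ j : ℕ, 1 ≤ j → j ≤ Λ.n - 1 →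
      ∃ C : ℝ, ∀ z, ‖wirtinger^[j] (fun w => (quarterLaplacian φ w : ℂ)) z‖ ≤ C := hn
  -- Small enough for the gauge on unit discs and for disjointness of the discs about the points of
  -- `Λ`.
  set R : ℝ := min 1 ρ / 2 with hR
  have hR0 : 0 < R := by rw [hR]; positivity
  have hR1 : R < 1 := by rw [hR]; linarith [min_le_left 1 ρ]
  have hRρ : 2 * R ≤ ρ := by rw [hR]; linarith [min_le_right 1 ρ]
  obtain ⟨C, hC, hloc⟩ := exists_local_estimates hφ h hL habs Λ.n hnL hR0 hR1
  obtain ⟨s, A, W, hs0, hA, hW, hpot⟩ := exists_potential hρ hs hLM hδ hr hdens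
  obtain ⟨Cκ, hCκ, hcut⟩ := exists_cutoff
  have hpi := Real.pi_pos
  -- All constants involved are independent of `ε`, and `s > 0`, so the local-norm terms can be made
  -- at most `δ / 4`, half of the gain `δ / 2`. Only afterwards does the bound `B` of `e^{-v}`
  -- enter; it depends on `ε` but not on the cutoff scale.
  obtain ⟨ε, hε, hε1, hεr, hερ, hεR, hεs⟩ : ∃ ε : ℝ, 0 < ε ∧ ε ≤ 1 ∧ ε ≤ r ∧ 2 * ε ≤ ρ ∧
      ε ≤ R / 4 ∧ (A + δ / 2) * Real.pi * (C * W * ε ^ s) ≤ δ / 4 := by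
    have lim : Tendsto (fun ε : ℝ => (A + δ / 2) * Real.pi * (C * W * ε ^ s)) (𝓝[>] 0) (𝓝 0) := by
      have := (Real.continuousAt_rpow_const 0 s (Or.inr hs0.le)).tendsto
      rw [Real.zero_rpow hs0.ne'] at this
      have := ((this.mono_left (nhdsWithin_le_nhds (s := Set.Ioi 0))).const_mul (C * W)).const_mul
        ((A + δ / 2) * Real.pi)
      simpa using this
    have ev : ∀ x : ℝ, 0 < x → ∀ᶠ ε in 𝓝[>] (0 : ℝ), ε < x := fun x hx =>
      (eventually_of_mem (Ioo_mem_nhdsGT hx) fun _ => And.right)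
    obtain ⟨ε, e1, e2, e3, e4, e5, e6⟩ := ((eventually_mem_nhdsWithin (a := (0 : ℝ)) (s := Set.Ioi 0)).and
      ((ev 1 one_pos).and ((ev r hr).and ((ev (ρ / 2) (by positivity)).and
        ((ev (R / 4) (by positivity)).and (lim.eventually_lt_const (u := δ / 4)
          (by positivity))))))).exists
    exact ⟨ε, e1, e2.le, e3.le, by linarith, e5.le, e6.le⟩
  obtain ⟨B, hB, hpot⟩ := hpot ε hε hε1 hεr hερ
  set D : ℝ := (A + δ / 2) * Real.pi * (B * C) with hD
  have hD0 : 0 < D := by positivity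
  refine ⟨δ / 4 / D, (Λ.n + 1) * C, by positivity, by positivity, fun f hf => ?_⟩
  set w : ℂ → ℝ := fun z => ‖f z‖ ^ 2 * Real.exp (-φ z) with hw
  have hw0 : ∀ z, 0 ≤ w z := fun z => by positivity
  set E := Λ.sampleEnergy φ f with hE
  have hE0 : ∀ p, 0 ≤ E p := Λ.sampleEnergy_nonneg φ f
  set I : Λ.carrier → ℝ := fun p => ∫ z in Metric.ball (p : ℂ) R, w z with hI
  have hI0 : ∀ p, 0 ≤ I p := fun p => integral_nonneg hw0
  -- Disjoint discs: this gives the upper sampling bound and also controls the remainder in the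
  -- lower one.
  have hsumI : ∀ F : Finset Λ.carrier, ∑ p ∈ F, I p ≤ fockNormSq φ f := fun F =>
    sum_setIntegral_ball_le hs hRρ hf.2 hw0 F
  have hEI : ∀ p, E p ≤ (Λ.n + 1) * C * I p := fun p => by
    have h1 : E p ≤ ∑ _j ∈ Finset.range (Λ.mult p), C * I p :=
      Finset.sum_le_sum fun j hj => (hloc f hf.1 p).1 j (by
        have := Finset.mem_range.1 hj
        have := Λ.mult_le p
        omega)
    rw [Finset.sum_const, Finset.card_range, nsmul_eq_mul] at h1
    have h2 : (Λ.mult p : ℝ) ≤ Λ.n + 1 := by exact_mod_cast Λ.mult_le p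
    have := mul_le_mul_of_nonneg_right h2 (mul_nonneg hC.le (hI0 p))
    linarith
  have hfin : ∀ F : Finset Λ.carrier, ∑ p ∈ F, E p ≤ (Λ.n + 1) * C * fockNormSq φ f := fun F =>
    calc ∑ p ∈ F, E p ≤ ∑ p ∈ F, (Λ.n + 1) * C * I p := Finset.sum_le_sum fun p _ => hEI p
      _ = (Λ.n + 1) * C * ∑ p ∈ F, I p := by rw [Finset.mul_sum]
      _ ≤ _ := mul_le_mul_of_nonneg_left (hsumI F) (by positivity)
  have hsm : Summable E := summable_of_sum_le hE0 hfin
  refine ⟨hsm, ?_, hsm.tsum_le_of_sum_le hfin⟩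
  have main : ∀ n : ℕ, δ / 2 * ∫ z in Metric.ball (0 : ℂ) ((n : ℝ) + 1), w z ≤
      D * ∑' p, E p + δ / 4 * fockNormSq φ f + Cκ * B * fockNormSq φ f * (1 / ((n : ℝ) + 1)) := by
    intro n
    set ℓ : ℝ := (n : ℝ) + 1 with hℓ
    have hℓ1 : 1 ≤ ℓ := by rw [hℓ]; linarith [(Nat.cast_nonneg n : (0 : ℝ) ≤ n)]
    have hℓ0 : 0 < ℓ := by linarith
    obtain ⟨κ, cκ, hκc, hκ0, hκ1, hκin, hκout, hκΔ⟩ := hcut ℓ hℓ0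
    obtain ⟨v, cv, hv0, hvB, hvp, hvfar, hvnear⟩ := hpot (2 * ℓ) (by linarith)
    have hfS := finite_of_separated hρ hs (T := 2 * ℓ + ε) (by linarith) 0
    have est := cutoff_estimate (Λ := Λ) hφ h hL habs hf cv (cκ.of_le (by norm_cast)) hκc hκ0 hκ1
      (half_pos hδ) hA hε hε1 hκout hκΔ hv0 hvB hvfar hvnear
      -- The jet part is weighted with the crude bound `B` of `e^{-v}`, the remainder with the
      -- refined bound on the disc.
      (H := fun p => B * C * E p + C * W * ε ^ s * I p)
      (fun p => by have := hE0 p; have := hI0 p; positivity)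
      (fun p hp z hz => by
        have h1 := (hloc f hf.1 p).2 (Λ.mult p) (Λ.mult_le p) z (hz.le.trans hεR)
        have h2 : ‖z - p‖ ^ (2 * Λ.mult p) ≤ ε ^ (2 * Λ.mult p) := by gcongr
        have h3 : w z ≤ C * E p + C * ε ^ (2 * Λ.mult p) * I p :=
          h1.trans (add_le_add le_rfl (mul_le_mul_of_nonneg_right
            (mul_le_mul_of_nonneg_left h2 hC.le) (hI0 p)))
        have h4 : Real.exp (-v z) * (C * E p) ≤ B * (C * E p) :=
          mul_le_mul_of_nonneg_right (hvB z) (mul_nonneg hC.le (hE0 p))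
        have h5 := mul_le_mul_of_nonneg_right (hvp p hp z hz) (mul_nonneg hC.le (hI0 p))
        calc ‖f z‖ ^ 2 * Real.exp (-(φ z + v z)) = Real.exp (-v z) * w z := by
              simp only [hw]
              rw [neg_add, Real.exp_add]
              ring
          _ ≤ Real.exp (-v z) * (C * E p + C * ε ^ (2 * Λ.mult p) * I p) := by gcongr
          _ ≤ _ := by linarith)
      hfS.toFinset (fun p hp => by
        rw [Set.Finite.mem_toFinset]
        change dist (p : ℂ) 0 ≤ 2 * ℓ + ε
        rwa [dist_zero_right])
    rw [Finset.sum_add_distrib, ← Finset.mul_sum, ← Finset.mul_sum] at est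
    have hN0 : 0 ≤ fockNormSq φ f := integral_nonneg hw0
    have e1 : ∫ z in Metric.ball (0 : ℂ) ℓ, w z ≤ ∫ z, κ z * w z := by
      rw [← integral_indicator measurableSet_ball]
      refine integral_mono (hf.2.indicator measurableSet_ball) ?_ fun z => ?_
      · refine hf.2.mono' ?_ (Eventually.of_forall fun z => ?_)
        · exact cκ.continuous.aestronglyMeasurable.mul hf.2.aestronglyMeasurable
        · rw [Real.norm_of_nonneg (mul_nonneg (hκ0 z) (hw0 z))]
          exact mul_le_of_le_one_left (hw0 z) (hκ1 z)
      · by_cases hz : z ∈ Metric.ball (0 : ℂ) ℓ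
        · rw [Set.indicator_of_mem hz, hκin z (mem_ball_zero_iff.1 hz).le, one_mul]
        · rw [Set.indicator_of_notMem hz]
          exact mul_nonneg (hκ0 z) (hw0 z)
    have e2 : ∑ p ∈ hfS.toFinset, E p ≤ ∑' p, E p := hsm.sum_le_tsum _ fun p _ => hE0 p
    have e3 := hsumI hfS.toFinset
    -- A weaker decay rate, sufficient for the limit since `ℓ ≥ 1`.
    have e4 : Cκ / ℓ ^ 2 ≤ Cκ * (1 / ℓ) := by
      rw [div_eq_mul_one_div]
      gcongr
      nlinarith
    have f1 := mul_le_mul_of_nonneg_left e1 (half_pos hδ).le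
    have f2 := mul_le_mul_of_nonneg_left e2 hD0.le
    have f3 := mul_le_mul_of_nonneg_left e3
      (by positivity : 0 ≤ (A + δ / 2) * Real.pi * (C * W * ε ^ s))
    have f4 := mul_le_mul_of_nonneg_right hεs hN0
    have f5 := mul_le_mul_of_nonneg_right e4 (mul_nonneg hB.le hN0)
    rw [hD] at f2 ⊢
    linarith
  -- As the scale grows the cutoff error vanishes; subtracting `δ / 4` of the norm leaves the lower
  -- bound with constant `δ / 4 / D`.
  have lim := le_of_tendsto_of_tendsto' ((tendsto_setIntegral_ball hf.2).const_mul (δ / 2))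
    ((tendsto_one_div_add_atTop_nhds_zero_nat.const_mul
      (Cκ * B * fockNormSq φ f)).const_add (D * ∑' p, E p + δ / 4 * fockNormSq φ f)) main
  rw [mul_zero, add_zero] at lim
  rw [div_mul_eq_mul_div, div_le_iff₀ hD0]
  simp only [fockNormSq] at lim ⊢
  linarith

end FockSampling

end

theorem mainTheorem6 (φ : ℂ → ℝ) (hφ : FockSampling.Subharmonic φ)
    (Λ : FockSampling.MultSet) (hsep : Λ.Separated) (hcomp : FockSampling.Compatible Λ φ)
    (lapφ : ℂ → ℝ) (hlap : FockSampling.IsDistribLaplacian φ lapφ) (hcont : Continuous lapφ)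
    (δ r : ℝ) (hδ : 0 < δ) (hr : 0 < r)
    (hdens : ∀ z : ℂ, Real.pi * Λ.nuConvChi r z > lapφ z + δ) :
    FockSampling.IsSampling Λ φ :=
  FockSampling.isSampling hφ hsep hcomp hlap hcont hδ hr hdens
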